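/- **Conventions.** Double categories are pseudo: $\mathbb D$ has a category $\mathbb D_0$ of objects and arrows and a category $\mathbb D_1$ of proarrows $x \to\!\!\!\!\mid\ y$ and cells, with an external composition $\odot$ and external identities that are associative and unital up to coherent isomorphism. A *colax functor* preserves $\odot$ and external identities up to coherent globular comparison cells $F(m\odot n)\to Fm\odot Fn$ and $F(\mathrm{id}_x)\to \mathrm{id}_{Fx}$; it is *pseudo* if these are invertible. A natural transformation of colax functors has an arrow at each object and a cell at each proarrow, natural and compatible with the comparison cells. The *double category of families* $\mathbb{F}\mathsf{am}(\mathbb D)$ has as objects set-indexed families $(I,(x_i)_{i\in I})$ of objects of $\mathbb D$; as arrows $(I,x)\to(J,y)$ a function $f_0:I\to J$ with arrows $f_i:x_i\to y_{f_0(i)}$; as proarrows $(I,x)\to\!\!\!\!\mid\ (J,y)$ a span of sets $I\xleftarrow{\ell}A\xrightarrow{r}J$ with proarrows $m_a: x_{\ell(a)}\to\!\!\!\!\mid\ y_{r(a)}$; as cells a map of spans with a family of cells of $\mathbb D$ over it. Proarrows are composed by pulling back the spans and composing in $\mathbb D$. The pseudo functor $\Delta:\mathbb D\to\mathbb{F}\mathsf{am}(\mathbb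 D)$ sends objects and proarrows to singleton families. A colax functor $F$ induces a colax functor $\mathbb{F}\mathsf{am}(F)$ by postcomposition. $\mathbb D$ *has colax coproducts* if $\Delta$ has a left adjoint $\Sigma$ in the 2-category of double categories, colax functors and natural transformations; the coproducts are *strong* if $\Sigma$ is pseudo. A colax functor $F:\mathbb C\to\mathbb E$ between double categories with colax coproducts *preserves coproducts* if the canonical comparison $\Sigma\,\mathbb{F}\mathsf{am}(F)\Rightarrow F\,\Sigma$, the mate of the identity $\mathbb{F}\mathsf{am}(F)\,\Delta=\Delta F$, is a natural isomorphism. A colax functor $J:\mathbb D\to\mathbb C$ *exhibits $\mathbb C$ as the free coproduct completion of $\mathbb D$* if $\mathbb C$ has colax coproducts and, for every colax functor $F:\mathbb D\to\mathbb E$ into a double category $\mathbb E$ with colax coproducts: 1. there is a coproduct-preserving colax functor $\hat F:\mathbb C\to\mathbb E$ with a natural isomorphism $\hat F J\cong F$; 2. if every proarrow of $\mathbb E$ can be transported along isomorphisms of its source and target (that is, for every proarrow $n:x\to\!\!\!\!\mid\ y$ and isomorphisms $f:x'\cong x$, $g:y'\cong y$ there are a proarrow $n':x'\to\!\!\!\!\mid\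 y'$ and an invertible cell $n'\cong n$ with sides $f$ and $g$), then $\hat F$ can be chosen with $\hat F J=F$; 3. for any two coproduct-preserving colax functors $G,H:\mathbb C\to\mathbb E$ with natural isomorphisms $\sigma:GJ\cong F$ and $\tau:HJ\cong F$, there is a natural isomorphism $\theta:G\cong H$ with $\tau\circ\theta J=\sigma$. **Theorem.** Let $\mathbb D$ be any double category. Then $\mathbb{F}\mathsf{am}(\mathbb D)$ has strong coproducts, and $\Delta:\mathbb D\to\mathbb{F}\mathsf{am}(\mathbb D)$ exhibits $\mathbb{F}\mathsf{am}(\mathbb D)$ as the free coproduct completion of $\mathbb D$. Moreover, for the terminal double category $\mathbb 1$ and the double category $\mathbb{S}\mathsf{pan}$ of sets, functions, spans and maps of spans, there is a (strict) isomorphism of double categories $\mathbb{F}\mathsf{am}(\mathbb 1)\cong\mathbb{S}\mathsf{pan}$ that carries $\Delta$ to the functor $\mathbb 1\to\mathbb{S}\mathsf{pan}$ picking out the singleton set. Hence $\mathbb{S}\mathsf{pan}$ has strong coproducts, and this functor exhibits it as the free coproduct completion of $\mathbb 1$. -/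

import Mathlib

open CategoryTheory

universe i u v w z u₁ v₁ w₁ z₁ u₂ v₂ w₂ z₂ u₃ v₃ w₃ z₃ u₄ v₄ w₄ z₄

namespace Dbl

/-- A proarrow with unspecified source and target, for a family `P x y` of types of proarrows
`x ⇸ y`.  These are the objects of the category `D₁` of a double category. -/
structure Proarr {O : Type u} (P : O → O → Type w) where
  of ::
  {src : O}
  {tgt : O}
  (pro : P src tgt)

/-- A pseudo double category: a pseudocategory in categories, with category of objects and arrows
`Obj`, category of proarrows and cells `Proarr Pro`, source and target functors (`left`, `right` on
cells), and an external composition (diagrammatic order) and external identities that are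
associative and unital up to coherent globular isomorphism. -/
structure DblCat where
  Obj : Type u
  [cat : Category.{v} Obj]
  Pro : Obj → Obj → Type w
  [catPro : Category.{z} (Proarr Pro)]
  left : ∀ {m n : Proarr Pro}, (m ⟶ n) → (m.src ⟶ n.src)
  right : ∀ {m n : Proarr Pro}, (m ⟶ n) → (m.tgt ⟶ n.tgt)
  left_id : ∀ m : Proarr Pro, left (𝟙 m) = 𝟙 m.src
  right_id : ∀ m : Proarr Pro, right (𝟙 m) = 𝟙 m.tgt
  left_comp : ∀ {m n p : Proarr Pro} (α : m ⟶ n) (β : n ⟶ p), left (α ≫ β) = left α ≫ left β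
  right_comp : ∀ {m n p : Proarr Pro} (α : m ⟶ n) (β : n ⟶ p),
    right (α ≫ β) = right α ≫ right β
  /-- external composition of proarrows -/
  hcomp : ∀ {x y t : Obj}, Pro x y → Pro y t → Pro x t
  /-- external composition of cells that share a boundary arrow -/
  hcompCell : ∀ {x y t x' y' t' : Obj} {m : Pro x y} {n : Pro y t} {m' : Pro x' y'}
    {n' : Pro y' t'} (α : Proarr.of m ⟶ Proarr.of m') (β : Proarr.of n ⟶ Proarr.of n'),
    right α = left β → (Proarr.of (hcomp m n) ⟶ Proarr.of (hcomp m' n'))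
  left_hcompCell : ∀ {x y t x' y' t' : Obj} {m : Pro x y} {n : Pro y t} {m' : Pro x' y'}
    {n' : Pro y' t'} (α : Proarr.of m ⟶ Proarr.of m') (β : Proarr.of n ⟶ Proarr.of n')
    (h : right α = left β), left (hcompCell α β h) = left α
  right_hcompCell : ∀ {x y t x' y' t' : Obj} {m : Pro x y} {n : Pro y t} {m' : Pro x' y'}
    {n' : Pro y' t'} (α : Proarr.of m ⟶ Proarr.of m') (β : Proarr.of n ⟶ Proarr.of n')
    (h : right α = left β), right (hcompCell α β h) = right β
  hcompCell_id : ∀ {x y t : Obj} (m : Pro x y) (n : Pro y t),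
    hcompCell (𝟙 (Proarr.of m)) (𝟙 (Proarr.of n)) (by rw [right_id, left_id]) =
      𝟙 (Proarr.of (hcomp m n))
  hcompCell_comp : ∀ {x y t x' y' t' x'' y'' t'' : Obj} {m : Pro x y} {n : Pro y t}
    {m' : Pro x' y'} {n' : Pro y' t'} {m'' : Pro x'' y''} {n'' : Pro y'' t''}
    (α : Proarr.of m ⟶ Proarr.of m') (β : Proarr.of n ⟶ Proarr.of n')
    (α' : Proarr.of m' ⟶ Proarr.of m'') (β' : Proarr.of n' ⟶ Proarr.of n'')
    (h : right α = left β) (h' : right α' = left β'),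
    hcompCell (α ≫ α') (β ≫ β') (by rw [right_comp, left_comp, h, h']) =
      hcompCell α β h ≫ hcompCell α' β' h'
  /-- external identity proarrow -/
  hid : ∀ x : Obj, Pro x x
  /-- external identity cell on an arrow -/
  hidCell : ∀ {x y : Obj}, (x ⟶ y) → (Proarr.of (hid x) ⟶ Proarr.of (hid y))
  left_hidCell : ∀ {x y : Obj} (f : x ⟶ y), left (hidCell f) = f
  right_hidCell : ∀ {x y : Obj} (f : x ⟶ y), right (hidCell f) = f
  hidCell_id : ∀ x : Obj, hidCell (𝟙 x) = 𝟙 (Proarr.of (hid x))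
  hidCell_comp : ∀ {x y t : Obj} (f : x ⟶ y) (g : y ⟶ t),
    hidCell (f ≫ g) = hidCell f ≫ hidCell g
  /-- associators -/
  assoc : ∀ {x y t s : Obj} (m : Pro x y) (n : Pro y t) (p : Pro t s),
    Proarr.of (hcomp (hcomp m n) p) ≅ Proarr.of (hcomp m (hcomp n p))
  left_assoc : ∀ {x y t s : Obj} (m : Pro x y) (n : Pro y t) (p : Pro t s),
    left (assoc m n p).hom = 𝟙 x
  right_assoc : ∀ {x y t s : Obj} (m : Pro x y) (n : Pro y t) (p : Pro t s),
    right (assoc m n p).hom = 𝟙 s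
  assoc_naturality : ∀ {x y t s x' y' t' s' : Obj} {m : Pro x y} {n : Pro y t} {p : Pro t s}
    {m' : Pro x' y'} {n' : Pro y' t'} {p' : Pro t' s'} (α : Proarr.of m ⟶ Proarr.of m')
    (β : Proarr.of n ⟶ Proarr.of n') (γ : Proarr.of p ⟶ Proarr.of p')
    (h : right α = left β) (h' : right β = left γ),
    hcompCell (hcompCell α β h) γ (by rw [right_hcompCell, h']) ≫ (assoc m' n' p').hom =
      (assoc m n p).hom ≫ hcompCell α (hcompCell β γ h') (by rw [left_hcompCell, h])
  /-- left unitors -/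
  lunit : ∀ {x y : Obj} (m : Pro x y), Proarr.of (hcomp (hid x) m) ≅ Proarr.of m
  left_lunit : ∀ {x y : Obj} (m : Pro x y), left (lunit m).hom = 𝟙 x
  right_lunit : ∀ {x y : Obj} (m : Pro x y), right (lunit m).hom = 𝟙 y
  lunit_naturality : ∀ {x y x' y' : Obj} {m : Pro x y} {m' : Pro x' y'}
    (α : Proarr.of m ⟶ Proarr.of m'),
    hcompCell (hidCell (left α)) α (by rw [right_hidCell]) ≫ (lunit m').hom =
      (lunit m).hom ≫ α
  /-- right unitors -/
  runit : ∀ {x y : Obj} (m : Pro x y), Proarr.of (hcomp m (hid y)) ≅ Proarr.of m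
  left_runit : ∀ {x y : Obj} (m : Pro x y), left (runit m).hom = 𝟙 x
  right_runit : ∀ {x y : Obj} (m : Pro x y), right (runit m).hom = 𝟙 y
  runit_naturality : ∀ {x y x' y' : Obj} {m : Pro x y} {m' : Pro x' y'}
    (α : Proarr.of m ⟶ Proarr.of m'),
    hcompCell α (hidCell (right α)) (by rw [left_hidCell]) ≫ (runit m').hom =
      (runit m).hom ≫ α
  pentagon : ∀ {x y t s r : Obj} (m : Pro x y) (n : Pro y t) (p : Pro t s) (q : Pro s r),
    hcompCell (assoc m n p).hom (𝟙 (Proarr.of q)) (by rw [right_assoc, left_id]) ≫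
      (assoc m (hcomp n p) q).hom ≫
        hcompCell (𝟙 (Proarr.of m)) (assoc n p q).hom (by rw [left_assoc, right_id]) =
      (assoc (hcomp m n) p q).hom ≫ (assoc m n (hcomp p q)).hom
  triangle : ∀ {x y t : Obj} (m : Pro x y) (n : Pro y t),
    (assoc m (hid y) n).hom ≫
        hcompCell (𝟙 (Proarr.of m)) (lunit n).hom (by rw [left_lunit, right_id]) =
      hcompCell (runit m).hom (𝟙 (Proarr.of n)) (by rw [right_runit, left_id])

attribute [instance] DblCat.cat DblCat.catPro

namespace DblCat

attribute [simp] left_id right_id left_comp right_comp left_hcompCell right_hcompCell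
  hcompCell_id left_hidCell right_hidCell hidCell_id left_assoc right_assoc left_lunit
  right_lunit left_runit right_runit

@[simp] theorem left_assoc_inv (D : DblCat.{u, v, w, z}) {x y t s : D.Obj} (m : D.Pro x y)
    (n : D.Pro y t) (p : D.Pro t s) : D.left (D.assoc m n p).inv = 𝟙 x := by
  have h := congrArg D.left (D.assoc m n p).hom_inv_id
  rw [D.left_comp, D.left_id, D.left_assoc] at h
  exact (Category.id_comp _).symm.trans h

@[simp] theorem right_assoc_inv (D : DblCat.{u, v, w, z}) {x y t s : D.Obj} (m : D.Pro x y)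
    (n : D.Pro y t) (p : D.Pro t s) : D.right (D.assoc m n p).inv = 𝟙 s := by
  have h := congrArg D.right (D.assoc m n p).hom_inv_id
  rw [D.right_comp, D.right_id, D.right_assoc] at h
  exact (Category.id_comp _).symm.trans h

@[simp] theorem left_lunit_inv (D : DblCat.{u, v, w, z}) {x y : D.Obj} (m : D.Pro x y) :
    D.left (D.lunit m).inv = 𝟙 x := by
  have h := congrArg D.left (D.lunit m).hom_inv_id
  rw [D.left_comp, D.left_id, D.left_lunit] at h
  exact (Category.id_comp _).symm.trans h

@[simp] theorem right_lunit_inv (D : DblCat.{u, v, w, z}) {x y : D.Obj} (m : D.Pro x y) :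
    D.right (D.lunit m).inv = 𝟙 y := by
  have h := congrArg D.right (D.lunit m).hom_inv_id
  rw [D.right_comp, D.right_id, D.right_lunit] at h
  exact (Category.id_comp _).symm.trans h

@[simp] theorem left_runit_inv (D : DblCat.{u, v, w, z}) {x y : D.Obj} (m : D.Pro x y) :
    D.left (D.runit m).inv = 𝟙 x := by
  have h := congrArg D.left (D.runit m).hom_inv_id
  rw [D.left_comp, D.left_id, D.left_runit] at h
  exact (Category.id_comp _).symm.trans h

@[simp] theorem right_runit_inv (D : DblCat.{u, v, w, z}) {x y : D.Obj} (m : D.Pro x y) :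
    D.right (D.runit m).inv = 𝟙 y := by
  have h := congrArg D.right (D.runit m).hom_inv_id
  rw [D.right_comp, D.right_id, D.right_runit] at h
  exact (Category.id_comp _).symm.trans h

theorem hcompCell_congr (D : DblCat.{u, v, w, z}) {x y t x' y' t' : D.Obj} {m : D.Pro x y}
    {n : D.Pro y t} {m' : D.Pro x' y'} {n' : D.Pro y' t'}
    {α α' : Proarr.of m ⟶ Proarr.of m'} {β β' : Proarr.of n ⟶ Proarr.of n'}
    (hα : α = α') (hβ : β = β') (h : D.right α = D.left β) :
    D.hcompCell α β h = D.hcompCell α' β' (by rw [← hα, ← hβ, h]) := by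
  subst hα hβ
  rfl

end DblCat

/-- A colax double functor: it preserves vertical composition strictly, and has globular
comparison cells `F (m ⊙ n) ⟶ F m ⊙ F n` and `F (id x) ⟶ id (F x)` that are natural, coassociative
and counital. -/
@[ext]
structure ColaxFunctor (C : DblCat.{u₁, v₁, w₁, z₁}) (D : DblCat.{u₂, v₂, w₂, z₂}) where
  obj : C.Obj → D.Obj
  map : ∀ {x y : C.Obj}, (x ⟶ y) → (obj x ⟶ obj y)
  map_id : ∀ x : C.Obj, map (𝟙 x) = 𝟙 (obj x)
  map_comp : ∀ {x y t : C.Obj} (f : x ⟶ y) (g : y ⟶ t), map (f ≫ g) = map f ≫ map g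
  pro : ∀ {x y : C.Obj}, C.Pro x y → D.Pro (obj x) (obj y)
  cell : ∀ {x y x' y' : C.Obj} {m : C.Pro x y} {m' : C.Pro x' y'},
    (Proarr.of m ⟶ Proarr.of m') → (Proarr.of (pro m) ⟶ Proarr.of (pro m'))
  cell_id : ∀ {x y : C.Obj} (m : C.Pro x y), cell (𝟙 (Proarr.of m)) = 𝟙 (Proarr.of (pro m))
  cell_comp : ∀ {x y x' y' x'' y'' : C.Obj} {m : C.Pro x y} {m' : C.Pro x' y'}
    {m'' : C.Pro x'' y''} (α : Proarr.of m ⟶ Proarr.of m') (β : Proarr.of m' ⟶ Proarr.of m''),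
    cell (α ≫ β) = cell α ≫ cell β
  left_cell : ∀ {x y x' y' : C.Obj} {m : C.Pro x y} {m' : C.Pro x' y'}
    (α : Proarr.of m ⟶ Proarr.of m'), D.left (cell α) = map (C.left α)
  right_cell : ∀ {x y x' y' : C.Obj} {m : C.Pro x y} {m' : C.Pro x' y'}
    (α : Proarr.of m ⟶ Proarr.of m'), D.right (cell α) = map (C.right α)
  /-- composition comparison -/
  cmp : ∀ {x y t : C.Obj} (m : C.Pro x y) (n : C.Pro y t),
    Proarr.of (pro (C.hcomp m n)) ⟶ Proarr.of (D.hcomp (pro m) (pro n))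
  left_cmp : ∀ {x y t : C.Obj} (m : C.Pro x y) (n : C.Pro y t),
    D.left (cmp m n) = 𝟙 (obj x)
  right_cmp : ∀ {x y t : C.Obj} (m : C.Pro x y) (n : C.Pro y t),
    D.right (cmp m n) = 𝟙 (obj t)
  cmp_naturality : ∀ {x y t x' y' t' : C.Obj} {m : C.Pro x y} {n : C.Pro y t}
    {m' : C.Pro x' y'} {n' : C.Pro y' t'} (α : Proarr.of m ⟶ Proarr.of m')
    (β : Proarr.of n ⟶ Proarr.of n') (h : C.right α = C.left β),
    cell (C.hcompCell α β h) ≫ cmp m' n' =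
      cmp m n ≫ D.hcompCell (cell α) (cell β) (by rw [right_cell, left_cell, h])
  /-- identity comparison -/
  idcmp : ∀ x : C.Obj, Proarr.of (pro (C.hid x)) ⟶ Proarr.of (D.hid (obj x))
  left_idcmp : ∀ x : C.Obj, D.left (idcmp x) = 𝟙 (obj x)
  right_idcmp : ∀ x : C.Obj, D.right (idcmp x) = 𝟙 (obj x)
  idcmp_naturality : ∀ {x y : C.Obj} (f : x ⟶ y),
    cell (C.hidCell f) ≫ idcmp y = idcmp x ≫ D.hidCell (map f)
  coassoc : ∀ {x y t s : C.Obj} (m : C.Pro x y) (n : C.Pro y t) (p : C.Pro t s),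
    cmp (C.hcomp m n) p ≫
        D.hcompCell (cmp m n) (𝟙 (Proarr.of (pro p))) (by rw [right_cmp, D.left_id]) ≫
          (D.assoc (pro m) (pro n) (pro p)).hom =
      cell (C.assoc m n p).hom ≫ cmp m (C.hcomp n p) ≫
        D.hcompCell (𝟙 (Proarr.of (pro m))) (cmp n p) (by rw [left_cmp, D.right_id])
  left_counit : ∀ {x y : C.Obj} (m : C.Pro x y),
    cmp (C.hid x) m ≫
        D.hcompCell (idcmp x) (𝟙 (Proarr.of (pro m))) (by rw [right_idcmp, D.left_id]) ≫
          (D.lunit (pro m)).hom =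
      cell (C.lunit m).hom
  right_counit : ∀ {x y : C.Obj} (m : C.Pro x y),
    cmp m (C.hid y) ≫
        D.hcompCell (𝟙 (Proarr.of (pro m))) (idcmp y) (by rw [left_idcmp, D.right_id]) ≫
          (D.runit (pro m)).hom =
      cell (C.runit m).hom

namespace ColaxFunctor

attribute [simp] map_id cell_id left_cell right_cell left_cmp right_cmp left_idcmp right_idcmp

theorem map_comp_assoc {C : DblCat.{u₁, v₁, w₁, z₁}} {D : DblCat.{u₂, v₂, w₂, z₂}}
    (F : ColaxFunctor C D) {x y t : C.Obj} (f : x ⟶ y) (g : y ⟶ t) {s : D.Obj}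
    (h : F.obj t ⟶ s) : F.map (f ≫ g) ≫ h = F.map f ≫ F.map g ≫ h := by
  rw [F.map_comp, Category.assoc]

theorem cell_comp_assoc {C : DblCat.{u₁, v₁, w₁, z₁}} {D : DblCat.{u₂, v₂, w₂, z₂}}
    (F : ColaxFunctor C D) {x y x' y' x'' y'' : C.Obj} {m : C.Pro x y} {m' : C.Pro x' y'}
    {m'' : C.Pro x'' y''} (α : Proarr.of m ⟶ Proarr.of m') (β : Proarr.of m' ⟶ Proarr.of m'')
    {p : Proarr D.Pro} (γ : Proarr.of (F.pro m'') ⟶ p) :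
    F.cell (α ≫ β) ≫ γ = F.cell α ≫ F.cell β ≫ γ := by
  rw [F.cell_comp, Category.assoc]

/-- A colax functor is pseudo when its comparison cells are invertible. -/
def IsPseudo {C : DblCat.{u₁, v₁, w₁, z₁}} {D : DblCat.{u₂, v₂, w₂, z₂}}
    (F : ColaxFunctor C D) : Prop :=
  (∀ {x y t : C.Obj} (m : C.Pro x y) (n : C.Pro y t), IsIso (F.cmp m n)) ∧
    ∀ x : C.Obj, IsIso (F.idcmp x)

/-- A colax functor is strict when its comparison cells are identities. -/
def IsStrict {C : DblCat.{u₁, v₁, w₁, z₁}} {D : DblCat.{u₂, v₂, w₂, z₂}}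
    (F : ColaxFunctor C D) : Prop :=
  (∀ {x y t : C.Obj} (m : C.Pro x y) (n : C.Pro y t),
    ∃ h : F.pro (C.hcomp m n) = D.hcomp (F.pro m) (F.pro n),
      F.cmp m n = eqToHom (congrArg Proarr.of h)) ∧
    ∀ x : C.Obj, ∃ h : F.pro (C.hid x) = D.hid (F.obj x),
      F.idcmp x = eqToHom (congrArg Proarr.of h)

/-- The identity double functor. -/
def idFunctor (C : DblCat.{u₁, v₁, w₁, z₁}) : ColaxFunctor C C where
  obj x := x
  map f := f
  map_id _ := rfl
  map_comp _ _ := rfl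
  pro m := m
  cell α := α
  cell_id _ := rfl
  cell_comp _ _ := rfl
  left_cell _ := rfl
  right_cell _ := rfl
  cmp _ _ := 𝟙 _
  left_cmp m n := C.left_id _
  right_cmp m n := C.right_id _
  cmp_naturality _ _ _ := by simp
  idcmp _ := 𝟙 _
  left_idcmp _ := C.left_id _
  right_idcmp _ := C.right_id _
  idcmp_naturality _ := by simp
  coassoc _ _ _ := by simp
  left_counit _ := by simp
  right_counit _ := by simp

/-- Composition of colax double functors, in diagrammatic order. -/
def comp {B : DblCat.{u₁, v₁, w₁, z₁}} {C : DblCat.{u₂, v₂, w₂, z₂}}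
    {D : DblCat.{u₃, v₃, w₃, z₃}} (F : ColaxFunctor B C) (G : ColaxFunctor C D) :
    ColaxFunctor B D where
  obj x := G.obj (F.obj x)
  map f := G.map (F.map f)
  map_id _ := by simp
  map_comp _ _ := by rw [F.map_comp, G.map_comp]
  pro m := G.pro (F.pro m)
  cell α := G.cell (F.cell α)
  cell_id _ := by simp
  cell_comp _ _ := by rw [F.cell_comp, G.cell_comp]
  left_cell _ := by simp
  right_cell _ := by simp
  cmp m n := G.cell (F.cmp m n) ≫ G.cmp (F.pro m) (F.pro n)
  left_cmp m n := by simp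
  right_cmp m n := by simp
  cmp_naturality α β h := by
    rw [← Category.assoc, ← G.cell_comp, F.cmp_naturality, G.cell_comp, Category.assoc,
      G.cmp_naturality, Category.assoc]
  idcmp x := G.cell (F.idcmp x) ≫ G.idcmp (F.obj x)
  left_idcmp x := by simp
  right_idcmp x := by simp
  idcmp_naturality f := by
    rw [← Category.assoc, ← G.cell_comp, F.idcmp_naturality, G.cell_comp, Category.assoc,
      G.idcmp_naturality, Category.assoc]
  coassoc m n p := by
    have e₁ := D.hcompCell_comp (G.cell (F.cmp m n)) (G.cell (𝟙 (Proarr.of (F.pro p))))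
      (G.cmp (F.pro m) (F.pro n)) (𝟙 (Proarr.of (G.pro (F.pro p)))) (by simp) (by simp)
    have e₂ := D.hcompCell_comp (G.cell (𝟙 (Proarr.of (F.pro m)))) (G.cell (F.cmp n p))
      (𝟙 (Proarr.of (G.pro (F.pro m)))) (G.cmp (F.pro n) (F.pro p)) (by simp) (by simp)
    have n₁ := G.cmp_naturality (F.cmp m n) (𝟙 (Proarr.of (F.pro p))) (by simp)
    have n₂ := G.cmp_naturality (𝟙 (Proarr.of (F.pro m))) (F.cmp n p) (by simp)
    have c := congrArg G.cell (F.coassoc m n p)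
    simp only [G.cell_comp] at c
    simp only [G.cell_id, Category.comp_id] at e₁ e₂ n₁ n₂
    rw [e₁, e₂]
    simp only [Category.assoc]
    rw [← reassoc_of% n₁, G.coassoc, ← reassoc_of% n₂, reassoc_of% c]
  left_counit m := by
    have e₁ := D.hcompCell_comp (G.cell (F.idcmp _)) (G.cell (𝟙 (Proarr.of (F.pro m))))
      (G.idcmp _) (𝟙 (Proarr.of (G.pro (F.pro m)))) (by simp) (by simp)
    have n₁ := G.cmp_naturality (F.idcmp _) (𝟙 (Proarr.of (F.pro m))) (by simp)
    have c := congrArg G.cell (F.left_counit m)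
    simp only [G.cell_comp] at c
    simp only [G.cell_id, Category.comp_id] at e₁ n₁
    rw [e₁]
    simp only [Category.assoc]
    rw [← reassoc_of% n₁, G.left_counit, c]
  right_counit m := by
    have e₁ := D.hcompCell_comp (G.cell (𝟙 (Proarr.of (F.pro m)))) (G.cell (F.idcmp _))
      (𝟙 (Proarr.of (G.pro (F.pro m)))) (G.idcmp _) (by simp) (by simp)
    have n₁ := G.cmp_naturality (𝟙 (Proarr.of (F.pro m))) (F.idcmp _) (by simp)
    have c := congrArg G.cell (F.right_counit m)
    simp only [G.cell_comp] at c
    simp only [G.cell_id, Category.comp_id] at e₁ n₁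
    rw [e₁]
    simp only [Category.assoc]
    rw [← reassoc_of% n₁, G.right_counit, c]

end ColaxFunctor

/-- A natural transformation of colax double functors: it has arrow components at objects and cell
components at proarrows, is natural with respect to arrows and cells, and is compatible with the
comparison cells. -/
@[ext]
structure DblTrans {C : DblCat.{u₁, v₁, w₁, z₁}} {D : DblCat.{u₂, v₂, w₂, z₂}}
    (F G : ColaxFunctor C D) where
  app : ∀ x : C.Obj, F.obj x ⟶ G.obj x
  naturality : ∀ {x y : C.Obj} (f : x ⟶ y), F.map f ≫ app y = app x ≫ G.map f
  appPro : ∀ {x y : C.Obj} (m : C.Pro x y), Proarr.of (F.pro m) ⟶ Proarr.of (G.pro m)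
  left_appPro : ∀ {x y : C.Obj} (m : C.Pro x y), D.left (appPro m) = app x
  right_appPro : ∀ {x y : C.Obj} (m : C.Pro x y), D.right (appPro m) = app y
  naturalityPro : ∀ {x y x' y' : C.Obj} {m : C.Pro x y} {m' : C.Pro x' y'}
    (α : Proarr.of m ⟶ Proarr.of m'), F.cell α ≫ appPro m' = appPro m ≫ G.cell α
  comp_cmp : ∀ {x y t : C.Obj} (m : C.Pro x y) (n : C.Pro y t),
    F.cmp m n ≫ D.hcompCell (appPro m) (appPro n) (by rw [right_appPro, left_appPro]) =
      appPro (C.hcomp m n) ≫ G.cmp m n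
  comp_idcmp : ∀ x : C.Obj,
    F.idcmp x ≫ D.hidCell (app x) = appPro (C.hid x) ≫ G.idcmp x

namespace DblTrans

attribute [simp] left_appPro right_appPro

/-- Natural transformations of colax functors compose componentwise. -/
instance (C : DblCat.{u₁, v₁, w₁, z₁}) (D : DblCat.{u₂, v₂, w₂, z₂}) :
    Category (ColaxFunctor C D) where
  Hom F G := DblTrans F G
  id F :=
    { app := fun _ => 𝟙 _
      naturality := fun _ => by simp
      appPro := fun _ => 𝟙 _
      left_appPro := fun _ => D.left_id _
      right_appPro := fun _ => D.right_id _
      naturalityPro := fun _ => by simp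
      comp_cmp := fun _ _ => by simp
      comp_idcmp := fun _ => by simp }
  comp {F G H} α β :=
    { app := fun x => α.app x ≫ β.app x
      naturality := fun f => by
        rw [← Category.assoc, α.naturality, Category.assoc, β.naturality, Category.assoc]
      appPro := fun m => α.appPro m ≫ β.appPro m
      left_appPro := fun m => by simp
      right_appPro := fun m => by simp
      naturalityPro := fun a => by
        rw [← Category.assoc, α.naturalityPro, Category.assoc, β.naturalityPro, Category.assoc]
      comp_cmp := fun m n => by
        rw [D.hcompCell_comp _ _ _ _ (by simp) (by simp), ← Category.assoc, α.comp_cmp,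
          Category.assoc, β.comp_cmp, Category.assoc]
      comp_idcmp := fun x => by
        rw [D.hidCell_comp, ← Category.assoc, α.comp_idcmp, Category.assoc, β.comp_idcmp,
          Category.assoc] }
  id_comp α := by ext <;> exact Category.id_comp _
  comp_id α := by ext <;> exact Category.comp_id _
  assoc α β γ := by ext <;> exact Category.assoc _ _ _

/-- Whiskering of a natural transformation with a colax functor on the domain side. -/
def whisker {B : DblCat.{u₁, v₁, w₁, z₁}} {C : DblCat.{u₂, v₂, w₂, z₂}}
    {D : DblCat.{u₃, v₃, w₃, z₃}} (J : ColaxFunctor B C) {G H : ColaxFunctor C D} (θ : G ⟶ H) :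
    J.comp G ⟶ J.comp H where
  app x := θ.app (J.obj x)
  naturality f := θ.naturality (J.map f)
  appPro m := θ.appPro (J.pro m)
  left_appPro m := θ.left_appPro (J.pro m)
  right_appPro m := θ.right_appPro (J.pro m)
  naturalityPro α := θ.naturalityPro (J.cell α)
  comp_cmp m n := by
    have h₁ := θ.comp_cmp (J.pro m) (J.pro n)
    have h₂ := θ.naturalityPro (J.cmp m n)
    simp only [ColaxFunctor.comp, Category.assoc]
    rw [h₁, reassoc_of% h₂]
  comp_idcmp x := by
    have h₁ := θ.comp_idcmp (J.obj x)
    have h₂ := θ.naturalityPro (J.idcmp x)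
    simp only [ColaxFunctor.comp, Category.assoc]
    rw [h₁, reassoc_of% h₂]

end DblTrans


/-! The double category of families. -/

/-- A set-indexed family of objects. -/
structure FamObj (D : DblCat.{u, v, w, z}) where
  idx : Type i
  fam : idx → D.Obj

/-- A morphism of families: a function of indexing sets and a family of arrows. -/
@[ext]
structure FamHom {D : DblCat.{u, v, w, z}} (X Y : FamObj.{i} D) where
  base : X.idx → Y.idx
  hom : ∀ k : X.idx, X.fam k ⟶ Y.fam (base k)

instance (D : DblCat.{u, v, w, z}) : Category (FamObj.{i} D) where
  Hom X Y := FamHom X Y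
  id X := ⟨fun k => k, fun k => 𝟙 (X.fam k)⟩
  comp f g := ⟨fun k => g.base (f.base k), fun k => f.hom k ≫ g.hom (f.base k)⟩
  id_comp f := by
    refine FamHom.ext rfl (heq_of_eq ?_)
    funext k
    exact Category.id_comp _
  comp_id f := by
    refine FamHom.ext rfl (heq_of_eq ?_)
    funext k
    exact Category.comp_id _
  assoc f g h := by
    refine FamHom.ext rfl (heq_of_eq ?_)
    funext k
    exact Category.assoc _ _ _

/-- A proarrow of families: a span `X.idx ← apex → Y.idx` with legs `l`, `r`, and a family
consisting of a proarrow `X.fam j ⇸ Y.fam k` for each element `a : j ⇸ k` of the span, that is,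
for each `a` with `l a = j` and `r a = k`. -/
structure FamPro {D : DblCat.{u, v, w, z}} (X Y : FamObj.{i} D) where
  apex : Type i
  l : apex → X.idx
  r : apex → Y.idx
  pro : ∀ (a : apex) {j : X.idx} {k : Y.idx}, l a = j → r a = k → D.Pro (X.fam j) (Y.fam k)

/-- A cell of families: a map of spans and a family of cells over it. -/
structure FamCell {D : DblCat.{u, v, w, z}} (M N : Proarr (FamPro.{i} (D := D))) where
  lhom : M.src ⟶ N.src
  rhom : M.tgt ⟶ N.tgt
  base : M.pro.apex → N.pro.apex
  l_base : ∀ a, N.pro.l (base a) = lhom.base (M.pro.l a)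
  r_base : ∀ a, N.pro.r (base a) = rhom.base (M.pro.r a)
  cell : ∀ (a : M.pro.apex) {j : M.src.idx} {k : M.tgt.idx} (hj : M.pro.l a = j)
    (hk : M.pro.r a = k), Proarr.of (M.pro.pro a hj hk) ⟶
      Proarr.of (N.pro.pro (base a) (j := lhom.base j) (k := rhom.base k)
        ((l_base a).trans (congrArg lhom.base hj)) ((r_base a).trans (congrArg rhom.base hk)))
  left_cell : ∀ (a : M.pro.apex) {j : M.src.idx} {k : M.tgt.idx} (hj : M.pro.l a = j)
    (hk : M.pro.r a = k), D.left (cell a hj hk) = lhom.hom j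
  right_cell : ∀ (a : M.pro.apex) {j : M.src.idx} {k : M.tgt.idx} (hj : M.pro.l a = j)
    (hk : M.pro.r a = k), D.right (cell a hj hk) = rhom.hom k

attribute [simp] FamCell.left_cell FamCell.right_cell

theorem FamCell.ext' {D : DblCat.{u, v, w, z}} {M N : Proarr (FamPro.{i} (D := D))}
    {α β : FamCell M N} (hl : α.lhom = β.lhom) (hr : α.rhom = β.rhom)
    (hb : ∀ a, α.base a = β.base a)
    (hc : ∀ (a : M.pro.apex) {j : M.src.idx} {k : M.tgt.idx} (hj : M.pro.l a = j)
      (hk : M.pro.r a = k), α.cell a hj hk ≍ β.cell a hj hk) : α = β := by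
  obtain ⟨l, r, b, _, _, c, _, _⟩ := α
  obtain ⟨l', r', b', _, _, c', _, _⟩ := β
  dsimp only at hl hr hb hc
  subst hl hr
  obtain rfl : b = b' := funext hb
  congr 1
  funext a j k hj hk
  exact eq_of_heq (hc a hj hk)

instance (D : DblCat.{u, v, w, z}) : Category (Proarr (FamPro.{i} (D := D))) where
  Hom M N := FamCell M N
  id M :=
    { lhom := 𝟙 _
      rhom := 𝟙 _
      base := fun a => a
      l_base := fun _ => rfl
      r_base := fun _ => rfl
      cell := fun a _ _ hj hk => 𝟙 (Proarr.of (M.pro.pro a hj hk))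
      left_cell := fun _ _ _ _ _ => D.left_id _
      right_cell := fun _ _ _ _ _ => D.right_id _ }
  comp {M N P} α β :=
    { lhom := α.lhom ≫ β.lhom
      rhom := α.rhom ≫ β.rhom
      base := fun a => β.base (α.base a)
      l_base := fun a => (β.l_base _).trans (congrArg β.lhom.base (α.l_base a))
      r_base := fun a => (β.r_base _).trans (congrArg β.rhom.base (α.r_base a))
      cell := fun a _ _ hj hk => α.cell a hj hk ≫ β.cell (α.base a) _ _
      left_cell := fun _ _ _ _ _ => by
        rw [D.left_comp, FamCell.left_cell, FamCell.left_cell]; rfl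
      right_cell := fun _ _ _ _ _ => by
        rw [D.right_comp, FamCell.right_cell, FamCell.right_cell]; rfl }
  id_comp α := FamCell.ext' (Category.id_comp _) (Category.id_comp _) (fun _ => rfl)
    (fun _ _ _ _ _ => heq_of_eq (Category.id_comp _))
  comp_id α := FamCell.ext' (Category.comp_id _) (Category.comp_id _) (fun _ => rfl)
    (fun _ _ _ _ _ => heq_of_eq (Category.comp_id _))
  assoc α β γ := FamCell.ext' (Category.assoc _ _ _) (Category.assoc _ _ _) (fun _ => rfl)
    (fun _ _ _ _ _ => heq_of_eq (Category.assoc _ _ _))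

/-- The pullback of a cospan of sets `A → J ← B`, as the set of compatible elements of the three
sets. -/
structure PullbackPt {A B J : Type i} (r : A → J) (l : B → J) where
  fst : A
  mid : J
  snd : B
  fst_eq : r fst = mid
  snd_eq : l snd = mid

theorem PullbackPt.ext' {A B J : Type i} {r : A → J} {l : B → J} {p q : PullbackPt r l}
    (h₁ : p.fst = q.fst) (h₂ : p.snd = q.snd) : p = q := by
  obtain ⟨a, j, b, ha, hb⟩ := p
  obtain ⟨a', j', b', ha', hb'⟩ := q
  dsimp only at h₁ h₂
  subst h₁ h₂ ha ha'
  rfl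

/-- The identity proarrow on `x a`, seen as a proarrow `x j ⇸ x k` when `a = j` and `a = k`. -/
def DblCat.hidOf (D : DblCat.{u, v, w, z}) {I : Type i} (x : I → D.Obj) :
    ∀ {a j k : I}, a = j → a = k → D.Pro (x j) (x k)
  | a, _, _, rfl, rfl => D.hid (x a)

namespace FamPro

variable {D : DblCat.{u, v, w, z}}

/-- External composition: pull back the indexing spans and compose proarrows componentwise. -/
def hcomp {X Y Z : FamObj.{i} D} (M : FamPro X Y) (N : FamPro Y Z) : FamPro X Z where
  apex := PullbackPt M.r N.l
  l p := M.l p.fst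
  r p := N.r p.snd
  pro p _ _ hj hk := D.hcomp (M.pro p.fst hj p.fst_eq) (N.pro p.snd p.snd_eq hk)

/-- The identity span with the family of identity proarrows. -/
def hid (X : FamObj.{i} D) : FamPro X X where
  apex := X.idx
  l a := a
  r a := a
  pro _ _ _ hj hk := D.hidOf X.fam hj hk

/-- Componentwise external composition of cells. -/
def hcompCell {X Y Z X' Y' Z' : FamObj.{i} D} {M : FamPro X Y} {N : FamPro Y Z}
    {M' : FamPro X' Y'} {N' : FamPro Y' Z'} (α : Proarr.of M ⟶ Proarr.of M')
    (β : Proarr.of N ⟶ Proarr.of N') (h : α.rhom = β.lhom) :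
    Proarr.of (hcomp M N) ⟶ Proarr.of (hcomp M' N') where
  lhom := α.lhom
  rhom := β.rhom
  base p := ⟨α.base p.fst, α.rhom.base p.mid, β.base p.snd,
    (α.r_base _).trans (congrArg α.rhom.base p.fst_eq),
    by rw [h]; exact (β.l_base _).trans (congrArg β.lhom.base p.snd_eq)⟩
  l_base p := α.l_base _
  r_base p := β.r_base _
  cell p j k hj hk := by
    obtain ⟨αl, αr, αb, αlb, αrb, αc, αlc, αrc⟩ := α
    obtain ⟨βl, βr, βb, βlb, βrb, βc, βlc, βrc⟩ := β
    dsimp only at h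
    subst h
    exact D.hcompCell (αc p.fst hj p.fst_eq) (βc p.snd p.snd_eq hk) 
      ((αrc p.fst hj p.fst_eq).trans (βlc p.snd p.snd_eq hk).symm)
  left_cell p j k hj hk := by
    obtain ⟨αl, αr, αb, αlb, αrb, αc, αlc, αrc⟩ := α
    obtain ⟨βl, βr, βb, βlb, βrb, βc, βlc, βrc⟩ := β
    dsimp only at h
    subst h
    exact (D.left_hcompCell _ _ _).trans (αlc p.fst hj p.fst_eq)
  right_cell p j k hj hk := by
    obtain ⟨αl, αr, αb, αlb, αrb, αc, αlc, αrc⟩ := α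
    obtain ⟨βl, βr, βb, βlb, βrb, βc, βlc, βrc⟩ := β
    dsimp only at h
    subst h
    exact (D.right_hcompCell _ _ _).trans (βrc p.snd p.snd_eq hk)

theorem hcompCell_cell {X Y Z X' Y' Z' : FamObj.{i} D} {M : FamPro X Y} {N : FamPro Y Z}
    {M' : FamPro X' Y'} {N' : FamPro Y' Z'} (α : Proarr.of M ⟶ Proarr.of M')
    (β : Proarr.of N ⟶ Proarr.of N') (h : α.rhom = β.lhom) (p : PullbackPt M.r N.l)
    {j : X.idx} {k : Z.idx} (hj : M.l p.fst = j) (hk : N.r p.snd = k)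
    (γ : Proarr.of (N.pro p.snd p.snd_eq hk) ⟶
      Proarr.of (N'.pro (β.base p.snd) (j := α.rhom.base p.mid) (k := β.rhom.base k)
        (by rw [h]; exact (β.l_base _).trans (congrArg β.lhom.base p.snd_eq))
        ((β.r_base _).trans (congrArg β.rhom.base hk))))
    (hγ : γ ≍ β.cell p.snd p.snd_eq hk)
    (hb : D.right (α.cell p.fst hj p.fst_eq) = D.left γ) :
    (hcompCell α β h).cell p hj hk = D.hcompCell (α.cell p.fst hj p.fst_eq) γ hb := by
  obtain ⟨αl, αr, αb, αlb, αrb, αc, αlc, αrc⟩ := α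
  obtain ⟨βl, βr, βb, βlb, βrb, βc, βlc, βrc⟩ := β
  dsimp only at h
  subst h
  obtain rfl := eq_of_heq hγ
  rfl

/-- External identity cell: identity cells componentwise. -/
def hidCell {X Y : FamObj.{i} D} (f : X ⟶ Y) : Proarr.of (hid X) ⟶ Proarr.of (hid Y) where
  lhom := f
  rhom := f
  base := f.base
  l_base _ := rfl
  r_base _ := rfl
  cell a _ _ hj hk :=
    match hj, hk with
    | rfl, rfl => D.hidCell (f.hom a)
  left_cell _ _ _ hj hk :=
    match hj, hk with
    | rfl, rfl => D.left_hidCell _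
  right_cell _ _ _ hj hk :=
    match hj, hk with
    | rfl, rfl => D.right_hidCell _

/-- Associators, componentwise. -/
def assoc {X Y Z W : FamObj.{i} D} (M : FamPro X Y) (N : FamPro Y Z) (P : FamPro Z W) :
    Proarr.of (hcomp (hcomp M N) P) ≅ Proarr.of (hcomp M (hcomp N P)) where
  hom :=
    { lhom := 𝟙 _
      rhom := 𝟙 _
      base := fun p => ⟨p.fst.fst, p.fst.mid, ⟨p.fst.snd, p.mid, p.snd, p.fst_eq, p.snd_eq⟩,
        p.fst.fst_eq, p.fst.snd_eq⟩
      l_base := fun _ => rfl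
      r_base := fun _ => rfl
      cell := fun p _ _ hj hk => (D.assoc (M.pro p.fst.fst hj p.fst.fst_eq)
        (N.pro p.fst.snd p.fst.snd_eq p.fst_eq) (P.pro p.snd p.snd_eq hk)).hom
      left_cell := fun _ _ _ _ _ => D.left_assoc _ _ _
      right_cell := fun _ _ _ _ _ => D.right_assoc _ _ _ }
  inv :=
    { lhom := 𝟙 _
      rhom := 𝟙 _
      base := fun p => ⟨⟨p.fst, p.mid, p.snd.fst, p.fst_eq, p.snd_eq⟩, p.snd.mid, p.snd.snd,
        p.snd.fst_eq, p.snd.snd_eq⟩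
      l_base := fun _ => rfl
      r_base := fun _ => rfl
      cell := fun p _ _ hj hk => (D.assoc (M.pro p.fst hj p.fst_eq)
        (N.pro p.snd.fst p.snd_eq p.snd.fst_eq) (P.pro p.snd.snd p.snd.snd_eq hk)).inv
      left_cell := fun _ _ _ _ _ => D.left_assoc_inv _ _ _
      right_cell := fun _ _ _ _ _ => D.right_assoc_inv _ _ _ }
  hom_inv_id := FamCell.ext' (Category.id_comp _) (Category.id_comp _) (fun _ => rfl)
    (fun _ _ _ _ _ => heq_of_eq (Iso.hom_inv_id _))
  inv_hom_id := FamCell.ext' (Category.id_comp _) (Category.id_comp _) (fun _ => rfl)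
    (fun _ _ _ _ _ => heq_of_eq (Iso.inv_hom_id _))

/-- Left unitors, componentwise. -/
def lunit {X Y : FamObj.{i} D} (M : FamPro X Y) :
    Proarr.of (hcomp (hid X) M) ≅ Proarr.of M where
  hom :=
    { lhom := 𝟙 _
      rhom := 𝟙 _
      base := fun p => p.snd
      l_base := fun p => p.snd_eq.trans p.fst_eq.symm
      r_base := fun _ => rfl
      cell := fun ⟨_, _, b, h₁, _⟩ _ _ hj hk =>
        match h₁, hj with
        | rfl, rfl => (D.lunit (M.pro b _ hk)).hom
      left_cell := fun ⟨_, _, b, h₁, _⟩ _ _ hj hk =>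
        match h₁, hj with
        | rfl, rfl => D.left_lunit _
      right_cell := fun ⟨_, _, b, h₁, _⟩ _ _ hj hk =>
        match h₁, hj with
        | rfl, rfl => D.right_lunit _ }
  inv :=
    { lhom := 𝟙 _
      rhom := 𝟙 _
      base := fun b => ⟨M.l b, M.l b, b, rfl, rfl⟩
      l_base := fun _ => rfl
      r_base := fun _ => rfl
      cell := fun b _ _ hj hk =>
        match hj with
        | rfl => (D.lunit (M.pro b rfl hk)).inv
      left_cell := fun b _ _ hj hk =>
        match hj with
        | rfl => D.left_lunit_inv _
      right_cell := fun b _ _ hj hk =>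
        match hj with
        | rfl => D.right_lunit_inv _ }
  hom_inv_id := FamCell.ext' (Category.id_comp _) (Category.id_comp _)
    (fun p => PullbackPt.ext' (p.snd_eq.trans p.fst_eq.symm) rfl)
    (by
      rintro ⟨a, b, c, rfl, h⟩ j k rfl rfl
      obtain rfl : M.l c = a := h
      exact heq_of_eq (Iso.hom_inv_id _))
  inv_hom_id := FamCell.ext' (Category.id_comp _) (Category.id_comp _) (fun _ => rfl)
    (by
      rintro a j k rfl rfl
      exact heq_of_eq (Iso.inv_hom_id _))

/-- Right unitors, componentwise. -/
def runit {X Y : FamObj.{i} D} (M : FamPro X Y) :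
    Proarr.of (hcomp M (hid Y)) ≅ Proarr.of M where
  hom :=
    { lhom := 𝟙 _
      rhom := 𝟙 _
      base := fun p => p.fst
      l_base := fun _ => rfl
      r_base := fun p => p.fst_eq.trans p.snd_eq.symm
      cell := fun ⟨a, _, _, _, h₂⟩ _ _ hj hk =>
        match h₂, hk with
        | rfl, rfl => (D.runit (M.pro a hj _)).hom
      left_cell := fun ⟨a, _, _, _, h₂⟩ _ _ hj hk =>
        match h₂, hk with
        | rfl, rfl => D.left_runit _
      right_cell := fun ⟨a, _, _, _, h₂⟩ _ _ hj hk =>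
        match h₂, hk with
        | rfl, rfl => D.right_runit _ }
  inv :=
    { lhom := 𝟙 _
      rhom := 𝟙 _
      base := fun a => ⟨a, M.r a, M.r a, rfl, rfl⟩
      l_base := fun _ => rfl
      r_base := fun _ => rfl
      cell := fun a _ _ hj hk =>
        match hk with
        | rfl => (D.runit (M.pro a hj rfl)).inv
      left_cell := fun a _ _ hj hk =>
        match hk with
        | rfl => D.left_runit_inv _
      right_cell := fun a _ _ hj hk =>
        match hk with
        | rfl => D.right_runit_inv _ }
  hom_inv_id := FamCell.ext' (Category.id_comp _) (Category.id_comp _)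
    (fun p => PullbackPt.ext' rfl (p.fst_eq.trans p.snd_eq.symm))
    (by
      rintro ⟨a, b, c, h, rfl⟩ j k rfl rfl
      obtain rfl : M.r a = c := h
      exact heq_of_eq (Iso.hom_inv_id _))
  inv_hom_id := FamCell.ext' (Category.id_comp _) (Category.id_comp _) (fun _ => rfl)
    (by
      rintro a j k rfl rfl
      exact heq_of_eq (Iso.inv_hom_id _))

end FamPro

/-- The double category of families in `D`, indexed by sets in `Type i`. -/
def DblFam (D : DblCat.{u, v, w, z}) :
    DblCat.{max u (i + 1), max v i, max w (i + 1), max z v i} where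
  Obj := FamObj.{i} D
  cat := inferInstance
  Pro := FamPro
  catPro := inferInstance
  left α := FamCell.lhom α
  right α := FamCell.rhom α
  left_id _ := rfl
  right_id _ := rfl
  left_comp _ _ := rfl
  right_comp _ _ := rfl
  hcomp := FamPro.hcomp
  hcompCell := FamPro.hcompCell
  left_hcompCell _ _ _ := rfl
  right_hcompCell _ _ _ := rfl
  hcompCell_id M N := FamCell.ext' rfl rfl (fun _ => rfl)
    (fun _ _ _ _ _ => heq_of_eq (D.hcompCell_id _ _))
  hcompCell_comp α β α' β' h h' := by
    obtain ⟨αl, αr, αb, αlb, αrb, αc, αlc, αrc⟩ := α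
    obtain ⟨βl, βr, βb, βlb, βrb, βc, βlc, βrc⟩ := β
    obtain ⟨αl', αr', αb', αlb', αrb', αc', αlc', αrc'⟩ := α'
    obtain ⟨βl', βr', βb', βlb', βrb', βc', βlc', βrc'⟩ := β'
    dsimp only at h h'
    subst h h'
    exact FamCell.ext' rfl rfl (fun _ => rfl)
      (fun _ _ _ _ _ => heq_of_eq (D.hcompCell_comp _ _ _ _ _ _))
  hid := FamPro.hid
  hidCell := FamPro.hidCell
  left_hidCell _ := rfl
  right_hidCell _ := rfl
  hidCell_id X := FamCell.ext' rfl rfl (fun _ => rfl) (by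
    rintro a j k rfl rfl
    exact heq_of_eq (D.hidCell_id _))
  hidCell_comp f g := FamCell.ext' rfl rfl (fun _ => rfl) (by
    rintro a j k rfl rfl
    exact heq_of_eq (D.hidCell_comp _ _))
  assoc := FamPro.assoc
  left_assoc _ _ _ := rfl
  right_assoc _ _ _ := rfl
  assoc_naturality α β γ h h' := by
    obtain ⟨αl, αr, αb, αlb, αrb, αc, αlc, αrc⟩ := α
    obtain ⟨βl, βr, βb, βlb, βrb, βc, βlc, βrc⟩ := β
    obtain ⟨γl, γr, γb, γlb, γrb, γc, γlc, γrc⟩ := γ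
    dsimp only at h h'
    subst h h'
    refine FamCell.ext' ?_ ?_ (fun _ => rfl) (fun _ _ _ _ _ => heq_of_eq ?_)
    · exact (Category.comp_id _).trans (Category.id_comp _).symm
    · exact (Category.comp_id _).trans (Category.id_comp _).symm
    · exact D.assoc_naturality _ _ _ _ _
  lunit := FamPro.lunit
  left_lunit _ := rfl
  right_lunit _ := rfl
  lunit_naturality {X Y X' Y' M M'} α := by
    refine FamCell.ext' ?_ ?_ (fun _ => rfl) ?_
    · exact (Category.comp_id _).trans (Category.id_comp _).symm
    · exact (Category.comp_id _).trans (Category.id_comp _).symm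
    · rintro ⟨a, b, c, rfl, h⟩ j k rfl rfl
      obtain rfl : M.l c = a := h
      refine heq_of_eq (Eq.trans ?_ (D.lunit_naturality (α.cell c rfl rfl)))
      exact congrArg (fun t => t ≫ _) (D.hcompCell_congr
        (congrArg D.hidCell (α.left_cell c rfl rfl).symm) rfl _)
  runit := FamPro.runit
  left_runit _ := rfl
  right_runit _ := rfl
  runit_naturality {X Y X' Y' M M'} α := by
    obtain ⟨αl, αr, αb, αlb, αrb, αc, αlc, αrc⟩ := α
    refine FamCell.ext' ?_ ?_ (fun _ => rfl) ?_
    · exact (Category.comp_id _).trans (Category.id_comp _).symm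
    · exact (Category.comp_id _).trans (Category.id_comp _).symm
    · rintro ⟨a, b, c, h, rfl⟩ j k rfl rfl
      obtain rfl : M.r a = c := h
      refine heq_of_eq (Eq.trans ?_ (D.runit_naturality (αc a rfl rfl)))
      exact congrArg (fun t => t ≫ _) (D.hcompCell_congr rfl
        (congrArg D.hidCell (αrc a rfl rfl).symm) _)
  pentagon M N P Q := by
    refine FamCell.ext' ?_ ?_ (fun _ => rfl) (fun _ _ _ _ _ => heq_of_eq ?_)
    · exact Category.id_comp _
    · exact Category.id_comp _
    · exact D.pentagon _ _ _ _
  triangle M N := by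
    refine FamCell.ext' ?_ ?_ ?_ ?_
    · exact Category.id_comp _
    · exact Category.id_comp _
    · rintro ⟨⟨a, b, c, h₁, h₂⟩, d, e, h₃, h₄⟩
      exact PullbackPt.ext' rfl rfl
    · rintro ⟨⟨a, b, c, h₁, rfl⟩, d, e, h₃, h₄⟩ j k rfl rfl
      obtain rfl : c = d := h₃
      exact heq_of_eq (D.triangle _ _)


/-- The singleton family of objects. -/
def single {D : DblCat.{u, v, w, z}} (x : D.Obj) : FamObj.{i} D :=
  ⟨PUnit, fun _ => x⟩

/-- The singleton family of proarrows, indexed by the span `1 ← 1 → 1`. -/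
def singlePro {D : DblCat.{u, v, w, z}} {x y : D.Obj} (m : D.Pro x y) :
    FamPro (single.{i} x) (single.{i} y) :=
  ⟨PUnit, fun _ => ⟨⟩, fun _ => ⟨⟩, fun _ _ _ _ _ => m⟩

/-- The singleton family of cells. -/
def singleCell {D : DblCat.{u, v, w, z}} {x y x' y' : D.Obj} {m : D.Pro x y} {m' : D.Pro x' y'}
    (α : Proarr.of m ⟶ Proarr.of m') :
    Proarr.of (singlePro.{i} m) ⟶ Proarr.of (singlePro.{i} m') where
  lhom := ⟨fun _ => ⟨⟩, fun _ => D.left α⟩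
  rhom := ⟨fun _ => ⟨⟩, fun _ => D.right α⟩
  base := fun _ => ⟨⟩
  l_base := fun _ => rfl
  r_base := fun _ => rfl
  cell := fun _ _ _ _ _ => α
  left_cell := fun _ _ _ _ _ => rfl
  right_cell := fun _ _ _ _ _ => rfl

/-- The embedding `Δ : D → DblFam D` as singleton families. -/
def Delta (D : DblCat.{u, v, w, z}) : ColaxFunctor D (DblFam.{i} D) where
  obj := single
  map f := ⟨fun _ => ⟨⟩, fun _ => f⟩
  map_id _ := rfl
  map_comp _ _ := rfl
  pro := singlePro
  cell := singleCell
  cell_id m := FamCell.ext' (FamHom.ext rfl (heq_of_eq (funext fun _ => D.left_id _)))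
    (FamHom.ext rfl (heq_of_eq (funext fun _ => D.right_id _))) (fun _ => rfl)
    (fun _ _ _ _ _ => HEq.rfl)
  cell_comp α β := FamCell.ext' (FamHom.ext rfl (heq_of_eq (funext fun _ => D.left_comp _ _)))
    (FamHom.ext rfl (heq_of_eq (funext fun _ => D.right_comp _ _))) (fun _ => rfl)
    (fun _ _ _ _ _ => HEq.rfl)
  left_cell _ := rfl
  right_cell _ := rfl
  cmp m n :=
    { lhom := 𝟙 _
      rhom := 𝟙 _
      base := fun _ => ⟨⟨⟩, ⟨⟩, ⟨⟩, rfl, rfl⟩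
      l_base := fun _ => rfl
      r_base := fun _ => rfl
      cell := fun _ _ _ _ _ => 𝟙 (Proarr.of (D.hcomp m n))
      left_cell := fun _ _ _ _ _ => D.left_id _
      right_cell := fun _ _ _ _ _ => D.right_id _ }
  left_cmp _ _ := rfl
  right_cmp _ _ := rfl
  cmp_naturality α β h := by
    refine FamCell.ext' ?_ ?_ (fun _ => rfl) (fun _ _ _ _ _ => heq_of_eq ?_)
    · refine FamHom.ext rfl (heq_of_eq (funext fun _ => ?_))
      exact (by simp : D.left (D.hcompCell α β h) ≫ 𝟙 _ = 𝟙 _ ≫ D.left α)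
    · refine FamHom.ext rfl (heq_of_eq (funext fun _ => ?_))
      exact (by simp : D.right (D.hcompCell α β h) ≫ 𝟙 _ = 𝟙 _ ≫ D.right β)
    · exact (Category.comp_id _).trans ((FamPro.hcompCell_cell (singleCell α) (singleCell β)
        (FamHom.ext rfl (heq_of_eq (funext fun _ => h))) ⟨⟨⟩, ⟨⟩, ⟨⟩, rfl, rfl⟩ rfl rfl β HEq.rfl
        h).symm.trans (Category.id_comp _).symm)
  idcmp x :=
    { lhom := 𝟙 _
      rhom := 𝟙 _
      base := fun _ => ⟨⟩
      l_base := fun _ => rfl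
      r_base := fun _ => rfl
      cell := fun _ _ _ hj hk =>
        match hj, hk with
        | rfl, rfl => 𝟙 (Proarr.of (D.hid x))
      left_cell := fun _ _ _ _ _ => D.left_id _
      right_cell := fun _ _ _ _ _ => D.right_id _ }
  left_idcmp _ := rfl
  right_idcmp _ := rfl
  idcmp_naturality f := by
    refine FamCell.ext' ?_ ?_ (fun _ => rfl) (fun _ _ _ _ _ => heq_of_eq ?_)
    · refine FamHom.ext rfl (heq_of_eq (funext fun _ => ?_))
      exact (by simp : D.left (D.hidCell f) ≫ 𝟙 _ = 𝟙 _ ≫ f)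
    · refine FamHom.ext rfl (heq_of_eq (funext fun _ => ?_))
      exact (by simp : D.right (D.hidCell f) ≫ 𝟙 _ = 𝟙 _ ≫ f)
    · exact (Category.comp_id _).trans (Category.id_comp _).symm
  coassoc m n p := by
    refine FamCell.ext' ?_ ?_ (fun _ => rfl) (fun _ _ _ _ _ => heq_of_eq ?_)
    · refine FamHom.ext rfl (heq_of_eq (funext fun _ => ?_))
      exact (by simp : 𝟙 _ ≫ 𝟙 _ ≫ 𝟙 _ = D.left (D.assoc m n p).hom ≫ 𝟙 _ ≫ 𝟙 _)
    · refine FamHom.ext rfl (heq_of_eq (funext fun _ => ?_))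
      exact (by simp : 𝟙 _ ≫ 𝟙 _ ≫ 𝟙 _ = D.right (D.assoc m n p).hom ≫ 𝟙 _ ≫ 𝟙 _)
    · exact (by simp : 𝟙 _ ≫ D.hcompCell (𝟙 _) (𝟙 _) _ ≫ (D.assoc m n p).hom =
        (D.assoc m n p).hom ≫ 𝟙 _ ≫ D.hcompCell (𝟙 _) (𝟙 _) _)
  left_counit m := by
    refine FamCell.ext' ?_ ?_ (fun _ => rfl) (fun _ _ _ _ _ => heq_of_eq ?_)
    · refine FamHom.ext rfl (heq_of_eq (funext fun _ => ?_))
      exact (by simp : 𝟙 _ ≫ 𝟙 _ ≫ 𝟙 _ = D.left (D.lunit m).hom)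
    · refine FamHom.ext rfl (heq_of_eq (funext fun _ => ?_))
      exact (by simp : 𝟙 _ ≫ 𝟙 _ ≫ 𝟙 _ = D.right (D.lunit m).hom)
    · exact (by simp : 𝟙 _ ≫ D.hcompCell (𝟙 _) (𝟙 _) _ ≫ (D.lunit m).hom = (D.lunit m).hom)
  right_counit m := by
    refine FamCell.ext' ?_ ?_ (fun _ => rfl) (fun _ _ _ _ _ => heq_of_eq ?_)
    · refine FamHom.ext rfl (heq_of_eq (funext fun _ => ?_))
      exact (by simp : 𝟙 _ ≫ 𝟙 _ ≫ 𝟙 _ = D.left (D.runit m).hom)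
    · refine FamHom.ext rfl (heq_of_eq (funext fun _ => ?_))
      exact (by simp : 𝟙 _ ≫ 𝟙 _ ≫ 𝟙 _ = D.right (D.runit m).hom)
    · exact (by simp : 𝟙 _ ≫ D.hcompCell (𝟙 _) (𝟙 _) _ ≫ (D.runit m).hom = (D.runit m).hom)

/-- The action of a colax functor on identity proarrows of a family. -/
def ColaxFunctor.idcmpOf {C : DblCat.{u₁, v₁, w₁, z₁}} {D : DblCat.{u₂, v₂, w₂, z₂}}
    (F : ColaxFunctor C D) {I : Type i} (x : I → C.Obj) : ∀ {a j k : I} (hj : a = j) (hk : a = k),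
    Proarr.of (F.pro (C.hidOf x hj hk)) ⟶ Proarr.of (D.hidOf (fun t => F.obj (x t)) hj hk)
  | a, _, _, rfl, rfl => F.idcmp (x a)

/-- The colax functor `DblFam F` acts on families by postcomposition with `F` and preserves
indexing sets and spans; its comparison cells are families of comparison cells of `F`. -/
def famMap {C : DblCat.{u₁, v₁, w₁, z₁}} {D : DblCat.{u₂, v₂, w₂, z₂}} (F : ColaxFunctor C D) :
    ColaxFunctor (DblFam.{i} C) (DblFam.{i} D) where
  obj X := ⟨X.idx, fun a => F.obj (X.fam a)⟩
  map f := ⟨f.base, fun a => F.map (f.hom a)⟩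
  map_id X := FamHom.ext rfl (heq_of_eq (funext fun _ => F.map_id _))
  map_comp f g := FamHom.ext rfl (heq_of_eq (funext fun _ => F.map_comp _ _))
  pro M := ⟨M.apex, M.l, M.r, fun a _ _ hj hk => F.pro (M.pro a hj hk)⟩
  cell α :=
    { lhom := ⟨α.lhom.base, fun a => F.map (α.lhom.hom a)⟩
      rhom := ⟨α.rhom.base, fun a => F.map (α.rhom.hom a)⟩
      base := α.base
      l_base := α.l_base
      r_base := α.r_base
      cell := fun a _ _ hj hk => F.cell (α.cell a hj hk)
      left_cell := fun a _ _ hj hk =>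
        (F.left_cell _).trans (congrArg F.map (α.left_cell a hj hk))
      right_cell := fun a _ _ hj hk =>
        (F.right_cell _).trans (congrArg F.map (α.right_cell a hj hk)) }
  cell_id M := FamCell.ext' (FamHom.ext rfl (heq_of_eq (funext fun _ => F.map_id _)))
    (FamHom.ext rfl (heq_of_eq (funext fun _ => F.map_id _))) (fun _ => rfl)
    (fun _ _ _ _ _ => heq_of_eq (F.cell_id _))
  cell_comp α β := FamCell.ext' (FamHom.ext rfl (heq_of_eq (funext fun _ => F.map_comp _ _)))
    (FamHom.ext rfl (heq_of_eq (funext fun _ => F.map_comp _ _))) (fun _ => rfl)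
    (fun _ _ _ _ _ => heq_of_eq (F.cell_comp _ _))
  left_cell _ := rfl
  right_cell _ := rfl
  cmp M N :=
    { lhom := 𝟙 _
      rhom := 𝟙 _
      base := fun p => ⟨p.fst, p.mid, p.snd, p.fst_eq, p.snd_eq⟩
      l_base := fun _ => rfl
      r_base := fun _ => rfl
      cell := fun p _ _ hj hk =>
        F.cmp (M.pro p.fst hj p.fst_eq) (N.pro p.snd p.snd_eq hk)
      left_cell := fun _ _ _ _ _ => F.left_cmp _ _
      right_cell := fun _ _ _ _ _ => F.right_cmp _ _ }
  left_cmp _ _ := rfl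
  right_cmp _ _ := rfl
  cmp_naturality α β h := by
    obtain ⟨αl, αr, αb, αlb, αrb, αc, αlc, αrc⟩ := α
    obtain ⟨βl, βr, βb, βlb, βrb, βc, βlc, βrc⟩ := β
    dsimp only [DblFam] at h
    subst h
    refine FamCell.ext' ?_ ?_ (fun _ => rfl) (fun _ _ _ _ _ => heq_of_eq ?_)
    · exact (Category.comp_id _).trans (Category.id_comp _).symm
    · exact (Category.comp_id _).trans (Category.id_comp _).symm
    · exact F.cmp_naturality _ _ _
  idcmp X :=
    { lhom := 𝟙 _
      rhom := 𝟙 _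
      base := fun a => a
      l_base := fun _ => rfl
      r_base := fun _ => rfl
      cell := fun _ _ _ hj hk => F.idcmpOf X.fam hj hk
      left_cell := fun _ _ _ hj hk =>
        match hj, hk with
        | rfl, rfl => F.left_idcmp _
      right_cell := fun _ _ _ hj hk =>
        match hj, hk with
        | rfl, rfl => F.right_idcmp _ }
  left_idcmp _ := rfl
  right_idcmp _ := rfl
  idcmp_naturality f := by
    refine FamCell.ext' ?_ ?_ (fun _ => rfl) ?_
    · exact (Category.comp_id _).trans (Category.id_comp _).symm
    · exact (Category.comp_id _).trans (Category.id_comp _).symm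
    · rintro a j k rfl rfl
      exact heq_of_eq (F.idcmp_naturality _)
  coassoc M N P := by
    refine FamCell.ext' ?_ ?_ (fun _ => rfl) (fun _ _ _ _ _ => heq_of_eq ?_)
    · refine FamHom.ext rfl (heq_of_eq (funext fun _ => ?_))
      exact (by simp : 𝟙 _ ≫ 𝟙 _ ≫ 𝟙 _ = F.map (𝟙 _) ≫ 𝟙 _ ≫ 𝟙 _)
    · refine FamHom.ext rfl (heq_of_eq (funext fun _ => ?_))
      exact (by simp : 𝟙 _ ≫ 𝟙 _ ≫ 𝟙 _ = F.map (𝟙 _) ≫ 𝟙 _ ≫ 𝟙 _)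
    · exact F.coassoc _ _ _
  left_counit M := by
    refine FamCell.ext' ?_ ?_ (fun _ => rfl) ?_
    · refine FamHom.ext rfl (heq_of_eq (funext fun _ => ?_))
      exact (by simp : 𝟙 _ ≫ 𝟙 _ ≫ 𝟙 _ = F.map (𝟙 _))
    · refine FamHom.ext rfl (heq_of_eq (funext fun _ => ?_))
      exact (by simp : 𝟙 _ ≫ 𝟙 _ ≫ 𝟙 _ = F.map (𝟙 _))
    · rintro ⟨a, b, c, rfl, h⟩ j k rfl rfl
      obtain rfl : M.l c = a := h
      exact heq_of_eq (F.left_counit _)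
  right_counit M := by
    refine FamCell.ext' ?_ ?_ (fun _ => rfl) ?_
    · refine FamHom.ext rfl (heq_of_eq (funext fun _ => ?_))
      exact (by simp : 𝟙 _ ≫ 𝟙 _ ≫ 𝟙 _ = F.map (𝟙 _))
    · refine FamHom.ext rfl (heq_of_eq (funext fun _ => ?_))
      exact (by simp : 𝟙 _ ≫ 𝟙 _ ≫ 𝟙 _ = F.map (𝟙 _))
    · rintro ⟨a, b, c, h, rfl⟩ j k rfl rfl
      obtain rfl : M.r a = c := h
      exact heq_of_eq (F.right_counit _)


/-! Coproducts in double categories. -/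

/-- A colax double functor left adjoint to `R`, that is, an adjunction in the 2-category of double
categories, colax functors and natural transformations. -/
structure ColaxLeftAdjoint {D : DblCat.{u₁, v₁, w₁, z₁}} {C : DblCat.{u₂, v₂, w₂, z₂}}
    (R : ColaxFunctor D C) where
  L : ColaxFunctor C D
  unit : ColaxFunctor.idFunctor C ⟶ L.comp R
  counit : R.comp L ⟶ ColaxFunctor.idFunctor D
  left_triangle : ∀ x : C.Obj, L.map (unit.app x) ≫ counit.app (L.obj x) = 𝟙 (L.obj x)
  left_trianglePro : ∀ {x y : C.Obj} (m : C.Pro x y),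
    L.cell (unit.appPro m) ≫ counit.appPro (L.pro m) = 𝟙 (Proarr.of (L.pro m))
  right_triangle : ∀ x : D.Obj, unit.app (R.obj x) ≫ R.map (counit.app x) = 𝟙 (R.obj x)
  right_trianglePro : ∀ {x y : D.Obj} (m : D.Pro x y),
    unit.appPro (R.pro m) ≫ R.cell (counit.appPro m) = 𝟙 (Proarr.of (R.pro m))

namespace ColaxLeftAdjoint

variable {D : DblCat.{u₁, v₁, w₁, z₁}} {C : DblCat.{u₂, v₂, w₂, z₂}} {R : ColaxFunctor D C}

/-- Components of the unit. -/
def η (c : ColaxLeftAdjoint R) (x : C.Obj) : x ⟶ R.obj (c.L.obj x) :=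
  c.unit.app x

/-- Components of the unit at proarrows. -/
def ηPro (c : ColaxLeftAdjoint R) {x y : C.Obj} (m : C.Pro x y) :
    Proarr.of m ⟶ Proarr.of (R.pro (c.L.pro m)) :=
  c.unit.appPro m

/-- Components of the counit. -/
def ε (c : ColaxLeftAdjoint R) (x : D.Obj) : c.L.obj (R.obj x) ⟶ x :=
  c.counit.app x

/-- Components of the counit at proarrows. -/
def εPro (c : ColaxLeftAdjoint R) {x y : D.Obj} (m : D.Pro x y) :
    Proarr.of (c.L.pro (R.pro m)) ⟶ Proarr.of m :=
  c.counit.appPro m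

theorem η_naturality (c : ColaxLeftAdjoint R) {x y : C.Obj} (f : x ⟶ y) :
    f ≫ c.η y = c.η x ≫ R.map (c.L.map f) :=
  c.unit.naturality f

theorem ε_naturality (c : ColaxLeftAdjoint R) {x y : D.Obj} (f : x ⟶ y) :
    c.L.map (R.map f) ≫ c.ε y = c.ε x ≫ f :=
  c.counit.naturality f

theorem ηPro_naturality (c : ColaxLeftAdjoint R) {x y x' y' : C.Obj} {m : C.Pro x y}
    {m' : C.Pro x' y'} (α : Proarr.of m ⟶ Proarr.of m') :
    α ≫ c.ηPro m' = c.ηPro m ≫ R.cell (c.L.cell α) :=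
  c.unit.naturalityPro α

theorem εPro_naturality (c : ColaxLeftAdjoint R) {x y x' y' : D.Obj} {m : D.Pro x y}
    {m' : D.Pro x' y'} (α : Proarr.of m ⟶ Proarr.of m') :
    c.L.cell (R.cell α) ≫ c.εPro m' = c.εPro m ≫ α :=
  c.counit.naturalityPro α

@[simp] theorem left_ηPro (c : ColaxLeftAdjoint R) {x y : C.Obj} (m : C.Pro x y) :
    C.left (c.ηPro m) = c.η x :=
  c.unit.left_appPro m

@[simp] theorem right_ηPro (c : ColaxLeftAdjoint R) {x y : C.Obj} (m : C.Pro x y) :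
    C.right (c.ηPro m) = c.η y :=
  c.unit.right_appPro m

@[simp] theorem left_εPro (c : ColaxLeftAdjoint R) {x y : D.Obj} (m : D.Pro x y) :
    D.left (c.εPro m) = c.ε x :=
  c.counit.left_appPro m

@[simp] theorem right_εPro (c : ColaxLeftAdjoint R) {x y : D.Obj} (m : D.Pro x y) :
    D.right (c.εPro m) = c.ε y :=
  c.counit.right_appPro m

theorem ηPro_hcomp (c : ColaxLeftAdjoint R) {x y t : C.Obj} (m : C.Pro x y) (n : C.Pro y t) :
    C.hcompCell (c.ηPro m) (c.ηPro n) (by simp) =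
      c.ηPro (C.hcomp m n) ≫ R.cell (c.L.cmp m n) ≫ R.cmp (c.L.pro m) (c.L.pro n) :=
  (Category.id_comp _).symm.trans (c.unit.comp_cmp m n)

theorem εPro_hcomp (c : ColaxLeftAdjoint R) {x y t : D.Obj} (m : D.Pro x y) (n : D.Pro y t) :
    c.L.cell (R.cmp m n) ≫ c.L.cmp (R.pro m) (R.pro n) ≫
      D.hcompCell (c.εPro m) (c.εPro n) (by simp) = c.εPro (D.hcomp m n) :=
  (Category.assoc _ _ _).symm.trans ((c.counit.comp_cmp m n).trans (Category.comp_id _))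

theorem ηPro_hid (c : ColaxLeftAdjoint R) (x : C.Obj) :
    C.hidCell (c.η x) = c.ηPro (C.hid x) ≫ R.cell (c.L.idcmp x) ≫ R.idcmp (c.L.obj x) :=
  (Category.id_comp _).symm.trans (c.unit.comp_idcmp x)

theorem εPro_hid (c : ColaxLeftAdjoint R) (x : D.Obj) :
    c.L.cell (R.idcmp x) ≫ c.L.idcmp (R.obj x) ≫ D.hidCell (c.ε x) = c.εPro (D.hid x) :=
  (Category.assoc _ _ _).symm.trans ((c.counit.comp_idcmp x).trans (Category.comp_id _))

section Mate

variable {D' : DblCat.{u₃, v₃, w₃, z₃}} {C' : DblCat.{u₄, v₄, w₄, z₄}} {R' : ColaxFunctor D' C'}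
  (c : ColaxLeftAdjoint R) (d : ColaxLeftAdjoint R') {F : ColaxFunctor D D'}
  {F' : ColaxFunctor C C'} (a : ∀ x : D.Obj, F'.obj (R.obj x) ⟶ R'.obj (F.obj x))
  (b : ∀ {x y : D.Obj} (m : D.Pro x y),
    Proarr.of (F'.pro (R.pro m)) ⟶ Proarr.of (R'.pro (F.pro m)))

/-- Components of the mate at objects. -/
def mateApp (x : C.Obj) : d.L.obj (F'.obj x) ⟶ F.obj (c.L.obj x) :=
  d.L.map (F'.map (c.η x)) ≫ d.L.map (a (c.L.obj x)) ≫ d.ε (F.obj (c.L.obj x))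

/-- Components of the mate at proarrows. -/
def mateAppPro {x y : C.Obj} (m : C.Pro x y) :
    Proarr.of (d.L.pro (F'.pro m)) ⟶ Proarr.of (F.pro (c.L.pro m)) :=
  d.L.cell (F'.cell (c.ηPro m)) ≫ d.L.cell (b (c.L.pro m)) ≫ d.εPro (F.pro (c.L.pro m))

theorem mateApp_naturality
    (ha : ∀ {x y : D.Obj} (f : x ⟶ y), F'.map (R.map f) ≫ a y = a x ≫ R'.map (F.map f))
    {x y : C.Obj} (f : x ⟶ y) :
    d.L.map (F'.map f) ≫ mateApp c d a y = mateApp c d a x ≫ F.map (c.L.map f) := by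
  simp only [mateApp, Category.assoc]
  rw [← ε_naturality, ← d.L.map_comp_assoc, ← F'.map_comp, η_naturality, F'.map_comp,
    d.L.map_comp_assoc, ← d.L.map_comp_assoc (F'.map (R.map (c.L.map f))), ha,
    d.L.map_comp_assoc]

theorem left_mateAppPro
    (hl : ∀ {x y : D.Obj} (m : D.Pro x y), C'.left (b m) = a x) {x y : C.Obj} (m : C.Pro x y) :
    D'.left (mateAppPro c d b m) = mateApp c d a x := by
  simp [mateAppPro, mateApp, hl]

theorem right_mateAppPro
    (hr : ∀ {x y : D.Obj} (m : D.Pro x y), C'.right (b m) = a y) {x y : C.Obj} (m : C.Pro x y) :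
    D'.right (mateAppPro c d b m) = mateApp c d a y := by
  simp [mateAppPro, mateApp, hr]

theorem mateAppPro_naturality
    (hb : ∀ {x y x' y' : D.Obj} {m : D.Pro x y} {m' : D.Pro x' y'}
      (α : Proarr.of m ⟶ Proarr.of m'),
      F'.cell (R.cell α) ≫ b m' = b m ≫ R'.cell (F.cell α))
    {x y x' y' : C.Obj} {m : C.Pro x y} {m' : C.Pro x' y'} (α : Proarr.of m ⟶ Proarr.of m') :
    d.L.cell (F'.cell α) ≫ mateAppPro c d b m' =
      mateAppPro c d b m ≫ F.cell (c.L.cell α) := by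
  simp only [mateAppPro, Category.assoc]
  rw [← εPro_naturality, ← d.L.cell_comp_assoc, ← F'.cell_comp, ηPro_naturality, F'.cell_comp,
    d.L.cell_comp_assoc, ← d.L.cell_comp_assoc (F'.cell (R.cell (c.L.cell α))), hb,
    d.L.cell_comp_assoc]

theorem mateAppPro_hcomp
    (hl : ∀ {x y : D.Obj} (m : D.Pro x y), C'.left (b m) = a x)
    (hr : ∀ {x y : D.Obj} (m : D.Pro x y), C'.right (b m) = a y)
    (hb : ∀ {x y x' y' : D.Obj} {m : D.Pro x y} {m' : D.Pro x' y'}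
      (α : Proarr.of m ⟶ Proarr.of m'),
      F'.cell (R.cell α) ≫ b m' = b m ≫ R'.cell (F.cell α))
    (hc : ∀ {x y t : D.Obj} (m : D.Pro x y) (n : D.Pro y t),
      (F'.cell (R.cmp m n) ≫ F'.cmp (R.pro m) (R.pro n)) ≫
        C'.hcompCell (b m) (b n) (by rw [hl, hr]) =
      b (D.hcomp m n) ≫ R'.cell (F.cmp m n) ≫ R'.cmp (F.pro m) (F.pro n))
    {x y t : C.Obj} (m : C.Pro x y) (n : C.Pro y t) :
    (d.L.cell (F'.cmp m n) ≫ d.L.cmp (F'.pro m) (F'.pro n)) ≫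
        D'.hcompCell (mateAppPro c d b m) (mateAppPro c d b n)
          (by rw [left_mateAppPro c d a b hl, right_mateAppPro c d a b hr]) =
      mateAppPro c d b (C.hcomp m n) ≫ F.cell (c.L.cmp m n) ≫
        F.cmp (c.L.pro m) (c.L.pro n) := by
  have e₁ := D'.hcompCell_comp (d.L.cell (F'.cell (c.ηPro m))) (d.L.cell (F'.cell (c.ηPro n)))
    (d.L.cell (b (c.L.pro m)) ≫ d.εPro _) (d.L.cell (b (c.L.pro n)) ≫ d.εPro _)
    (by simp) (by simp [hl, hr])
  have e₂ := D'.hcompCell_comp (d.L.cell (b (c.L.pro m))) (d.L.cell (b (c.L.pro n)))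
    (d.εPro (F.pro (c.L.pro m))) (d.εPro (F.pro (c.L.pro n))) (by simp [hl, hr]) (by simp)
  have n₁ := d.L.cmp_naturality (F'.cell (c.ηPro m)) (F'.cell (c.ηPro n)) (by simp)
  have n₂ := F'.cmp_naturality (c.ηPro m) (c.ηPro n) (by simp)
  have n₃ := d.L.cmp_naturality (b (c.L.pro m)) (b (c.L.pro n)) (by simp [hl, hr])
  have h := hc (c.L.pro m) (c.L.pro n)
  simp only [Category.assoc] at h
  have h' := congrArg d.L.cell h
  simp only [d.L.cell_comp] at h'
  have n₂' := congrArg d.L.cell n₂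
  simp only [d.L.cell_comp] at n₂'
  simp only [mateAppPro, Category.assoc]
  rw [e₁, e₂, ← reassoc_of% n₁, ← reassoc_of% n₃, ← reassoc_of% n₂', ηPro_hcomp]
  simp only [F'.cell_comp, d.L.cell_comp, Category.assoc]
  have hb' := congrArg d.L.cell (hb (c.L.cmp m n))
  simp only [d.L.cell_comp] at hb'
  have t₁ := εPro_naturality d (F.cmp (c.L.pro m) (c.L.pro n))
  have t₂ := εPro_naturality d (F.cell (c.L.cmp m n))
  rw [reassoc_of% h', εPro_hcomp, t₁, reassoc_of% hb', reassoc_of% t₂]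

theorem mateAppPro_hid
    (hb : ∀ {x y x' y' : D.Obj} {m : D.Pro x y} {m' : D.Pro x' y'}
      (α : Proarr.of m ⟶ Proarr.of m'),
      F'.cell (R.cell α) ≫ b m' = b m ≫ R'.cell (F.cell α))
    (hc : ∀ x : D.Obj,
      (F'.cell (R.idcmp x) ≫ F'.idcmp (R.obj x)) ≫ C'.hidCell (a x) =
      b (D.hid x) ≫ R'.cell (F.idcmp x) ≫ R'.idcmp (F.obj x))
    (x : C.Obj) :
    (d.L.cell (F'.idcmp x) ≫ d.L.idcmp (F'.obj x)) ≫ D'.hidCell (mateApp c d a x) =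
      mateAppPro c d b (C.hid x) ≫ F.cell (c.L.idcmp x) ≫ F.idcmp (c.L.obj x) := by
  have e₁ : D'.hidCell (mateApp c d a x) = D'.hidCell (d.L.map (F'.map (c.η x))) ≫
      D'.hidCell (d.L.map (a (c.L.obj x))) ≫ D'.hidCell (d.ε (F.obj (c.L.obj x))) := by
    simp only [mateApp, D'.hidCell_comp]
  have n₁ := d.L.idcmp_naturality (F'.map (c.η x))
  have n₂ := F'.idcmp_naturality (c.η x)
  have n₃ := d.L.idcmp_naturality (a (c.L.obj x))
  have h := hc (c.L.obj x)
  simp only [Category.assoc] at h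
  have h' := congrArg d.L.cell h
  simp only [d.L.cell_comp] at h'
  have n₂' := congrArg d.L.cell n₂
  simp only [d.L.cell_comp] at n₂'
  simp only [mateAppPro, Category.assoc]
  rw [e₁, ← reassoc_of% n₁, ← reassoc_of% n₃, ← reassoc_of% n₂', ηPro_hid]
  simp only [F'.cell_comp, d.L.cell_comp, Category.assoc]
  have hb' := congrArg d.L.cell (hb (c.L.idcmp x))
  simp only [d.L.cell_comp] at hb'
  have t₁ := εPro_naturality d (F.idcmp (c.L.obj x))
  have t₂ := εPro_naturality d (F.cell (c.L.idcmp x))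
  rw [reassoc_of% h', εPro_hid, t₁, reassoc_of% hb', reassoc_of% t₂]

end Mate

/-- The mate `F' ⋙ L' ⟶ L ⋙ F` of a natural transformation `R ⋙ F' ⟶ F ⋙ R'`, where `L ⊣ R` and
`L' ⊣ R'`: its components are `L' F' ⟶ L' F' R L ⟶ L' R' F L ⟶ F L`. -/
def mate {D' : DblCat.{u₃, v₃, w₃, z₃}} {C' : DblCat.{u₄, v₄, w₄, z₄}} {R' : ColaxFunctor D' C'}
    (c : ColaxLeftAdjoint R) (d : ColaxLeftAdjoint R') {F : ColaxFunctor D D'}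
    {F' : ColaxFunctor C C'} (e : R.comp F' ⟶ F.comp R') : F'.comp d.L ⟶ c.L.comp F where
  app x := mateApp c d e.app x
  naturality f := mateApp_naturality c d e.app e.naturality f
  appPro m := mateAppPro c d e.appPro m
  left_appPro m := left_mateAppPro c d e.app e.appPro e.left_appPro m
  right_appPro m := right_mateAppPro c d e.app e.appPro e.right_appPro m
  naturalityPro α := mateAppPro_naturality c d e.appPro e.naturalityPro α
  comp_cmp m n := mateAppPro_hcomp c d e.app e.appPro e.left_appPro e.right_appPro
    e.naturalityPro e.comp_cmp m n
  comp_idcmp x := mateAppPro_hid c d e.app e.appPro e.naturalityPro e.comp_idcmp x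

end ColaxLeftAdjoint

/-- A choice of colax coproducts, indexed by sets in `Type i`: a colax left adjoint of
`Δ : D → DblFam D`. -/
abbrev Coproducts (D : DblCat.{u, v, w, z}) :=
  ColaxLeftAdjoint (Delta.{i} D)

/-- `D` has colax coproducts. -/
def HasColaxCoproducts (D : DblCat.{u, v, w, z}) : Prop :=
  Nonempty (Coproducts.{i} D)

/-- `D` has strong coproducts: the left adjoint of `Δ` is pseudo. -/
def HasStrongCoproducts (D : DblCat.{u, v, w, z}) : Prop :=
  ∃ c : Coproducts.{i} D, c.L.IsPseudo

theorem famMap_single {C : DblCat.{u₁, v₁, w₁, z₁}} {D : DblCat.{u₂, v₂, w₂, z₂}}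
    (F : ColaxFunctor C D) {x y x' y' : C.Obj} {m : C.Pro x y} {m' : C.Pro x' y'}
    (α : Proarr.of m ⟶ Proarr.of m') :
    (famMap.{i} F).cell ((Delta.{i} C).cell α) = (Delta.{i} D).cell (F.cell α) :=
  FamCell.ext' (FamHom.ext rfl (heq_of_eq (funext fun _ => (F.left_cell α).symm)))
    (FamHom.ext rfl (heq_of_eq (funext fun _ => (F.right_cell α).symm))) (fun _ => rfl)
    (fun _ _ _ _ _ => HEq.rfl)

theorem famMap_cmp_single {C : DblCat.{u₁, v₁, w₁, z₁}} {D : DblCat.{u₂, v₂, w₂, z₂}}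
    (F : ColaxFunctor C D) {x y t : C.Obj} (m : C.Pro x y) (n : C.Pro y t) :
    ((Delta.{i} C).comp (famMap F)).cmp m n = (F.comp (Delta.{i} D)).cmp m n := by
  refine FamCell.ext' ?_ ?_ (fun _ => rfl) (fun _ _ _ _ _ => heq_of_eq ?_)
  · refine FamHom.ext rfl (heq_of_eq (funext fun _ => ?_))
    exact (by simp : F.map (𝟙 _) ≫ 𝟙 _ = D.left (F.cmp m n) ≫ 𝟙 _)
  · refine FamHom.ext rfl (heq_of_eq (funext fun _ => ?_))
    exact (by simp : F.map (𝟙 _) ≫ 𝟙 _ = D.right (F.cmp m n) ≫ 𝟙 _)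
  · exact (by simp : F.cell (𝟙 _) ≫ F.cmp m n = F.cmp m n ≫ 𝟙 _)

theorem famMap_idcmp_single {C : DblCat.{u₁, v₁, w₁, z₁}} {D : DblCat.{u₂, v₂, w₂, z₂}}
    (F : ColaxFunctor C D) (x : C.Obj) :
    ((Delta.{i} C).comp (famMap F)).idcmp x = (F.comp (Delta.{i} D)).idcmp x := by
  refine FamCell.ext' ?_ ?_ (fun _ => rfl) (fun _ _ _ _ _ => heq_of_eq ?_)
  · refine FamHom.ext rfl (heq_of_eq (funext fun _ => ?_))
    exact (by simp : F.map (𝟙 _) ≫ 𝟙 _ = D.left (F.idcmp x) ≫ 𝟙 _)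
  · refine FamHom.ext rfl (heq_of_eq (funext fun _ => ?_))
    exact (by simp : F.map (𝟙 _) ≫ 𝟙 _ = D.right (F.idcmp x) ≫ 𝟙 _)
  · exact (by simp : F.cell (𝟙 _) ≫ F.idcmp x = F.idcmp x ≫ 𝟙 _)

/-- `Δ ⋙ DblFam F = F ⋙ Δ`. -/
theorem Delta_comp_famMap {C : DblCat.{u₁, v₁, w₁, z₁}} {D : DblCat.{u₂, v₂, w₂, z₂}}
    (F : ColaxFunctor C D) :
    (Delta.{i} C).comp (famMap F) = F.comp (Delta.{i} D) := by
  refine ColaxFunctor.ext rfl HEq.rfl HEq.rfl ?_ ?_ ?_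
  · exact heq_of_eq (by funext x y x' y' m m' α; exact famMap_single F α)
  · exact heq_of_eq (by funext x y t m n; exact famMap_cmp_single F m n)
  · exact heq_of_eq (by funext x; exact famMap_idcmp_single F x)

/-- The identity transformation `Δ ⋙ DblFam F ⟶ F ⋙ Δ`. -/
def famMapDelta {C : DblCat.{u₁, v₁, w₁, z₁}} {D : DblCat.{u₂, v₂, w₂, z₂}}
    (F : ColaxFunctor C D) : (Delta.{i} C).comp (famMap F) ⟶ F.comp (Delta.{i} D) where
  app x := 𝟙 ((Delta.{i} D).obj (F.obj x))
  naturality _ := (Category.comp_id _).trans (Category.id_comp _).symm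
  appPro m := 𝟙 (Proarr.of ((Delta.{i} D).pro (F.pro m)))
  left_appPro _ := rfl
  right_appPro _ := rfl
  naturalityPro α := (Category.comp_id _).trans ((famMap_single F α).trans
    (Category.id_comp _).symm)
  comp_cmp m n := (congrArg (fun t => _ ≫ t) ((DblFam.{i} D).hcompCell_id _ _)).trans
    ((Category.comp_id _).trans ((famMap_cmp_single F m n).trans (Category.id_comp _).symm))
  comp_idcmp x := (congrArg (fun t => _ ≫ t) ((DblFam.{i} D).hidCell_id _)).trans
    ((Category.comp_id _).trans ((famMap_idcmp_single F x).trans (Category.id_comp _).symm))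

/-- The comparison `Σ F ⟶ F Σ` of a colax functor `F` between double categories with colax
coproducts: the mate of the identity transformation `Δ ⋙ DblFam F ⟶ F ⋙ Δ`. -/
def coproductComparison {C : DblCat.{u₁, v₁, w₁, z₁}} {D : DblCat.{u₂, v₂, w₂, z₂}}
    (c : Coproducts.{i} C) (d : Coproducts.{i} D) (F : ColaxFunctor C D) :
    (famMap.{i} F).comp d.L ⟶ c.L.comp F :=
  ColaxLeftAdjoint.mate c d (famMapDelta F)

/-- A colax functor preserves coproducts when the coproduct comparison is a natural
isomorphism. -/
def PreservesCoproducts {C : DblCat.{u₁, v₁, w₁, z₁}} {D : DblCat.{u₂, v₂, w₂, z₂}}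
    (c : Coproducts.{i} C) (d : Coproducts.{i} D) (F : ColaxFunctor C D) : Prop :=
  IsIso (coproductComparison c d F)

/-- Proarrows can be transported along isomorphisms of their source and target. -/
def HorizontallyInvariant (E : DblCat.{u, v, w, z}) : Prop :=
  ∀ {x y x' y' : E.Obj} (n : E.Pro x y) (f : x' ≅ x) (g : y' ≅ y),
    ∃ (n' : E.Pro x' y') (θ : Proarr.of n' ≅ Proarr.of n),
      E.left θ.hom = f.hom ∧ E.right θ.hom = g.hom

instance : Category (Proarr fun _ _ : PUnit.{1} => PUnit.{1}) where
  Hom _ _ := PUnit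
  id _ := ⟨⟩
  comp _ _ := ⟨⟩

/-- The terminal double category. -/
def One : DblCat.{0, 0, 0, 0} where
  Obj := PUnit
  cat := { Hom := fun _ _ => PUnit, id := fun _ => ⟨⟩, comp := fun _ _ => ⟨⟩ }
  Pro _ _ := PUnit
  catPro := inferInstance
  left _ := ⟨⟩
  right _ := ⟨⟩
  left_id _ := rfl
  right_id _ := rfl
  left_comp _ _ := rfl
  right_comp _ _ := rfl
  hcomp _ _ := ⟨⟩
  hcompCell _ _ _ := ⟨⟩
  left_hcompCell _ _ _ := rfl
  right_hcompCell _ _ _ := rfl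
  hcompCell_id _ _ := rfl
  hcompCell_comp _ _ _ _ _ _ := rfl
  hid _ := ⟨⟩
  hidCell _ := ⟨⟩
  left_hidCell _ := rfl
  right_hidCell _ := rfl
  hidCell_id _ := rfl
  hidCell_comp _ _ := rfl
  assoc _ _ _ := { hom := ⟨⟩, inv := ⟨⟩ }
  left_assoc _ _ _ := rfl
  right_assoc _ _ _ := rfl
  assoc_naturality _ _ _ _ _ := rfl
  lunit _ := { hom := ⟨⟩, inv := ⟨⟩ }
  left_lunit _ := rfl
  right_lunit _ := rfl
  lunit_naturality _ := rfl
  runit _ := { hom := ⟨⟩, inv := ⟨⟩ }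
  left_runit _ := rfl
  right_runit _ := rfl
  runit_naturality _ := rfl
  pentagon _ _ _ _ := rfl
  triangle _ _ := rfl

/-- A span of sets. -/
structure SpanPro (I J : Type i) where
  apex : Type i
  l : apex → I
  r : apex → J

/-- A map of spans of sets. -/
@[ext]
structure SpanCell (M N : Proarr SpanPro.{i}) where
  lhom : M.src ⟶ N.src
  rhom : M.tgt ⟶ N.tgt
  base : M.pro.apex → N.pro.apex
  l_base : ∀ a, N.pro.l (base a) = lhom (M.pro.l a)
  r_base : ∀ a, N.pro.r (base a) = rhom (M.pro.r a)

instance : Category (Proarr SpanPro.{i}) where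
  Hom M N := SpanCell M N
  id M := ⟨𝟙 _, 𝟙 _, fun a => a, fun _ => rfl, fun _ => rfl⟩
  comp α β := ⟨α.lhom ≫ β.lhom, α.rhom ≫ β.rhom, fun a => β.base (α.base a),
    fun a => (β.l_base _).trans (congrArg β.lhom (α.l_base a)),
    fun a => (β.r_base _).trans (congrArg β.rhom (α.r_base a))⟩

/-- Composition of spans by pullback. -/
def SpanPro.hcomp {I J K : Type i} (M : SpanPro I J) (N : SpanPro J K) : SpanPro I K :=
  ⟨PullbackPt M.r N.l, fun p => M.l p.fst, fun p => N.r p.snd⟩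

/-- External composition of maps of spans. -/
def SpanCell.hcompCell {I J K I' J' K' : Type i} {M : SpanPro I J} {N : SpanPro J K}
    {M' : SpanPro I' J'} {N' : SpanPro J' K'} (α : Proarr.of M ⟶ Proarr.of M')
    (β : Proarr.of N ⟶ Proarr.of N') (h : α.rhom = β.lhom) :
    Proarr.of (M.hcomp N) ⟶ Proarr.of (M'.hcomp N') where
  lhom := α.lhom
  rhom := β.rhom
  base p := ⟨α.base p.fst, α.rhom p.mid, β.base p.snd,
    (α.r_base _).trans (congrArg α.rhom p.fst_eq),
    by rw [h]; exact (β.l_base _).trans (congrArg β.lhom p.snd_eq)⟩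
  l_base p := α.l_base _
  r_base p := β.r_base _

/-- The double category of sets, functions, spans and maps of spans. -/
def Span : DblCat.{i + 1, i, i + 1, i} where
  Obj := Type i
  cat := inferInstance
  Pro := SpanPro
  catPro := inferInstance
  left α := SpanCell.lhom α
  right α := SpanCell.rhom α
  left_id _ := rfl
  right_id _ := rfl
  left_comp _ _ := rfl
  right_comp _ _ := rfl
  hcomp := SpanPro.hcomp
  hcompCell := SpanCell.hcompCell
  left_hcompCell _ _ _ := rfl
  right_hcompCell _ _ _ := rfl
  hcompCell_id _ _ := rfl
  hcompCell_comp _ _ _ _ _ _ := rfl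
  hid I := ⟨I, fun a => a, fun a => a⟩
  hidCell f := ⟨f, f, f, fun _ => rfl, fun _ => rfl⟩
  left_hidCell _ := rfl
  right_hidCell _ := rfl
  hidCell_id _ := rfl
  hidCell_comp _ _ := rfl
  assoc M N P :=
    { hom := ⟨𝟙 _, 𝟙 _, fun p => ⟨p.fst.fst, p.fst.mid,
        ⟨p.fst.snd, p.mid, p.snd, p.fst_eq, p.snd_eq⟩, p.fst.fst_eq, p.fst.snd_eq⟩,
        fun _ => rfl, fun _ => rfl⟩
      inv := ⟨𝟙 _, 𝟙 _, fun p => ⟨⟨p.fst, p.mid, p.snd.fst, p.fst_eq, p.snd_eq⟩, p.snd.mid,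
        p.snd.snd, p.snd.fst_eq, p.snd.snd_eq⟩, fun _ => rfl, fun _ => rfl⟩ }
  left_assoc _ _ _ := rfl
  right_assoc _ _ _ := rfl
  assoc_naturality _ _ _ _ _ := rfl
  lunit M :=
    { hom := ⟨𝟙 _, 𝟙 _, fun p => p.snd, fun p => p.snd_eq.trans p.fst_eq.symm, fun _ => rfl⟩
      inv := ⟨𝟙 _, 𝟙 _, fun b => ⟨M.l b, M.l b, b, rfl, rfl⟩, fun _ => rfl, fun _ => rfl⟩
      hom_inv_id := SpanCell.ext rfl rfl (funext fun p =>
        PullbackPt.ext' (p.snd_eq.trans p.fst_eq.symm) rfl)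
      inv_hom_id := rfl }
  left_lunit _ := rfl
  right_lunit _ := rfl
  lunit_naturality _ := rfl
  runit M :=
    { hom := ⟨𝟙 _, 𝟙 _, fun p => p.fst, fun _ => rfl, fun p => p.fst_eq.trans p.snd_eq.symm⟩
      inv := ⟨𝟙 _, 𝟙 _, fun a => ⟨a, M.r a, M.r a, rfl, rfl⟩, fun _ => rfl, fun _ => rfl⟩
      hom_inv_id := SpanCell.ext rfl rfl (funext fun p =>
        PullbackPt.ext' rfl (p.fst_eq.trans p.snd_eq.symm))
      inv_hom_id := rfl }
  left_runit _ := rfl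
  right_runit _ := rfl
  runit_naturality _ := rfl
  pentagon _ _ _ _ := rfl
  triangle _ _ := SpanCell.ext rfl rfl (funext fun _ => PullbackPt.ext' rfl rfl)

/-- The double functor `1 → Span` that picks out the singleton set. -/
def point : ColaxFunctor One Span.{i} where
  obj _ := PUnit.{i + 1}
  map _ := 𝟙 (PUnit.{i + 1} : Type i)
  map_id _ := rfl
  map_comp _ _ := rfl
  pro _ := ⟨PUnit, fun _ => ⟨⟩, fun _ => ⟨⟩⟩
  cell _ := ⟨𝟙 _, 𝟙 _, fun _ => ⟨⟩, fun _ => rfl, fun _ => rfl⟩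
  cell_id _ := rfl
  cell_comp _ _ := rfl
  left_cell _ := rfl
  right_cell _ := rfl
  cmp _ _ := ⟨𝟙 _, 𝟙 _, fun _ => ⟨⟨⟩, ⟨⟩, ⟨⟩, rfl, rfl⟩, fun _ => rfl, fun _ => rfl⟩
  left_cmp _ _ := rfl
  right_cmp _ _ := rfl
  cmp_naturality _ _ _ := rfl
  idcmp _ := ⟨𝟙 _, 𝟙 _, fun _ => ⟨⟩, fun _ => rfl, fun _ => rfl⟩
  left_idcmp _ := rfl
  right_idcmp _ := rfl
  idcmp_naturality _ := rfl
  coassoc _ _ _ := rfl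
  left_counit _ := rfl
  right_counit _ := rfl


/-- A colax functor `J : D → C` exhibits `C` as the free coproduct completion of `D`, where
coproducts are indexed by sets in `Type i` and are colax: `C` has colax coproducts and, for every
double category `E` with colax coproducts, every colax functor `F : D → E` extends along `J` to a
coproduct-preserving colax functor, uniquely up to natural isomorphism.  The triangle commutes up to
natural isomorphism, with which the uniqueness isomorphism is compatible, and the extension can be
chosen so that it commutes strictly as soon as `E` is horizontally invariant. -/
def IsFreeCoproductCompletion {D : DblCat.{u₁, v₁, w₁, z₁}} {C : DblCat.{u₂, v₂, w₂, z₂}}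
    (J : ColaxFunctor D C) : Prop :=
  HasColaxCoproducts.{i} C ∧
    ∀ (E : DblCat.{u₃, v₃, w₃, z₃}) (c : Coproducts.{i} C) (d : Coproducts.{i} E)
      (F : ColaxFunctor D E),
      (∃ G : ColaxFunctor C E, PreservesCoproducts c d G ∧ Nonempty (J.comp G ≅ F)) ∧
      (HorizontallyInvariant E →
        ∃ G : ColaxFunctor C E, PreservesCoproducts c d G ∧ J.comp G = F) ∧
      ∀ (G H : ColaxFunctor C E), PreservesCoproducts c d G → PreservesCoproducts c d H →
        ∀ (σ : J.comp G ≅ F) (τ : J.comp H ≅ F),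
          ∃ θ : G ≅ H, DblTrans.whisker J θ.hom ≫ τ.hom = σ.hom

end Dbl

/-!
A pseudo functor `R` has a colax left adjoint as soon as every object has a universal arrow to `R`
and every proarrow a universal cell to `R` whose sides are the chosen universal arrows: the
comparison cells of the left adjoint are the factorizations of composites and identities of
universal cells through the inverse comparison cells of `R` (`UniversalData.exists_leftAdjoint`).
Conversely the unit of an adjunction consists of universal arrows and cells. So for `R = Δ`
coproducts are universal cocones under families of objects and of proarrows, and a colax functor
preserves coproducts exactly when it preserves universal cocones (`PreservesUniversal`).

A family of families has its disjoint union as coproduct (`flatData`). Disjoint unions commute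
with pullbacks of spans, so the comparison cells are invertible and the coproducts of `Fam D` are
strong (`hasStrongCoproducts_DblFam`).

Let `E` have coproducts, with left adjoint `Σ`. The extension of `F : D ⟶ E` is the action of `F`
on families followed by `Σ`. Both factors preserve coproducts, the first because it commutes with
disjoint unions and the second as a left adjoint, and its restriction along `Δ` is isomorphic to
`F` because `Δ` is fully faithful and hence the counit of `Σ ⊣ Δ` is invertible
(`Delta_comp_extension`).

Extensions are unique because every family, of objects or of proarrows, is the coproduct of its
members taken as singleton families (`densArrow_universal`, `densCell_universal`). If `G`
preserves coproducts and restricts to `F` along `Δ`, then the value of `G` at a family is a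
coproduct of values of `F`, by a universal cocone that is natural in the family and compatible
with comparison cells (`densTrans`). Two such functors are therefore related by a unique
comparison, an isomorphism (`exists_iso_of_preservesUniversal`).

When proarrows of `E` can be transported along isomorphisms, the values of the extension at
singleton families are replaced by those of `F`, and its values at the other proarrows are
transported. This is possible since `Δ` is injective on objects and proarrows
(`exists_strict_extension`).

Over the terminal double category a family is a set and a family of proarrows is a span, strictly
(`famToSpan`, `spanToFam`), and the statements about spans are transported along this isomorphism.
-/

namespace Dbl

/-! ### Universal arrows -/

/-- `f : x ⟶ F a` is a universal arrow from `x` to the functor `F`. -/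
def IsUniversal {A : Type u₁} [Category.{v₁} A] {B : Type u₂} [Category.{v₂} B] (F : A ⥤ B)
    {x : B} {a : A} (f : x ⟶ F.obj a) : Prop :=
  ∀ ⦃b : A⦄ (g : x ⟶ F.obj b), ∃! h : a ⟶ b, f ≫ F.map h = g

namespace IsUniversal

variable {A : Type u₁} [Category.{v₁} A] {B : Type u₂} [Category.{v₂} B] {F : A ⥤ B}
  {x : B} {a b : A} {f : x ⟶ F.obj a}

theorem hom_ext (hf : IsUniversal F f) {g h : a ⟶ b} (e : f ≫ F.map g = f ≫ F.map h) : g = h :=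
  (hf (f ≫ F.map h)).unique e rfl

theorem of_eq (hf : IsUniversal F f) {g : x ⟶ F.obj a} (e : f = g) : IsUniversal F g :=
  e ▸ hf

theorem comp_map (hf : IsUniversal F f) (e : a ⟶ b) [IsIso e] : IsUniversal F (f ≫ F.map e) := by
  intro c g
  obtain ⟨h, hh, hu⟩ := hf g
  refine ⟨inv e ≫ h, ?_, fun k hk => ?_⟩
  · dsimp only
    rw [Category.assoc, ← F.map_comp, IsIso.hom_inv_id_assoc, hh]
  · rw [IsIso.eq_inv_comp]
    apply hu
    rw [F.map_comp, ← Category.assoc, hk]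

theorem iso_comp (hf : IsUniversal F f) {y : B} (e : y ⟶ x) [IsIso e] :
    IsUniversal F (e ≫ f) := by
  intro c g
  obtain ⟨h, hh, hu⟩ := hf (inv e ≫ g)
  refine ⟨h, ?_, fun k hk => hu _ ?_⟩
  · dsimp only
    rw [Category.assoc, hh, IsIso.hom_inv_id_assoc]
  · dsimp only at hk ⊢
    rw [IsIso.eq_inv_comp, ← Category.assoc, hk]

theorem isIso_of_comp_map (hf : IsUniversal F f) {e : a ⟶ b}
    (he : IsUniversal F (f ≫ F.map e)) : IsIso e := by
  obtain ⟨h, hh, -⟩ := he f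
  refine ⟨h, hf.hom_ext ?_, he.hom_ext ?_⟩
  · rw [F.map_comp, F.map_id, Category.comp_id, ← Category.assoc]
    exact hh
  · rw [F.map_comp, F.map_id, Category.comp_id]
    rw [← Category.assoc, hh]

end IsUniversal

namespace DblCat

variable {D : DblCat.{u, v, w, z}}

theorem isIso_left {m n : Proarr D.Pro} (α : m ⟶ n) [IsIso α] : IsIso (D.left α) :=
  ⟨D.left (inv α), by rw [← D.left_comp, IsIso.hom_inv_id, D.left_id],
    by rw [← D.left_comp, IsIso.inv_hom_id, D.left_id]⟩

theorem isIso_right {m n : Proarr D.Pro} (α : m ⟶ n) [IsIso α] : IsIso (D.right α) :=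
  ⟨D.right (inv α), by rw [← D.right_comp, IsIso.hom_inv_id, D.right_id],
    by rw [← D.right_comp, IsIso.inv_hom_id, D.right_id]⟩

theorem left_inv {m n : Proarr D.Pro} (α : m ⟶ n) [IsIso α] {f : n.src ⟶ m.src}
    (h : D.left α ≫ f = 𝟙 _) : D.left (inv α) = f := by
  have := isIso_left α
  rw [← cancel_epi (D.left α), h, ← D.left_comp, IsIso.hom_inv_id, D.left_id]

theorem right_inv {m n : Proarr D.Pro} (α : m ⟶ n) [IsIso α] {f : n.tgt ⟶ m.tgt}
    (h : D.right α ≫ f = 𝟙 _) : D.right (inv α) = f := by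
  have := isIso_right α
  rw [← cancel_epi (D.right α), h, ← D.right_comp, IsIso.hom_inv_id, D.right_id]

theorem isIso_hcompCell {x y t x' y' t' : D.Obj} {m : D.Pro x y} {n : D.Pro y t}
    {m' : D.Pro x' y'} {n' : D.Pro y' t'} (α : Proarr.of m ⟶ Proarr.of m')
    (β : Proarr.of n ⟶ Proarr.of n') (h : D.right α = D.left β) [IsIso α] [IsIso β] :
    IsIso (D.hcompCell α β h) := by
  have hi : D.right (inv α) = D.left (inv β) := by
    apply D.right_inv
    rw [h, ← D.left_comp, IsIso.hom_inv_id, D.left_id]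
  refine ⟨D.hcompCell (inv α) (inv β) hi, ?_, ?_⟩
  · rw [← D.hcompCell_comp, ← D.hcompCell_id]
    exact D.hcompCell_congr (IsIso.hom_inv_id α) (IsIso.hom_inv_id β) _
  · rw [← D.hcompCell_comp, ← D.hcompCell_id]
    exact D.hcompCell_congr (IsIso.inv_hom_id α) (IsIso.inv_hom_id β) _

end DblCat

namespace ColaxFunctor

variable {D : DblCat.{u₁, v₁, w₁, z₁}} {C : DblCat.{u₂, v₂, w₂, z₂}} (R : ColaxFunctor D C)

/-- The action of a colax functor on objects and arrows. -/
def objFunctor : D.Obj ⥤ C.Obj where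
  obj := R.obj
  map := R.map
  map_id := R.map_id
  map_comp := R.map_comp

/-- The action of a colax functor on proarrows and cells. -/
def proFunctor : Proarr D.Pro ⥤ Proarr C.Pro where
  obj m := Proarr.of (R.pro m.pro)
  map α := R.cell α
  map_id m := R.cell_id m.pro
  map_comp α β := R.cell_comp α β

/-- `f : x ⟶ R a` is universal from `x` to the action of `R` on arrows. -/
abbrev UniversalArrow {x : C.Obj} {a : D.Obj} (f : x ⟶ R.obj a) : Prop :=
  IsUniversal R.objFunctor f

/-- `φ : m ⟶ R n` is universal from `m` to the action of `R` on cells. -/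
abbrev UniversalCell {x y : C.Obj} {a b : D.Obj} {m : C.Pro x y} {n : D.Pro a b}
    (φ : Proarr.of m ⟶ Proarr.of (R.pro n)) : Prop :=
  IsUniversal R.proFunctor (a := Proarr.of n) φ

instance isIso_map {x y : D.Obj} (f : x ⟶ y) [IsIso f] : IsIso (R.map f) :=
  inferInstanceAs (IsIso (R.objFunctor.map f))

instance isIso_cell {x y x' y' : D.Obj} {m : D.Pro x y} {m' : D.Pro x' y'}
    (α : Proarr.of m ⟶ Proarr.of m') [IsIso α] : IsIso (R.cell α) :=
  inferInstanceAs (IsIso (R.proFunctor.map α))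

variable {R}

section Arrow

variable {x : C.Obj} {a b : D.Obj} {f : x ⟶ R.obj a}

/-- The arrow induced by a universal arrow. -/
noncomputable def UniversalArrow.desc (hf : R.UniversalArrow f) (g : x ⟶ R.obj b) : a ⟶ b :=
  (hf g).choose

theorem UniversalArrow.fac (hf : R.UniversalArrow f) (g : x ⟶ R.obj b) :
    f ≫ R.map (hf.desc g) = g :=
  (hf g).choose_spec.1

theorem UniversalArrow.intro (h₀ : ∀ (b : D.Obj) (g : x ⟶ R.obj b), ∃ h : a ⟶ b, f ≫ R.map h = g)
    (h₁ : ∀ (b : D.Obj) (g h : a ⟶ b), f ≫ R.map g = f ≫ R.map h → g = h) :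
    R.UniversalArrow f := fun b g =>
  let ⟨h, hh⟩ := h₀ b g
  ⟨h, hh, fun _ hk => h₁ _ _ _ (hk.trans hh.symm)⟩

theorem UniversalArrow.ext (hf : R.UniversalArrow f) {g h : a ⟶ b}
    (e : f ≫ R.map g = f ≫ R.map h) : g = h :=
  IsUniversal.hom_ext hf e

theorem UniversalArrow.comp_map (hf : R.UniversalArrow f) (e : a ⟶ b) (he : IsIso e) :
    R.UniversalArrow (f ≫ R.map e) :=
  IsUniversal.comp_map hf e

theorem UniversalArrow.isIso (hf : R.UniversalArrow f) {e : a ⟶ b} {g : x ⟶ R.obj b}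
    (hg : R.UniversalArrow g) (h : f ≫ R.map e = g) : IsIso e := by
  subst h
  exact IsUniversal.isIso_of_comp_map hf hg

theorem UniversalArrow.exists_iso (hf : R.UniversalArrow f) {g : x ⟶ R.obj b}
    (hg : R.UniversalArrow g) : ∃ e : a ⟶ b, IsIso e ∧ f ≫ R.map e = g :=
  ⟨hf.desc g, hf.isIso hg (hf.fac g), hf.fac g⟩

end Arrow

section Cell

variable {x y : C.Obj} {a b a' b' : D.Obj} {m : C.Pro x y} {n : D.Pro a b} {p : D.Pro a' b'}
  {φ : Proarr.of m ⟶ Proarr.of (R.pro n)}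

/-- The cell induced by a universal cell. -/
noncomputable def UniversalCell.desc (hφ : R.UniversalCell φ)
    (ψ : Proarr.of m ⟶ Proarr.of (R.pro p)) : Proarr.of n ⟶ Proarr.of p :=
  (hφ (b := Proarr.of p) ψ).choose

theorem UniversalCell.fac (hφ : R.UniversalCell φ) (ψ : Proarr.of m ⟶ Proarr.of (R.pro p)) :
    φ ≫ R.cell (hφ.desc ψ) = ψ :=
  (hφ (b := Proarr.of p) ψ).choose_spec.1

theorem UniversalCell.intro
    (h₀ : ∀ {a' b' : D.Obj} (p : D.Pro a' b') (ψ : Proarr.of m ⟶ Proarr.of (R.pro p)),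
      ∃ α : Proarr.of n ⟶ Proarr.of p, φ ≫ R.cell α = ψ)
    (h₁ : ∀ {a' b' : D.Obj} (p : D.Pro a' b') (α β : Proarr.of n ⟶ Proarr.of p),
      φ ≫ R.cell α = φ ≫ R.cell β → α = β) : R.UniversalCell φ := fun p ψ =>
  let ⟨α, hα⟩ := h₀ p.pro ψ
  ⟨α, hα, fun _ hk => h₁ _ _ _ (hk.trans hα.symm)⟩

theorem UniversalCell.ext (hφ : R.UniversalCell φ) {α β : Proarr.of n ⟶ Proarr.of p}
    (e : φ ≫ R.cell α = φ ≫ R.cell β) : α = β :=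
  IsUniversal.hom_ext hφ e

theorem UniversalCell.comp_cell (hφ : R.UniversalCell φ) (α : Proarr.of n ⟶ Proarr.of p)
    (hα : IsIso α) : R.UniversalCell (φ ≫ R.cell α) :=
  IsUniversal.comp_map hφ α

theorem UniversalCell.isIso (hφ : R.UniversalCell φ) {α : Proarr.of n ⟶ Proarr.of p}
    {ψ : Proarr.of m ⟶ Proarr.of (R.pro p)} (hψ : R.UniversalCell ψ) (e : φ ≫ R.cell α = ψ) :
    IsIso α := by
  subst e
  exact IsUniversal.isIso_of_comp_map hφ hψ

theorem UniversalCell.exists_iso (hφ : R.UniversalCell φ)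
    {ψ : Proarr.of m ⟶ Proarr.of (R.pro p)} (hψ : R.UniversalCell ψ) :
    ∃ α : Proarr.of n ⟶ Proarr.of p, IsIso α ∧ φ ≫ R.cell α = ψ :=
  ⟨hφ.desc ψ, hφ.isIso hψ (hφ.fac ψ), hφ.fac ψ⟩

theorem UniversalCell.left_eq {f : x ⟶ R.obj a} (hf : R.UniversalArrow f) {g : a ⟶ a'}
    (hl : C.left φ = f) {α : Proarr.of n ⟶ Proarr.of p}
    (h : C.left (φ ≫ R.cell α) = f ≫ R.map g) : D.left α = g := by
  apply hf.ext
  rw [← h, C.left_comp, hl, R.left_cell]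

theorem UniversalCell.right_eq {f : y ⟶ R.obj b} (hf : R.UniversalArrow f) {g : b ⟶ b'}
    (hl : C.right φ = f) {α : Proarr.of n ⟶ Proarr.of p}
    (h : C.right (φ ≫ R.cell α) = f ≫ R.map g) : D.right α = g := by
  apply hf.ext
  rw [← h, C.right_comp, hl, R.right_cell]

end Cell

/-- Cells into a composite proarrow can be compared after the comparison cell of a pseudo
functor. -/
theorem UniversalCell.ext_cmp (hR : R.IsPseudo) {x y : C.Obj} {a b a' b' t : D.Obj}
    {m : C.Pro x y} {n : D.Pro a b} {p : D.Pro a' b'} {q : D.Pro b' t}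
    {φ : Proarr.of m ⟶ Proarr.of (R.pro n)} (hφ : R.UniversalCell φ)
    {α β : Proarr.of n ⟶ Proarr.of (D.hcomp p q)}
    (e : φ ≫ R.cell α ≫ R.cmp p q = φ ≫ R.cell β ≫ R.cmp p q) : α = β := by
  have := hR.1 p q
  apply hφ.ext
  rwa [← cancel_mono (R.cmp p q), Category.assoc, Category.assoc]

theorem UniversalCell.ext_idcmp (hR : R.IsPseudo) {x y : C.Obj} {a b t : D.Obj}
    {m : C.Pro x y} {n : D.Pro a b} {φ : Proarr.of m ⟶ Proarr.of (R.pro n)}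
    (hφ : R.UniversalCell φ) {α β : Proarr.of n ⟶ Proarr.of (D.hid t)}
    (e : φ ≫ R.cell α ≫ R.idcmp t = φ ≫ R.cell β ≫ R.idcmp t) : α = β := by
  have := hR.2 t
  apply hφ.ext
  rwa [← cancel_mono (R.idcmp t), Category.assoc, Category.assoc]

end ColaxFunctor

/-! ### Isomorphisms of colax functors -/

namespace DblTrans

variable {C : DblCat.{u₁, v₁, w₁, z₁}} {D : DblCat.{u₂, v₂, w₂, z₂}} {F G : ColaxFunctor C D}

theorem comp_app {H : ColaxFunctor C D} (α : F ⟶ G) (β : G ⟶ H) (x : C.Obj) :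
    DblTrans.app (α ≫ β) x = α.app x ≫ β.app x := rfl

theorem comp_appPro {H : ColaxFunctor C D} (α : F ⟶ G) (β : G ⟶ H) {x y : C.Obj}
    (m : C.Pro x y) : DblTrans.appPro (α ≫ β) m = α.appPro m ≫ β.appPro m := rfl

theorem id_app (x : C.Obj) : DblTrans.app (𝟙 F) x = 𝟙 (F.obj x) := rfl

theorem id_appPro {x y : C.Obj} (m : C.Pro x y) :
    DblTrans.appPro (𝟙 F) m = 𝟙 (Proarr.of (F.pro m)) := rfl

/-- The inverse of a natural transformation whose components are invertible. -/
noncomputable def inverse (θ : F ⟶ G) (h₀ : ∀ x, IsIso (θ.app x))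
    (h₁ : ∀ {x y : C.Obj} (m : C.Pro x y), IsIso (θ.appPro m)) : G ⟶ F :=
  have hl : ∀ {x y : C.Obj} (m : C.Pro x y), D.left (inv (θ.appPro m)) = inv (θ.app x) :=
    fun {x y} m => D.left_inv _ (by rw [θ.left_appPro]; exact IsIso.hom_inv_id _)
  have hr : ∀ {x y : C.Obj} (m : C.Pro x y), D.right (inv (θ.appPro m)) = inv (θ.app y) :=
    fun {x y} m => D.right_inv _ (by rw [θ.right_appPro]; exact IsIso.hom_inv_id _)
  { app := fun x => inv (θ.app x)
    naturality := fun f => by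
      rw [IsIso.comp_inv_eq, Category.assoc, θ.naturality, IsIso.inv_hom_id_assoc]
    appPro := fun m => inv (θ.appPro m)
    left_appPro := hl
    right_appPro := hr
    naturalityPro := fun α => by
      rw [IsIso.comp_inv_eq, Category.assoc, θ.naturalityPro, IsIso.inv_hom_id_assoc]
    comp_cmp := fun {x y t} m n => by
      rw [IsIso.eq_inv_comp, ← Category.assoc, ← θ.comp_cmp, Category.assoc, ← D.hcompCell_comp]
      refine Eq.trans ?_ (Category.comp_id _)
      rw [← D.hcompCell_id]
      congr 1
      exact D.hcompCell_congr (IsIso.hom_inv_id _) (IsIso.hom_inv_id _) _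
    comp_idcmp := fun x => by
      rw [IsIso.eq_inv_comp, ← Category.assoc, ← θ.comp_idcmp, Category.assoc, ← D.hidCell_comp,
        IsIso.hom_inv_id, D.hidCell_id, Category.comp_id] }

theorem isIso_iff (θ : F ⟶ G) : IsIso θ ↔
    (∀ x, IsIso (θ.app x)) ∧ ∀ {x y : C.Obj} (m : C.Pro x y), IsIso (θ.appPro m) := by
  constructor
  · intro h
    have e₁ := IsIso.hom_inv_id θ
    have e₂ := IsIso.inv_hom_id θ
    refine ⟨fun x => ⟨(inv θ).app x, ?_, ?_⟩, fun m => ⟨(inv θ).appPro m, ?_, ?_⟩⟩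
    · rw [← comp_app, e₁, id_app]
    · rw [← comp_app, e₂, id_app]
    · rw [← comp_appPro, e₁, id_appPro]
    · rw [← comp_appPro, e₂, id_appPro]
  · rintro ⟨h₀, h₁⟩
    refine ⟨inverse θ h₀ h₁, ?_, ?_⟩
    · refine DblTrans.ext (funext fun x => IsIso.hom_inv_id _) ?_
      funext x y m
      exact IsIso.hom_inv_id _
    · refine DblTrans.ext (funext fun x => IsIso.inv_hom_id _) ?_
      funext x y m
      exact IsIso.inv_hom_id _

theorem eqToHom_app (h : F = G) (x : C.Obj) :
    DblTrans.app (eqToHom h) x = eqToHom (congrArg (fun K => ColaxFunctor.obj K x) h) := by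
  subst h
  rfl

theorem eqToHom_appPro (h : F = G) {x y : C.Obj} (m : C.Pro x y) :
    DblTrans.appPro (eqToHom h) m =
      eqToHom (congrArg (fun K => Proarr.of (ColaxFunctor.pro K m)) h) := by
  subst h
  rfl

end DblTrans

namespace ColaxFunctor

variable {A : DblCat.{u₁, v₁, w₁, z₁}} {B : DblCat.{u₂, v₂, w₂, z₂}}
  {C : DblCat.{u₃, v₃, w₃, z₃}} {D : DblCat.{u₄, v₄, w₄, z₄}}

theorem comp_assoc (F : ColaxFunctor A B) (G : ColaxFunctor B C) (H : ColaxFunctor C D) :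
    (F.comp G).comp H = F.comp (G.comp H) := by
  refine ColaxFunctor.ext rfl HEq.rfl HEq.rfl HEq.rfl (heq_of_eq ?_) (heq_of_eq ?_)
  · funext x y t m n
    simp only [comp, H.cell_comp, Category.assoc]
  · funext x
    simp only [comp, H.cell_comp, Category.assoc]

theorem comp_idFunctor (F : ColaxFunctor A B) : F.comp (idFunctor B) = F := by
  refine ColaxFunctor.ext rfl HEq.rfl HEq.rfl HEq.rfl (heq_of_eq ?_) (heq_of_eq ?_)
  · funext x y t m n
    exact Category.comp_id _
  · funext x
    exact Category.comp_id _

theorem idFunctor_comp (F : ColaxFunctor A B) : (idFunctor A).comp F = F := by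
  refine ColaxFunctor.ext rfl HEq.rfl HEq.rfl HEq.rfl (heq_of_eq ?_) (heq_of_eq ?_)
  · funext x y t m n
    simp only [comp, idFunctor, F.cell_id, Category.id_comp]
  · funext x
    simp only [comp, idFunctor, F.cell_id, Category.id_comp]

end ColaxFunctor

/-! ### Universal transformations -/

/-- A transformation `K ⟶ G ⋙ R` of colax functors, with the composite written out in the types of
the components. -/
structure TransInto {B : DblCat.{u₃, v₃, w₃, z₃}} {D : DblCat.{u₁, v₁, w₁, z₁}}
    {C : DblCat.{u₂, v₂, w₂, z₂}} (K : ColaxFunctor B C) (G : ColaxFunctor B D)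
    (R : ColaxFunctor D C) where
  app : ∀ x : B.Obj, K.obj x ⟶ R.obj (G.obj x)
  naturality : ∀ {x y : B.Obj} (f : x ⟶ y), K.map f ≫ app y = app x ≫ R.map (G.map f)
  appPro : ∀ {x y : B.Obj} (m : B.Pro x y), Proarr.of (K.pro m) ⟶ Proarr.of (R.pro (G.pro m))
  left_appPro : ∀ {x y : B.Obj} (m : B.Pro x y), C.left (appPro m) = app x
  right_appPro : ∀ {x y : B.Obj} (m : B.Pro x y), C.right (appPro m) = app y
  naturalityPro : ∀ {x y x' y' : B.Obj} {m : B.Pro x y} {m' : B.Pro x' y'}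
    (α : Proarr.of m ⟶ Proarr.of m'), K.cell α ≫ appPro m' = appPro m ≫ R.cell (G.cell α)
  comp_cmp : ∀ {x y t : B.Obj} (m : B.Pro x y) (n : B.Pro y t),
    K.cmp m n ≫ C.hcompCell (appPro m) (appPro n) (by rw [right_appPro, left_appPro]) =
      appPro (B.hcomp m n) ≫ R.cell (G.cmp m n) ≫ R.cmp (G.pro m) (G.pro n)
  comp_idcmp : ∀ x : B.Obj,
    K.idcmp x ≫ C.hidCell (app x) = appPro (B.hid x) ≫ R.cell (G.idcmp x) ≫ R.idcmp (G.obj x)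

namespace TransInto

variable {B : DblCat.{u₃, v₃, w₃, z₃}} {D : DblCat.{u₁, v₁, w₁, z₁}}
  {C : DblCat.{u₂, v₂, w₂, z₂}} {R : ColaxFunctor D C} {K : ColaxFunctor B C}
  {G H : ColaxFunctor B D}

/-- All components of a transformation into `G ⋙ R` are universal for `R`. -/
structure Universal (u : TransInto K G R) : Prop where
  app : ∀ x, R.UniversalArrow (u.app x)
  appPro : ∀ {x y : B.Obj} (m : B.Pro x y), R.UniversalCell (u.appPro m)

namespace Universal

/-- The cells induced by universal cells are compatible with composition comparisons: both sides
are cells out of a universal one, and after `R` and its comparison they agree. -/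
theorem desc_cmp (hR : R.IsPseudo) {u : TransInto K G R} (hu : u.Universal) (v : TransInto K H R)
    {a : ∀ {x y : B.Obj} (m : B.Pro x y), Proarr.of (G.pro m) ⟶ Proarr.of (H.pro m)}
    (ha : ∀ {x y : B.Obj} (m : B.Pro x y), u.appPro m ≫ R.cell (a m) = v.appPro m)
    {x y t : B.Obj} (m : B.Pro x y) (n : B.Pro y t) (h : D.right (a m) = D.left (a n)) :
    G.cmp m n ≫ D.hcompCell (a m) (a n) h = a (B.hcomp m n) ≫ H.cmp m n := by
  refine ColaxFunctor.UniversalCell.ext_cmp hR (hu.appPro (B.hcomp m n)) ?_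
  have e := C.hcompCell_comp (u.appPro m) (u.appPro n) (R.cell (a m)) (R.cell (a n))
    (by rw [u.left_appPro, u.right_appPro]) (by rw [R.left_cell, R.right_cell, h])
  rw [R.cell_comp, R.cell_comp, Category.assoc, R.cmp_naturality, Category.assoc,
    ← reassoc_of% u.comp_cmp, ← e, reassoc_of% ha, ← v.comp_cmp]
  congr 1
  exact C.hcompCell_congr (ha m) (ha n) _

theorem desc_idcmp (hR : R.IsPseudo) {u : TransInto K G R} (hu : u.Universal)
    (v : TransInto K H R) {a₀ : ∀ x : B.Obj, G.obj x ⟶ H.obj x}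
    {a : ∀ {x y : B.Obj} (m : B.Pro x y), Proarr.of (G.pro m) ⟶ Proarr.of (H.pro m)}
    (h₀ : ∀ x, u.app x ≫ R.map (a₀ x) = v.app x)
    (ha : ∀ {x y : B.Obj} (m : B.Pro x y), u.appPro m ≫ R.cell (a m) = v.appPro m)
    (x : B.Obj) : G.idcmp x ≫ D.hidCell (a₀ x) = a (B.hid x) ≫ H.idcmp x := by
  refine ColaxFunctor.UniversalCell.ext_idcmp hR (hu.appPro (B.hid x)) ?_
  rw [R.cell_comp, R.cell_comp, Category.assoc, R.idcmp_naturality, Category.assoc,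
    ← reassoc_of% u.comp_idcmp, ← C.hidCell_comp, h₀, reassoc_of% ha, ← v.comp_idcmp]

/-- A transformation into `H ⋙ R` factors through a universal transformation into `G ⋙ R`. -/
theorem exists_fac (hR : R.IsPseudo) {u : TransInto K G R} (hu : u.Universal)
    (v : TransInto K H R) : ∃ θ : G ⟶ H, (∀ x, u.app x ≫ R.map (θ.app x) = v.app x) ∧
      ∀ {x y : B.Obj} (m : B.Pro x y), u.appPro m ≫ R.cell (θ.appPro m) = v.appPro m := by
  have h₀ : ∀ x, u.app x ≫ R.map ((hu.app x).desc (v.app x)) = v.app x :=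
    fun x => (hu.app x).fac _
  have h₁ : ∀ {x y : B.Obj} (m : B.Pro x y),
      u.appPro m ≫ R.cell ((hu.appPro m).desc (v.appPro m)) = v.appPro m :=
    fun m => (hu.appPro m).fac _
  have hl : ∀ {x y : B.Obj} (m : B.Pro x y), D.left ((hu.appPro m).desc (v.appPro m)) =
      (hu.app x).desc (v.app x) := fun m =>
    ColaxFunctor.UniversalCell.left_eq (hu.app _) (u.left_appPro m)
      (by rw [h₁, h₀, v.left_appPro])
  have hr : ∀ {x y : B.Obj} (m : B.Pro x y), D.right ((hu.appPro m).desc (v.appPro m)) =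
      (hu.app y).desc (v.app y) := fun m =>
    ColaxFunctor.UniversalCell.right_eq (hu.app _) (u.right_appPro m)
      (by rw [h₁, h₀, v.right_appPro])
  refine ⟨
    { app := fun x => (hu.app x).desc (v.app x)
      naturality := fun {x y} f => (hu.app x).ext ?_
      appPro := fun m => (hu.appPro m).desc (v.appPro m)
      left_appPro := hl
      right_appPro := hr
      naturalityPro := fun {x y x' y' m m'} α => (hu.appPro m).ext ?_
      comp_cmp := fun m n => hu.desc_cmp hR v h₁ m n _
      comp_idcmp := fun x => hu.desc_idcmp hR v h₀ h₁ x }, h₀, h₁⟩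
  · rw [R.map_comp, R.map_comp, ← reassoc_of% u.naturality, h₀, v.naturality,
      reassoc_of% h₀]
  · rw [R.cell_comp, R.cell_comp, ← reassoc_of% u.naturalityPro, h₁, v.naturalityPro,
      reassoc_of% h₁]

/-- Two universal transformations out of the same colax functor have isomorphic targets. -/
theorem exists_iso (hR : R.IsPseudo) {u : TransInto K G R} (hu : u.Universal)
    {v : TransInto K H R} (hv : v.Universal) :
    ∃ θ : G ≅ H, (∀ x, u.app x ≫ R.map (θ.hom.app x) = v.app x) ∧
      ∀ {x y : B.Obj} (m : B.Pro x y), u.appPro m ≫ R.cell (θ.hom.appPro m) = v.appPro m := by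
  obtain ⟨θ, h₀, h₁⟩ := hu.exists_fac hR v
  have : IsIso θ := by
    refine (DblTrans.isIso_iff θ).2 ⟨fun x => ?_, fun m => ?_⟩
    · exact (hu.app x).isIso (hv.app x) (h₀ x)
    · exact (hu.appPro m).isIso (hv.appPro m) (h₁ m)
  exact ⟨asIso θ, h₀, h₁⟩

end Universal

end TransInto

/-! ### Left adjoints from universal arrows and cells -/

/-- A choice of universal arrows from all objects and of universal cells from all proarrows to `R`,
where the sides of the chosen cells are the chosen arrows. -/
structure UniversalData {D : DblCat.{u₁, v₁, w₁, z₁}} {C : DblCat.{u₂, v₂, w₂, z₂}}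
    (R : ColaxFunctor D C) where
  obj : C.Obj → D.Obj
  arrow : ∀ x : C.Obj, x ⟶ R.obj (obj x)
  arrow_universal : ∀ x, R.UniversalArrow (arrow x)
  pro : ∀ {x y : C.Obj}, C.Pro x y → D.Pro (obj x) (obj y)
  cell : ∀ {x y : C.Obj} (m : C.Pro x y), Proarr.of m ⟶ Proarr.of (R.pro (pro m))
  left_cell : ∀ {x y : C.Obj} (m : C.Pro x y), C.left (cell m) = arrow x
  right_cell : ∀ {x y : C.Obj} (m : C.Pro x y), C.right (cell m) = arrow y
  cell_universal : ∀ {x y : C.Obj} (m : C.Pro x y), R.UniversalCell (cell m)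

namespace UniversalData

variable {D : DblCat.{u₁, v₁, w₁, z₁}} {C : DblCat.{u₂, v₂, w₂, z₂}} {R : ColaxFunctor D C}
  (U : UniversalData R) (hR : R.IsPseudo)

theorem right_cell_eq_left_cell {x y t : C.Obj} (m : C.Pro x y) (n : C.Pro y t) :
    C.right (U.cell m) = C.left (U.cell n) := by rw [U.right_cell, U.left_cell]

/-- The composition comparison of the left adjoint. -/
noncomputable def cmp {x y t : C.Obj} (m : C.Pro x y) (n : C.Pro y t) :
    Proarr.of (U.pro (C.hcomp m n)) ⟶ Proarr.of (D.hcomp (U.pro m) (U.pro n)) :=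
  have := hR.1 (U.pro m) (U.pro n)
  (U.cell_universal (C.hcomp m n)).desc
    (C.hcompCell (U.cell m) (U.cell n) (U.right_cell_eq_left_cell m n) ≫
      inv (R.cmp (U.pro m) (U.pro n)))

theorem cell_cmp {x y t : C.Obj} (m : C.Pro x y) (n : C.Pro y t) :
    U.cell (C.hcomp m n) ≫ R.cell (U.cmp hR m n) ≫ R.cmp (U.pro m) (U.pro n) =
      C.hcompCell (U.cell m) (U.cell n) (U.right_cell_eq_left_cell m n) := by
  have := hR.1 (U.pro m) (U.pro n)
  rw [← Category.assoc, cmp, (U.cell_universal (C.hcomp m n)).fac, Category.assoc,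
    IsIso.inv_hom_id, Category.comp_id]

/-- The identity comparison of the left adjoint. -/
noncomputable def idcmp (x : C.Obj) : Proarr.of (U.pro (C.hid x)) ⟶ Proarr.of (D.hid (U.obj x)) :=
  have := hR.2 (U.obj x)
  (U.cell_universal (C.hid x)).desc (C.hidCell (U.arrow x) ≫ inv (R.idcmp (U.obj x)))

theorem cell_idcmp (x : C.Obj) :
    U.cell (C.hid x) ≫ R.cell (U.idcmp hR x) ≫ R.idcmp (U.obj x) = C.hidCell (U.arrow x) := by
  have := hR.2 (U.obj x)
  rw [← Category.assoc, idcmp, (U.cell_universal (C.hid x)).fac, Category.assoc,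
    IsIso.inv_hom_id, Category.comp_id]

/-- The left adjoint on arrows. -/
noncomputable def map {x y : C.Obj} (f : x ⟶ y) : U.obj x ⟶ U.obj y :=
  (U.arrow_universal x).desc (f ≫ U.arrow y)

theorem arrow_map {x y : C.Obj} (f : x ⟶ y) :
    U.arrow x ≫ R.map (U.map f) = f ≫ U.arrow y :=
  (U.arrow_universal x).fac _

/-- The left adjoint on cells. -/
noncomputable def mapCell {x y x' y' : C.Obj} {m : C.Pro x y} {m' : C.Pro x' y'}
    (α : Proarr.of m ⟶ Proarr.of m') : Proarr.of (U.pro m) ⟶ Proarr.of (U.pro m') :=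
  (U.cell_universal m).desc (α ≫ U.cell m')

theorem cell_mapCell {x y x' y' : C.Obj} {m : C.Pro x y} {m' : C.Pro x' y'}
    (α : Proarr.of m ⟶ Proarr.of m') :
    U.cell m ≫ R.cell (U.mapCell α) = α ≫ U.cell m' :=
  (U.cell_universal m).fac _

theorem left_mapCell {x y x' y' : C.Obj} {m : C.Pro x y} {m' : C.Pro x' y'}
    (α : Proarr.of m ⟶ Proarr.of m') : D.left (U.mapCell α) = U.map (C.left α) :=
  ColaxFunctor.UniversalCell.left_eq (U.arrow_universal x) (U.left_cell m) (by
    rw [cell_mapCell, arrow_map, C.left_comp, U.left_cell])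

theorem right_mapCell {x y x' y' : C.Obj} {m : C.Pro x y} {m' : C.Pro x' y'}
    (α : Proarr.of m ⟶ Proarr.of m') : D.right (U.mapCell α) = U.map (C.right α) :=
  ColaxFunctor.UniversalCell.right_eq (U.arrow_universal y) (U.right_cell m) (by
    rw [cell_mapCell, arrow_map, C.right_comp, U.right_cell])

theorem left_cmp {x y t : C.Obj} (m : C.Pro x y) (n : C.Pro y t) :
    D.left (U.cmp hR m n) = 𝟙 (U.obj x) :=
  (U.arrow_universal x).ext (by
    have h := congrArg C.left (U.cell_cmp hR m n)
    simp only [C.left_comp, U.left_cell, R.left_cell, R.left_cmp, C.left_hcompCell] at h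
    simpa using h)

theorem right_cmp {x y t : C.Obj} (m : C.Pro x y) (n : C.Pro y t) :
    D.right (U.cmp hR m n) = 𝟙 (U.obj t) :=
  (U.arrow_universal t).ext (by
    have h := congrArg C.right (U.cell_cmp hR m n)
    simp only [C.right_comp, U.right_cell, R.right_cell, R.right_cmp, C.right_hcompCell] at h
    simpa using h)

theorem left_idcmp (x : C.Obj) : D.left (U.idcmp hR x) = 𝟙 (U.obj x) :=
  (U.arrow_universal x).ext (by
    have h := congrArg C.left (U.cell_idcmp hR x)
    simp only [C.left_comp, U.left_cell, R.left_cell, R.left_idcmp, C.left_hidCell] at h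
    simpa using h)

theorem right_idcmp (x : C.Obj) : D.right (U.idcmp hR x) = 𝟙 (U.obj x) :=
  (U.arrow_universal x).ext (by
    have h := congrArg C.right (U.cell_idcmp hR x)
    simp only [C.right_comp, U.right_cell, R.right_cell, R.right_idcmp, C.right_hidCell] at h
    simpa using h)

theorem cell_cmp_hcompCell {x y t : C.Obj} (m : C.Pro x y) (n : C.Pro y t)
    {a b c : D.Obj} {p : D.Pro a b} {q : D.Pro b c} (α : Proarr.of (U.pro m) ⟶ Proarr.of p)
    (β : Proarr.of (U.pro n) ⟶ Proarr.of q) (h : D.right α = D.left β) :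
    U.cell (C.hcomp m n) ≫ R.cell (U.cmp hR m n) ≫ R.cell (D.hcompCell α β h) ≫ R.cmp p q =
      C.hcompCell (U.cell m ≫ R.cell α) (U.cell n ≫ R.cell β)
        (by simp [h, U.left_cell, U.right_cell]) := by
  rw [R.cmp_naturality, C.hcompCell_comp _ _ _ _ (U.right_cell_eq_left_cell m n) (by simp [h]),
    ← U.cell_cmp hR]
  simp only [Category.assoc]

theorem coassoc {x y t s : C.Obj} (m : C.Pro x y) (n : C.Pro y t) (p : C.Pro t s) :
    U.cmp hR (C.hcomp m n) p ≫
        D.hcompCell (U.cmp hR m n) (𝟙 (Proarr.of (U.pro p)))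
          (by rw [right_cmp, D.left_id]) ≫ (D.assoc (U.pro m) (U.pro n) (U.pro p)).hom =
      U.mapCell (C.assoc m n p).hom ≫ U.cmp hR m (C.hcomp n p) ≫
        D.hcompCell (𝟙 (Proarr.of (U.pro m))) (U.cmp hR n p)
          (by rw [left_cmp, D.right_id]) := by
  have := hR.1 (U.pro n) (U.pro p)
  refine ColaxFunctor.UniversalCell.ext_cmp hR (U.cell_universal _) ?_
  have : IsIso (C.hcompCell (𝟙 (Proarr.of (R.pro (U.pro m)))) (R.cmp (U.pro n) (U.pro p))
    (by simp)) := C.isIso_hcompCell _ _ _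
  rw [← cancel_mono (C.hcompCell (𝟙 (Proarr.of (R.pro (U.pro m)))) (R.cmp (U.pro n) (U.pro p))
    (by simp))]
  -- After `R` and its comparisons, both sides are the associator of `C` on the universal cells.
  have e₁ := U.cell_cmp_hcompCell hR (C.hcomp m n) p (U.cmp hR m n) (𝟙 _)
    (by simp [right_cmp])
  have e₂ := U.cell_cmp_hcompCell hR m (C.hcomp n p) (𝟙 _) (U.cmp hR n p)
    (by simp [left_cmp])
  have f₁ := C.hcompCell_comp (U.cell (C.hcomp m n) ≫ R.cell (U.cmp hR m n)) (U.cell p)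
    (R.cmp (U.pro m) (U.pro n)) (𝟙 (Proarr.of (R.pro (U.pro p))))
    (by simp [right_cmp, U.left_cell, U.right_cell]) (by simp)
  have f₂ := C.hcompCell_comp (U.cell m) (U.cell (C.hcomp n p) ≫ R.cell (U.cmp hR n p))
    (𝟙 (Proarr.of (R.pro (U.pro m)))) (R.cmp (U.pro n) (U.pro p))
    (by simp [left_cmp, U.left_cell, U.right_cell]) (by simp)
  simp only [Category.comp_id, Category.assoc, R.cell_id, U.cell_cmp] at e₁ e₂ f₁ f₂
  simp only [R.cell_comp, Category.assoc]
  rw [← R.coassoc, reassoc_of% e₁, ← reassoc_of% f₁, C.assoc_naturality _ _ _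
    (U.right_cell_eq_left_cell m n) (U.right_cell_eq_left_cell n p),
    reassoc_of% U.cell_mapCell, reassoc_of% e₂, ← f₂]

theorem left_counit {x y : C.Obj} (m : C.Pro x y) :
    U.cmp hR (C.hid x) m ≫
        D.hcompCell (U.idcmp hR x) (𝟙 (Proarr.of (U.pro m))) (by rw [right_idcmp, D.left_id]) ≫
          (D.lunit (U.pro m)).hom =
      U.mapCell (C.lunit m).hom := by
  refine (U.cell_universal _).ext ?_
  have e₁ := U.cell_cmp_hcompCell hR (C.hid x) m (U.idcmp hR x) (𝟙 _) (by simp [right_idcmp])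
  have f₁ := C.hcompCell_comp (U.cell (C.hid x) ≫ R.cell (U.idcmp hR x)) (U.cell m)
    (R.idcmp (U.obj x)) (𝟙 (Proarr.of (R.pro (U.pro m))))
    (by simp [right_idcmp, U.left_cell, U.right_cell]) (by simp)
  have n₁ := C.lunit_naturality (U.cell m)
  simp only [Category.comp_id, Category.assoc, R.cell_id, U.cell_idcmp, U.left_cell] at e₁ f₁ n₁
  simp only [R.cell_comp]
  rw [← R.left_counit, reassoc_of% e₁, ← reassoc_of% f₁, n₁, U.cell_mapCell]

theorem right_counit {x y : C.Obj} (m : C.Pro x y) :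
    U.cmp hR m (C.hid y) ≫
        D.hcompCell (𝟙 (Proarr.of (U.pro m))) (U.idcmp hR y) (by rw [left_idcmp, D.right_id]) ≫
          (D.runit (U.pro m)).hom =
      U.mapCell (C.runit m).hom := by
  refine (U.cell_universal _).ext ?_
  have e₁ := U.cell_cmp_hcompCell hR m (C.hid y) (𝟙 _) (U.idcmp hR y) (by simp [left_idcmp])
  have f₁ := C.hcompCell_comp (U.cell m) (U.cell (C.hid y) ≫ R.cell (U.idcmp hR y))
    (𝟙 (Proarr.of (R.pro (U.pro m)))) (R.idcmp (U.obj y))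
    (by simp [left_idcmp, U.left_cell, U.right_cell]) (by simp)
  have n₁ := C.runit_naturality (U.cell m)
  simp only [Category.comp_id, Category.assoc, R.cell_id, U.cell_idcmp, U.right_cell] at e₁ f₁ n₁
  simp only [R.cell_comp]
  rw [← R.right_counit, reassoc_of% e₁, ← reassoc_of% f₁, n₁, U.cell_mapCell]

/-- The colax functor that sends every object and proarrow to its chosen universal one. -/
noncomputable def functor : ColaxFunctor C D where
  obj := U.obj
  map := U.map
  map_id x := (U.arrow_universal x).ext (by rw [arrow_map]; simp)
  map_comp f g := (U.arrow_universal _).ext (by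
    rw [arrow_map, R.map_comp, reassoc_of% U.arrow_map, arrow_map, Category.assoc])
  pro := U.pro
  cell := U.mapCell
  cell_id m := (U.cell_universal m).ext (by rw [cell_mapCell]; simp)
  cell_comp α β := (U.cell_universal _).ext (by
    rw [cell_mapCell, R.cell_comp, reassoc_of% U.cell_mapCell, cell_mapCell, Category.assoc])
  left_cell := U.left_mapCell
  right_cell := U.right_mapCell
  cmp := U.cmp hR
  left_cmp := U.left_cmp hR
  right_cmp := U.right_cmp hR
  cmp_naturality {x y t x' y' t' m n m' n'} α β h := by
    refine ColaxFunctor.UniversalCell.ext_cmp hR (U.cell_universal _) ?_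
    have e := C.hcompCell_comp α β (U.cell m') (U.cell n') h (U.right_cell_eq_left_cell _ _)
    simp only [R.cell_comp, Category.assoc]
    rw [U.cell_cmp_hcompCell, reassoc_of% U.cell_mapCell, U.cell_cmp, ← e]
    exact C.hcompCell_congr (U.cell_mapCell α).symm (U.cell_mapCell β).symm _
  idcmp := U.idcmp hR
  left_idcmp := U.left_idcmp hR
  right_idcmp := U.right_idcmp hR
  idcmp_naturality f := by
    refine ColaxFunctor.UniversalCell.ext_idcmp hR (U.cell_universal _) ?_
    simp only [R.cell_comp, Category.assoc]
    rw [R.idcmp_naturality, reassoc_of% U.cell_mapCell, U.cell_idcmp, ← C.hidCell_comp,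
      reassoc_of% U.cell_idcmp, ← C.hidCell_comp, arrow_map]
  coassoc := U.coassoc hR
  left_counit := U.left_counit hR
  right_counit := U.right_counit hR

/-- The unit, whose components are the chosen universal arrows and cells. -/
noncomputable def unit : ColaxFunctor.idFunctor C ⟶ (U.functor hR).comp R where
  app := U.arrow
  naturality f := (U.arrow_map f).symm
  appPro := U.cell
  left_appPro := U.left_cell
  right_appPro := U.right_cell
  naturalityPro α := (U.cell_mapCell α).symm
  comp_cmp m n := (Category.id_comp _).trans (U.cell_cmp hR m n).symm
  comp_idcmp x := (Category.id_comp _).trans (U.cell_idcmp hR x).symm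

/-- The universal transformation `R ⟶ (R ⋙ L) ⋙ R`. -/
noncomputable def unitAt : TransInto R (R.comp (U.functor hR)) R where
  app x := U.arrow (R.obj x)
  naturality f := (U.arrow_map (R.map f)).symm
  appPro m := U.cell (R.pro m)
  left_appPro m := U.left_cell (R.pro m)
  right_appPro m := U.right_cell (R.pro m)
  naturalityPro α := (U.cell_mapCell (R.cell α)).symm
  comp_cmp m n := by
    have e : R.cmp m n ≫ C.hcompCell (U.cell (R.pro m)) (U.cell (R.pro n))
        (U.right_cell_eq_left_cell _ _) = U.cell (R.pro (D.hcomp m n)) ≫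
          R.cell (U.mapCell (R.cmp m n) ≫ U.cmp hR (R.pro m) (R.pro n)) ≫
            R.cmp (U.pro (R.pro m)) (U.pro (R.pro n)) := by
      rw [R.cell_comp, Category.assoc, reassoc_of% U.cell_mapCell, U.cell_cmp]
    exact e
  comp_idcmp x := by
    have e : R.idcmp x ≫ C.hidCell (U.arrow (R.obj x)) = U.cell (R.pro (D.hid x)) ≫
        R.cell (U.mapCell (R.idcmp x) ≫ U.idcmp hR (R.obj x)) ≫ R.idcmp (U.obj (R.obj x)) := by
      rw [R.cell_comp, Category.assoc, reassoc_of% U.cell_mapCell, U.cell_idcmp]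
    exact e

theorem unitAt_universal : (U.unitAt hR).Universal where
  app x := U.arrow_universal (R.obj x)
  appPro m := U.cell_universal (R.pro m)

end UniversalData

/-- The identity of `R`, as a transformation `R ⟶ id ⋙ R`. -/
def TransInto.refl {D : DblCat.{u₁, v₁, w₁, z₁}} {C : DblCat.{u₂, v₂, w₂, z₂}}
    (R : ColaxFunctor D C) : TransInto R (ColaxFunctor.idFunctor D) R where
  app x := 𝟙 (R.obj x)
  naturality f := (Category.comp_id _).trans (Category.id_comp _).symm
  appPro m := 𝟙 (Proarr.of (R.pro m))
  left_appPro m := C.left_id _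
  right_appPro m := C.right_id _
  naturalityPro f := (Category.comp_id _).trans (Category.id_comp _).symm
  comp_cmp m n := by simp [ColaxFunctor.idFunctor]
  comp_idcmp x := by simp [ColaxFunctor.idFunctor]

/-- A pseudo functor with a choice of universal arrows and cells has a colax left adjoint.  The
counit is the factorization of the identity of `R` through the unit. -/
theorem UniversalData.exists_leftAdjoint {D : DblCat.{u₁, v₁, w₁, z₁}}
    {C : DblCat.{u₂, v₂, w₂, z₂}} {R : ColaxFunctor D C} (U : UniversalData R)
    (hR : R.IsPseudo) : ∃ c : ColaxLeftAdjoint R, c.L = U.functor hR := by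
  obtain ⟨θ, h₀, h₁⟩ := (U.unitAt_universal hR).exists_fac hR (TransInto.refl R)
  refine ⟨
    { L := U.functor hR
      unit := U.unit hR
      counit := θ
      left_triangle := fun x => ?_
      left_trianglePro := fun m => ?_
      right_triangle := h₀
      right_trianglePro := h₁ }, rfl⟩
  · refine (U.arrow_universal x).ext ?_
    have e := U.arrow_map (U.arrow x)
    exact (congrArg (U.arrow x ≫ ·) (R.map_comp _ _)).trans ((Category.assoc _ _ _).symm.trans
      ((congrArg (· ≫ R.map (θ.app (U.obj x))) e).trans ((Category.assoc _ _ _).trans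
      ((congrArg (U.arrow x ≫ ·) (h₀ (U.obj x))).trans
        (congrArg (U.arrow x ≫ ·) (R.map_id _).symm)))))
  · refine (U.cell_universal m).ext ?_
    have e := U.cell_mapCell (U.cell m)
    exact (congrArg (U.cell m ≫ ·) (R.cell_comp _ _)).trans ((Category.assoc _ _ _).symm.trans
      ((congrArg (· ≫ R.cell (θ.appPro (U.pro m))) e).trans ((Category.assoc _ _ _).trans
      ((congrArg (U.cell m ≫ ·) (h₁ (U.pro m))).trans
        (congrArg (U.cell m ≫ ·) (R.cell_id _).symm)))))

/-! ### Adjunctions, mates and preservation of coproducts -/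

namespace ColaxLeftAdjoint

section

variable {D : DblCat.{u₁, v₁, w₁, z₁}} {C : DblCat.{u₂, v₂, w₂, z₂}} {R : ColaxFunctor D C}
  (c : ColaxLeftAdjoint R)

/-- The universal property is that of `L`, by the triangle identities. -/
theorem universal_η (x : C.Obj) : R.UniversalArrow (c.η x) := by
  have ht : ∀ b, c.η (R.obj b) ≫ R.map (c.ε b) = 𝟙 _ := c.right_triangle
  have ht' : c.L.map (c.η x) ≫ c.ε (c.L.obj x) = 𝟙 _ := c.left_triangle x
  have key : ∀ b (h : c.L.obj x ⟶ b), c.L.map (c.η x ≫ R.map h) ≫ c.ε b = h := fun b h => by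
    rw [c.L.map_comp, Category.assoc, c.ε_naturality, reassoc_of% ht']
  refine ColaxFunctor.UniversalArrow.intro (fun b g => ⟨c.L.map g ≫ c.ε b, ?_⟩)
    (fun b g h e => ?_)
  · rw [R.map_comp, ← reassoc_of% c.η_naturality, ht, Category.comp_id]
  · rw [← key b g, e, key]

theorem universal_ηPro {x y : C.Obj} (m : C.Pro x y) : R.UniversalCell (c.ηPro m) := by
  have ht : ∀ {a b : D.Obj} (p : D.Pro a b), c.ηPro (R.pro p) ≫ R.cell (c.εPro p) = 𝟙 _ :=
    c.right_trianglePro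
  have ht' : c.L.cell (c.ηPro m) ≫ c.εPro (c.L.pro m) = 𝟙 _ := c.left_trianglePro m
  have key : ∀ {a b : D.Obj} (p : D.Pro a b) (h : Proarr.of (c.L.pro m) ⟶ Proarr.of p),
      c.L.cell (c.ηPro m ≫ R.cell h) ≫ c.εPro p = h := fun p h => by
    rw [c.L.cell_comp, Category.assoc, c.εPro_naturality, reassoc_of% ht']
  refine ColaxFunctor.UniversalCell.intro (fun p ψ => ⟨c.L.cell ψ ≫ c.εPro p, ?_⟩)
    (fun p α β e => ?_)
  · rw [R.cell_comp, ← reassoc_of% c.ηPro_naturality, ht, Category.comp_id]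
  · rw [← key p α, e, key]

end

section Mate

variable {D : DblCat.{u₁, v₁, w₁, z₁}} {C : DblCat.{u₂, v₂, w₂, z₂}} {R : ColaxFunctor D C}
  {D' : DblCat.{u₃, v₃, w₃, z₃}} {C' : DblCat.{u₄, v₄, w₄, z₄}} {R' : ColaxFunctor D' C'}
  (c : ColaxLeftAdjoint R) (d : ColaxLeftAdjoint R') {F : ColaxFunctor D D'}
  {F' : ColaxFunctor C C'} (a : ∀ x : D.Obj, F'.obj (R.obj x) ⟶ R'.obj (F.obj x))
  (b : ∀ {x y : D.Obj} (m : D.Pro x y),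
    Proarr.of (F'.pro (R.pro m)) ⟶ Proarr.of (R'.pro (F.pro m)))

/-- The mate is the factorization of `F' η ≫ a` through the unit. -/
theorem η_mateApp (x : C.Obj) : d.η (F'.obj x) ≫ R'.map (mateApp c d a x) =
    F'.map (c.η x) ≫ a (c.L.obj x) := by
  have ht : d.η (R'.obj (F.obj (c.L.obj x))) ≫ R'.map (d.ε (F.obj (c.L.obj x))) = 𝟙 _ :=
    d.right_triangle _
  simp only [mateApp, R'.map_comp]
  rw [← reassoc_of% d.η_naturality, ← reassoc_of% d.η_naturality, ht, Category.comp_id]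

theorem ηPro_mateAppPro {x y : C.Obj} (m : C.Pro x y) :
    d.ηPro (F'.pro m) ≫ R'.cell (mateAppPro c d b m) =
      F'.cell (c.ηPro m) ≫ b (c.L.pro m) := by
  have ht : d.ηPro (R'.pro (F.pro (c.L.pro m))) ≫ R'.cell (d.εPro (F.pro (c.L.pro m))) = 𝟙 _ :=
    d.right_trianglePro _
  simp only [mateAppPro, R'.cell_comp]
  rw [← reassoc_of% d.ηPro_naturality, ← reassoc_of% d.ηPro_naturality, ht, Category.comp_id]

end Mate

end ColaxLeftAdjoint

/-- The action of `G` on families preserves universal arrows and cells to singleton families, that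
is, coproduct cocones. -/
structure PreservesUniversal {C : DblCat.{u₁, v₁, w₁, z₁}} {E : DblCat.{u₂, v₂, w₂, z₂}}
    (G : ColaxFunctor C E) : Prop where
  arrow : ∀ {X : (DblFam.{i} C).Obj} {a : C.Obj} {f : X ⟶ (Delta C).obj a},
    (Delta C).UniversalArrow f → (Delta E).UniversalArrow (a := G.obj a) ((famMap G).map f)
  cell : ∀ {X Y : (DblFam.{i} C).Obj} {M : (DblFam C).Pro X Y} {a b : C.Obj} {n : C.Pro a b}
    {φ : Proarr.of M ⟶ Proarr.of ((Delta C).pro n)},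
    (Delta C).UniversalCell φ → (Delta E).UniversalCell (n := G.pro n) ((famMap G).cell φ)

section Preserves

variable {C : DblCat.{u₁, v₁, w₁, z₁}} {E : DblCat.{u₂, v₂, w₂, z₂}} {G : ColaxFunctor C E}

/-- Since universal arrows and cells are unique up to isomorphism, it is enough that one of each
is preserved. -/
theorem PreservesUniversal.of_unit (U : UniversalData (Delta.{i} C))
    (h₀ : ∀ X, (Delta E).UniversalArrow (a := G.obj (U.obj X)) ((famMap G).map (U.arrow X)))
    (h₁ : ∀ {X Y : (DblFam.{i} C).Obj} (M : (DblFam C).Pro X Y),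
      (Delta E).UniversalCell (n := G.pro (U.pro M)) ((famMap G).cell (U.cell M))) :
    PreservesUniversal.{i} G where
  arrow {X a f} hf := by
    obtain ⟨e, he, rfl⟩ := (U.arrow_universal X).exists_iso hf
    exact IsUniversal.of_eq (ColaxFunctor.UniversalArrow.comp_map (h₀ X) (G.map e) inferInstance)
      ((famMap G).map_comp (U.arrow X) ((Delta C).map e)).symm
  cell {X Y M a b n φ} hf := by
    obtain ⟨e, he, rfl⟩ := (U.cell_universal M).exists_iso hf
    refine IsUniversal.of_eq
      (ColaxFunctor.UniversalCell.comp_cell (h₁ M) (G.cell e) (G.isIso_cell e)) ?_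
    refine Eq.trans ?_ ((famMap G).cell_comp (U.cell M) ((Delta C).cell e)).symm
    exact congrArg (fun t => _ ≫ t) (famMap_single G e).symm

theorem PreservesUniversal.η_comparison (c : Coproducts.{i} C) (d : Coproducts.{i} E)
    (X : (DblFam.{i} C).Obj) :
    d.η ((famMap G).obj X) ≫ (Delta E).map ((coproductComparison c d G).app X) =
      (famMap G).map (c.η X) :=
  (ColaxLeftAdjoint.η_mateApp (F := G) (F' := famMap.{i} G) c d (famMapDelta G).app X).trans
    (Category.comp_id _)

theorem PreservesUniversal.ηPro_comparison (c : Coproducts.{i} C) (d : Coproducts.{i} E)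
    {X Y : (DblFam.{i} C).Obj} (M : (DblFam C).Pro X Y) :
    d.ηPro ((famMap G).pro M) ≫ (Delta E).cell ((coproductComparison c d G).appPro M) =
      (famMap G).cell (c.ηPro M) :=
  (ColaxLeftAdjoint.ηPro_mateAppPro (F := G) (F' := famMap.{i} G) c d (famMapDelta G).appPro
    M).trans (Category.comp_id _)

theorem PreservesUniversal.preservesCoproducts (hG : PreservesUniversal.{i} G)
    (c : Coproducts.{i} C) (d : Coproducts.{i} E) : PreservesCoproducts c d G :=
  (DblTrans.isIso_iff _).2 ⟨fun X => (d.universal_η _).isIso (hG.arrow (c.universal_η X))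
      (η_comparison c d X),
    fun M => (d.universal_ηPro _).isIso (hG.cell (c.universal_ηPro M)) (ηPro_comparison c d M)⟩

theorem PreservesCoproducts.preservesUniversal {c : Coproducts.{i} C} {d : Coproducts.{i} E}
    (hG : PreservesCoproducts c d G) : PreservesUniversal.{i} G := by
  obtain ⟨h₀, h₁⟩ := (DblTrans.isIso_iff _).1 hG
  exact PreservesUniversal.of_unit
    { obj := c.L.obj
      arrow := c.η
      arrow_universal := c.universal_η
      pro := c.L.pro
      cell := c.ηPro
      left_cell := c.left_ηPro
      right_cell := c.right_ηPro
      cell_universal := c.universal_ηPro }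
    (fun X => IsUniversal.of_eq (ColaxFunctor.UniversalArrow.comp_map (d.universal_η _) _ (h₀ X))
      (PreservesUniversal.η_comparison c d X))
    (fun M => IsUniversal.of_eq
      (ColaxFunctor.UniversalCell.comp_cell (d.universal_ηPro _) _ (h₁ M))
      (PreservesUniversal.ηPro_comparison c d M))

end Preserves

/-! ### Cells of families -/

section FamCell

variable {D : DblCat.{u, v, w, z}}

theorem FamHom.ext' {X Y : FamObj.{i} D} {f g : FamHom X Y} (h₀ : ∀ k, f.base k = g.base k)
    (h₁ : ∀ k, f.hom k ≍ g.hom k) : f = g := by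
  obtain ⟨b, h⟩ := f
  obtain ⟨b', h'⟩ := g
  obtain rfl : b = b' := funext h₀
  obtain rfl : h = h' := funext fun k => eq_of_heq (h₁ k)
  rfl

theorem FamHom.hom_heq {X Y : FamObj.{i} D} {f g : FamHom X Y} (h : f = g) (k : X.idx) :
    f.hom k ≍ g.hom k := by
  subst h
  rfl

theorem FamCell.cell_heq {M N : Proarr (FamPro.{i} (D := D))} {α β : FamCell M N} (h : α = β)
    (a : M.pro.apex) {j : M.src.idx} {k : M.tgt.idx} (hj : M.pro.l a = j) (hk : M.pro.r a = k) :
    α.cell a hj hk ≍ β.cell a hj hk := by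
  subst h
  rfl

/-- A component of a cell whose sides are only propositionally equal to `f` and `g`. -/
def FamCell.cellOf {M N : Proarr (FamPro.{i} (D := D))} (α : FamCell M N) {f : M.src ⟶ N.src}
    {g : M.tgt ⟶ N.tgt} (hf : α.lhom = f) (hg : α.rhom = g) (a : M.pro.apex) {j : M.src.idx}
    {k : M.tgt.idx} (hj : M.pro.l a = j) (hk : M.pro.r a = k) :
    Proarr.of (M.pro.pro a hj hk) ⟶
      Proarr.of (N.pro.pro (α.base a) (j := f.base j) (k := g.base k)
        (hf ▸ (α.l_base a).trans (congrArg α.lhom.base hj))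
        (hg ▸ (α.r_base a).trans (congrArg α.rhom.base hk))) :=
  match f, g, hf, hg with
  | _, _, rfl, rfl => α.cell a hj hk

theorem FamCell.cellOf_heq {M N : Proarr (FamPro.{i} (D := D))} (α : FamCell M N)
    {f : M.src ⟶ N.src} {g : M.tgt ⟶ N.tgt} (hf : α.lhom = f) (hg : α.rhom = g)
    (a : M.pro.apex) {j : M.src.idx} {k : M.tgt.idx} (hj : M.pro.l a = j)
    (hk : M.pro.r a = k) : α.cellOf hf hg a hj hk ≍ α.cell a hj hk := by
  subst hf hg
  rfl

theorem FamCell.left_cellOf {M N : Proarr (FamPro.{i} (D := D))} (α : FamCell M N)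
    {f : M.src ⟶ N.src} {g : M.tgt ⟶ N.tgt} (hf : α.lhom = f) (hg : α.rhom = g)
    (a : M.pro.apex) {j : M.src.idx} {k : M.tgt.idx} (hj : M.pro.l a = j)
    (hk : M.pro.r a = k) : D.left (α.cellOf hf hg a hj hk) = f.hom j := by
  subst hf hg
  exact α.left_cell a hj hk

theorem FamCell.right_cellOf {M N : Proarr (FamPro.{i} (D := D))} (α : FamCell M N)
    {f : M.src ⟶ N.src} {g : M.tgt ⟶ N.tgt} (hf : α.lhom = f) (hg : α.rhom = g)
    (a : M.pro.apex) {j : M.src.idx} {k : M.tgt.idx} (hj : M.pro.l a = j)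
    (hk : M.pro.r a = k) : D.right (α.cellOf hf hg a hj hk) = g.hom k := by
  subst hf hg
  exact α.right_cell a hj hk

/-- The inverse of a component of a globular cell, based at a point `b` of the target span which
is propositionally the image of `a`. -/
noncomputable def FamCell.invCell {X Y : FamObj.{i} D} {M N : FamPro X Y}
    {base : M.apex → N.apex} (hl : ∀ a, N.l (base a) = M.l a) (hr : ∀ a, N.r (base a) = M.r a)
    (cell : ∀ (a : M.apex) {j : X.idx} {k : Y.idx} (hj : M.l a = j) (hk : M.r a = k),
      Proarr.of (M.pro a hj hk) ⟶ Proarr.of (N.pro (base a) ((hl a).trans hj) ((hr a).trans hk)))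
    (hc : ∀ (a : M.apex) {j : X.idx} {k : Y.idx} (hj : M.l a = j) (hk : M.r a = k),
      IsIso (cell a hj hk)) {a : M.apex} {b : N.apex} (h : base a = b) {j : X.idx} {k : Y.idx}
    (hj : N.l b = j) (hk : N.r b = k) (hj' : M.l a = j) (hk' : M.r a = k) :
    Proarr.of (N.pro b hj hk) ⟶ Proarr.of (M.pro a hj' hk') :=
  match b, h with
  | _, rfl => have := hc a hj' hk'; inv (cell a hj' hk')

theorem FamCell.left_invCell {X Y : FamObj.{i} D} {M N : FamPro X Y}
    {base : M.apex → N.apex} (hl : ∀ a, N.l (base a) = M.l a) (hr : ∀ a, N.r (base a) = M.r a)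
    (cell : ∀ (a : M.apex) {j : X.idx} {k : Y.idx} (hj : M.l a = j) (hk : M.r a = k),
      Proarr.of (M.pro a hj hk) ⟶ Proarr.of (N.pro (base a) ((hl a).trans hj) ((hr a).trans hk)))
    (hc : ∀ (a : M.apex) {j : X.idx} {k : Y.idx} (hj : M.l a = j) (hk : M.r a = k),
      IsIso (cell a hj hk))
    (h' : ∀ (a : M.apex) {j : X.idx} {k : Y.idx} (hj : M.l a = j) (hk : M.r a = k),
      D.left (cell a hj hk) = 𝟙 _) {a : M.apex} {b : N.apex} (h : base a = b) {j : X.idx}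
    {k : Y.idx} (hj : N.l b = j) (hk : N.r b = k) (hj' : M.l a = j) (hk' : M.r a = k) :
    D.left (FamCell.invCell hl hr cell hc h hj hk hj' hk') = 𝟙 _ := by
  subst h
  have := hc a hj' hk'
  refine D.left_inv _ ?_
  rw [h']
  exact Category.id_comp _

theorem FamCell.right_invCell {X Y : FamObj.{i} D} {M N : FamPro X Y}
    {base : M.apex → N.apex} (hl : ∀ a, N.l (base a) = M.l a) (hr : ∀ a, N.r (base a) = M.r a)
    (cell : ∀ (a : M.apex) {j : X.idx} {k : Y.idx} (hj : M.l a = j) (hk : M.r a = k),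
      Proarr.of (M.pro a hj hk) ⟶ Proarr.of (N.pro (base a) ((hl a).trans hj) ((hr a).trans hk)))
    (hc : ∀ (a : M.apex) {j : X.idx} {k : Y.idx} (hj : M.l a = j) (hk : M.r a = k),
      IsIso (cell a hj hk))
    (h' : ∀ (a : M.apex) {j : X.idx} {k : Y.idx} (hj : M.l a = j) (hk : M.r a = k),
      D.right (cell a hj hk) = 𝟙 _) {a : M.apex} {b : N.apex} (h : base a = b) {j : X.idx}
    {k : Y.idx} (hj : N.l b = j) (hk : N.r b = k) (hj' : M.l a = j) (hk' : M.r a = k) :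
    D.right (FamCell.invCell hl hr cell hc h hj hk hj' hk') = 𝟙 _ := by
  subst h
  have := hc a hj' hk'
  refine D.right_inv _ ?_
  rw [h']
  exact Category.id_comp _

/-- A globular cell of families is invertible when its map of spans is bijective and its components
are invertible. -/
theorem FamCell.isIso_of_bijective {X Y : FamObj.{i} D} {M N : FamPro X Y}
    (α : Proarr.of M ⟶ Proarr.of N) (hl : FamCell.lhom α = 𝟙 X) (hr : FamCell.rhom α = 𝟙 Y)
    (hb : Function.Bijective (FamCell.base α))
    (hc : ∀ (a : M.apex) {j : X.idx} {k : Y.idx} (hj : M.l a = j) (hk : M.r a = k),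
      IsIso (FamCell.cell α a hj hk)) : IsIso α := by
  obtain ⟨l, r, base, l_base, r_base, cell, left_cell, right_cell⟩ := α
  dsimp only at hl hr hb hc
  subst hl hr
  obtain ⟨hi, hs⟩ := hb
  choose s hs using hs
  have hsl : ∀ b, M.l (s b) = N.l b := fun b => (l_base (s b)).symm.trans (congrArg N.l (hs b))
  have hsr : ∀ b, M.r (s b) = N.r b := fun b => (r_base (s b)).symm.trans (congrArg N.r (hs b))
  let β : FamCell (Proarr.of N) (Proarr.of M) :=
    { lhom := 𝟙 X
      rhom := 𝟙 Y
      base := s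
      l_base := hsl
      r_base := hsr
      cell := fun b _ _ hj hk => FamCell.invCell l_base r_base cell hc (hs b) hj hk
        ((hsl b).trans hj) ((hsr b).trans hk)
      left_cell := fun b _ _ hj hk => FamCell.left_invCell l_base r_base cell hc left_cell _ _ _ _ _
      right_cell := fun b _ _ hj hk =>
        FamCell.right_invCell l_base r_base cell hc right_cell _ _ _ _ _ }
  refine ⟨β, ?_, ?_⟩
  · refine FamCell.ext' (Category.id_comp _) (Category.id_comp _) (fun a => hi (hs _)) ?_
    rintro a j k hj hk
    have key : ∀ (a' : M.apex) (h : base a' = base a) (hj' : M.l a' = j) (hk' : M.r a' = k),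
        cell a hj hk ≫ FamCell.invCell l_base r_base cell hc h ((l_base a).trans hj)
          ((r_base a).trans hk) hj' hk' ≍ 𝟙 (Proarr.of (M.pro a hj hk)) := by
      intro a' h hj' hk'
      obtain rfl := hi h
      have := hc a' hj hk
      exact heq_of_eq (IsIso.hom_inv_id _)
    exact key _ _ _ _
  · refine FamCell.ext' (Category.id_comp _) (Category.id_comp _) (fun a => hs _) ?_
    rintro b j k hj hk
    have key : ∀ (a : M.apex) (h : base a = b) (hj' : M.l a = j) (hk' : M.r a = k),
        FamCell.invCell l_base r_base cell hc h hj hk hj' hk' ≫ cell a hj' hk' ≍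
          𝟙 (Proarr.of (N.pro b hj hk)) := by
      intro a h hj' hk'
      subst h
      have := hc a hj' hk'
      exact heq_of_eq (IsIso.inv_hom_id _)
    exact key _ _ _ _

theorem Delta_isPseudo : (Delta.{i} D).IsPseudo := by
  refine ⟨fun {x y t} m n => ?_, fun x => ?_⟩
  · refine FamCell.isIso_of_bijective _ rfl rfl ⟨fun _ _ _ => rfl, ?_⟩ (fun _ _ _ _ _ => ?_)
    · rintro ⟨_, _, _, _, _⟩
      exact ⟨⟨⟩, rfl⟩
    · exact inferInstanceAs (IsIso (𝟙 (Proarr.of (D.hcomp m n))))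
  · refine FamCell.isIso_of_bijective _ rfl rfl ⟨fun _ _ _ => rfl, fun _ => ⟨⟨⟩, rfl⟩⟩
      (fun _ _ _ _ _ => ?_)
    exact inferInstanceAs (IsIso (𝟙 (Proarr.of (D.hid x))))

end FamCell

/-! ### Coproducts of families -/

section Flat

variable {D : DblCat.{u, v, w, z}}

/-- The disjoint union of a family of families. -/
def flatObj (X : FamObj.{i} (DblFam.{i} D)) : FamObj.{i} D where
  idx := Σ k : X.idx, FamObj.idx (X.fam k)
  fam p := FamObj.fam (X.fam p.1) p.2

/-- An element of the disjoint union of the spans of a family of proarrows of families.  The end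
points of the index are recorded as separate entries, as in `PullbackPt`. -/
structure FlatPt {X Y : FamObj.{i} (DblFam.{i} D)} (M : FamPro X Y) where
  idx : M.apex
  src : X.idx
  tgt : Y.idx
  l_eq : M.l idx = src
  r_eq : M.r idx = tgt
  pt : FamPro.apex (M.pro idx l_eq r_eq)

/-- The disjoint union of a family of proarrows of families. -/
def flatPro {X Y : FamObj.{i} (DblFam.{i} D)} (M : FamPro X Y) :
    FamPro (flatObj X) (flatObj Y) where
  apex := FlatPt M
  l p := ⟨p.src, FamPro.l (M.pro p.idx p.l_eq p.r_eq) p.pt⟩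
  r p := ⟨p.tgt, FamPro.r (M.pro p.idx p.l_eq p.r_eq) p.pt⟩
  pro p _ _ hj hk :=
    match hj, hk with
    | rfl, rfl => FamPro.pro (M.pro p.idx p.l_eq p.r_eq) p.pt rfl rfl

/-- The inclusion of a member of a family of families into the disjoint union. -/
def flatIncl (X : FamObj.{i} (DblFam.{i} D)) (k : X.idx) : FamHom (X.fam k) (flatObj X) where
  base t := ⟨k, t⟩
  hom t := 𝟙 (FamObj.fam (X.fam k) t)

/-- The coproduct cocone of a family of families. -/
def flatArrow (X : FamObj.{i} (DblFam.{i} D)) : FamHom X (single (flatObj X)) where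
  base _ := ⟨⟩
  hom k := flatIncl X k

/-- The inclusion of a member of a family of proarrows of families into the disjoint union. -/
def flatInclCell {X Y : FamObj.{i} (DblFam.{i} D)} (M : FamPro X Y) (a : M.apex) {j : X.idx}
    {k : Y.idx} (hj : M.l a = j) (hk : M.r a = k) :
    FamCell (Proarr.of (P := FamPro) (M.pro a hj hk)) (Proarr.of (flatPro M)) where
  lhom := flatIncl X j
  rhom := flatIncl Y k
  base b := ⟨a, j, k, hj, hk, b⟩
  l_base _ := rfl
  r_base _ := rfl
  cell b _ _ hj' hk' :=
    match hj', hk' with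
    | rfl, rfl => 𝟙 (Proarr.of (FamPro.pro (M.pro a hj hk) b rfl rfl))
  left_cell _ _ _ hj' hk' :=
    match hj', hk' with
    | rfl, rfl => D.left_id _
  right_cell _ _ _ hj' hk' :=
    match hj', hk' with
    | rfl, rfl => D.right_id _

/-- The coproduct cocone of a family of proarrows of families. -/
def flatCell {X Y : FamObj.{i} (DblFam.{i} D)} (M : FamPro X Y) :
    FamCell (Proarr.of M)
      (Proarr.of (P := FamPro) (singlePro (D := DblFam.{i} D) (flatPro M))) where
  lhom := flatArrow X
  rhom := flatArrow Y
  base _ := ⟨⟩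
  l_base _ := rfl
  r_base _ := rfl
  cell a _ _ hj hk := flatInclCell M a hj hk
  left_cell _ _ _ _ _ := rfl
  right_cell _ _ _ _ _ := rfl

theorem flatArrow_universal (X : FamObj.{i} (DblFam.{i} D)) :
    (Delta.{i} (DblFam.{i} D)).UniversalArrow (a := flatObj X) (flatArrow X) := by
  refine ColaxFunctor.UniversalArrow.intro (fun Z g => ⟨?_, ?_⟩) (fun Z g h e => ?_)
  · exact ⟨fun p => FamHom.base (FamHom.hom g p.1) p.2,
      fun p => FamHom.hom (FamHom.hom g p.1) p.2⟩
  · exact FamHom.ext' (fun k => rfl) (fun k => heq_of_eq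
      (FamHom.ext' (fun t => rfl) fun t => heq_of_eq (Category.id_comp _)))
  · have e' : ∀ k, flatIncl X k ≫ g = flatIncl X k ≫ h := fun k => eq_of_heq (FamHom.hom_heq e k)
    refine FamHom.ext' (fun p => ?_) (fun p => ?_)
    · exact congrFun (congrArg FamHom.base (e' p.1)) p.2
    · exact (heq_of_eq (Category.id_comp _).symm).trans ((FamHom.hom_heq (e' p.1) p.2).trans
        (heq_of_eq (Category.id_comp _)))

/-- The components of the induced cell are those of the given cocone, whose sides agree with the
arrows induced by its sides only propositionally; hence the use of `FamCell.cellOf`. -/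
theorem flatCell_universal {X Y : FamObj.{i} (DblFam.{i} D)} (M : FamPro X Y) :
    (Delta.{i} (DblFam.{i} D)).UniversalCell (n := flatPro M) (flatCell M) := by
  refine ColaxFunctor.UniversalCell.intro (fun {S T} P ψ => ⟨?_, ?_⟩) (fun {S T} P α β e => ?_)
  · have hl : ∀ (a : M.apex) {j : X.idx} {k : Y.idx} (hj : M.l a = j) (hk : M.r a = k),
      FamCell.lhom (FamCell.cell ψ a hj hk) = FamHom.hom (FamCell.lhom ψ) j :=
      fun a _ _ hj hk => FamCell.left_cell ψ a hj hk
    have hr : ∀ (a : M.apex) {j : X.idx} {k : Y.idx} (hj : M.l a = j) (hk : M.r a = k),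
      FamCell.rhom (FamCell.cell ψ a hj hk) = FamHom.hom (FamCell.rhom ψ) k :=
      fun a _ _ hj hk => FamCell.right_cell ψ a hj hk
    exact
      { lhom := ⟨fun p => FamHom.base (FamHom.hom (FamCell.lhom ψ) p.1) p.2,
          fun p => FamHom.hom (FamHom.hom (FamCell.lhom ψ) p.1) p.2⟩
        rhom := ⟨fun p => FamHom.base (FamHom.hom (FamCell.rhom ψ) p.1) p.2,
          fun p => FamHom.hom (FamHom.hom (FamCell.rhom ψ) p.1) p.2⟩
        base := fun p => FamCell.base (FamCell.cell ψ p.idx p.l_eq p.r_eq) p.pt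
        l_base := fun p => (FamCell.l_base (FamCell.cell ψ p.idx p.l_eq p.r_eq) p.pt).trans
          (congrArg (fun t => FamHom.base t _) (hl p.idx p.l_eq p.r_eq))
        r_base := fun p => (FamCell.r_base (FamCell.cell ψ p.idx p.l_eq p.r_eq) p.pt).trans
          (congrArg (fun t => FamHom.base t _) (hr p.idx p.l_eq p.r_eq))
        cell := fun p _ _ hj hk =>
          match hj, hk with
          | rfl, rfl => FamCell.cellOf (FamCell.cell ψ p.idx p.l_eq p.r_eq)
              (hl p.idx p.l_eq p.r_eq) (hr p.idx p.l_eq p.r_eq) p.pt rfl rfl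
        left_cell := by
          rintro p j k rfl rfl
          exact FamCell.left_cellOf _ _ _ _ _ _
        right_cell := by
          rintro p j k rfl rfl
          exact FamCell.right_cellOf _ _ _ _ _ _ }
  · refine FamCell.ext' ?_ ?_ (fun _ => rfl) (fun a j k hj hk => heq_of_eq ?_)
    · exact FamHom.ext' (fun k => rfl) (fun k => heq_of_eq
        (FamHom.ext' (fun t => rfl) fun t => heq_of_eq (Category.id_comp _)))
    · exact FamHom.ext' (fun k => rfl) (fun k => heq_of_eq
        (FamHom.ext' (fun t => rfl) fun t => heq_of_eq (Category.id_comp _)))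
    · refine FamCell.ext' ?_ ?_ (fun _ => rfl) ?_
      · refine Eq.trans ?_ (FamCell.left_cell ψ a hj hk).symm
        exact FamHom.ext' (fun t => rfl) fun t => heq_of_eq (Category.id_comp _)
      · refine Eq.trans ?_ (FamCell.right_cell ψ a hj hk).symm
        exact FamHom.ext' (fun t => rfl) fun t => heq_of_eq (Category.id_comp _)
      · rintro b j' k' rfl rfl
        exact (heq_of_eq (Category.id_comp _)).trans (FamCell.cellOf_heq _ _ _ _ _ _)
  · have hl : FamCell.lhom α = FamCell.lhom β :=
      (flatArrow_universal X).ext (congrArg FamCell.lhom e)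
    have hr : FamCell.rhom α = FamCell.rhom β :=
      (flatArrow_universal Y).ext (congrArg FamCell.rhom e)
    have e' : ∀ (a : M.apex) {j : X.idx} {k : Y.idx} (hj : M.l a = j) (hk : M.r a = k),
        (show (DblFam.{i} D).catPro.Hom _ _ from flatInclCell M a hj hk) ≫ α =
          (show (DblFam.{i} D).catPro.Hom _ _ from flatInclCell M a hj hk) ≫ β :=
      fun a _ _ hj hk => eq_of_heq (FamCell.cell_heq e a hj hk)
    refine FamCell.ext' hl hr ?_ ?_
    · rintro ⟨a, j, k, hj, hk, b⟩
      exact congrFun (congrArg FamCell.base (e' a hj hk)) b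
    · rintro ⟨a, j, k, hj, hk, b⟩ _ _ rfl rfl
      exact (heq_of_eq (Category.id_comp _).symm).trans
        ((FamCell.cell_heq (e' a hj hk) b rfl rfl).trans (heq_of_eq (Category.id_comp _)))

/-- Families have coproducts: disjoint unions. -/
def flatData (D : DblCat.{u, v, w, z}) : UniversalData (Delta.{i} (DblFam.{i} D)) where
  obj := flatObj
  arrow := flatArrow
  arrow_universal := flatArrow_universal
  pro := flatPro
  cell := flatCell
  left_cell _ := rfl
  right_cell _ := rfl
  cell_universal := flatCell_universal

end Flat

/-! ### Coproducts of families are strong -/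

/-- The left adjoint is pseudo if its comparison cells are represented by invertible cells. -/
theorem UniversalData.functor_isPseudo {D : DblCat.{u₁, v₁, w₁, z₁}}
    {C : DblCat.{u₂, v₂, w₂, z₂}} {R : ColaxFunctor D C} (U : UniversalData R) (hR : R.IsPseudo)
    (h₀ : ∀ {x y t : C.Obj} (m : C.Pro x y) (n : C.Pro y t),
      ∃ κ : Proarr.of (U.pro (C.hcomp m n)) ⟶ Proarr.of (D.hcomp (U.pro m) (U.pro n)),
        IsIso κ ∧ U.cell (C.hcomp m n) ≫ R.cell κ ≫ R.cmp (U.pro m) (U.pro n) =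
          C.hcompCell (U.cell m) (U.cell n) (U.right_cell_eq_left_cell m n))
    (h₁ : ∀ x : C.Obj, ∃ κ : Proarr.of (U.pro (C.hid x)) ⟶ Proarr.of (D.hid (U.obj x)),
      IsIso κ ∧ U.cell (C.hid x) ≫ R.cell κ ≫ R.idcmp (U.obj x) = C.hidCell (U.arrow x)) :
    (U.functor hR).IsPseudo := by
  refine ⟨fun m n => ?_, fun x => ?_⟩
  · obtain ⟨κ, hκ, e⟩ := h₀ m n
    have : U.cmp hR m n = κ := ColaxFunctor.UniversalCell.ext_cmp hR (U.cell_universal _)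
      ((U.cell_cmp hR m n).trans e.symm)
    change IsIso (U.cmp hR m n)
    rwa [this]
  · obtain ⟨κ, hκ, e⟩ := h₁ x
    have : U.idcmp hR x = κ := ColaxFunctor.UniversalCell.ext_idcmp hR (U.cell_universal _)
      ((U.cell_idcmp hR x).trans e.symm)
    change IsIso (U.idcmp hR x)
    rwa [this]

section Flat

variable {D : DblCat.{u, v, w, z}}

theorem isIso_flatInclCell {X Y : FamObj.{i} (DblFam.{i} D)} (M : FamPro X Y) (a : M.apex)
    {j : X.idx} {k : Y.idx} (hj : M.l a = j) (hk : M.r a = k) (b : FamPro.apex (M.pro a hj hk))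
    {j' : FamObj.idx (X.fam j)} {k' : FamObj.idx (Y.fam k)}
    (hj' : FamPro.l (M.pro a hj hk) b = j') (hk' : FamPro.r (M.pro a hj hk) b = k') :
    IsIso ((flatInclCell M a hj hk).cell b hj' hk') := by
  subst hj' hk'
  exact inferInstanceAs (IsIso (𝟙 _))

/-- Disjoint unions of composites of spans are composites of disjoint unions. -/
def flatCmp {X Y Z : FamObj.{i} (DblFam.{i} D)} (M : FamPro X Y) (N : FamPro Y Z) :
    FamCell (Proarr.of (flatPro (FamPro.hcomp M N)))
      (Proarr.of (FamPro.hcomp (flatPro M) (flatPro N))) where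
  lhom := 𝟙 (flatObj X)
  rhom := 𝟙 (flatObj Z)
  base p :=
    ⟨⟨p.idx.fst, p.src, p.idx.mid, p.l_eq, p.idx.fst_eq, PullbackPt.fst p.pt⟩,
      ⟨p.idx.mid, PullbackPt.mid p.pt⟩,
      ⟨p.idx.snd, p.idx.mid, p.tgt, p.idx.snd_eq, p.r_eq, PullbackPt.snd p.pt⟩,
      congrArg (Sigma.mk p.idx.mid) (PullbackPt.fst_eq p.pt),
      congrArg (Sigma.mk p.idx.mid) (PullbackPt.snd_eq p.pt)⟩
  l_base _ := rfl
  r_base _ := rfl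
  cell p _ _ hj hk :=
    match hj, hk with
    | rfl, rfl => D.hcompCell
        ((flatInclCell M p.idx.fst p.l_eq p.idx.fst_eq).cell (PullbackPt.fst p.pt) rfl
          (PullbackPt.fst_eq p.pt))
        ((flatInclCell N p.idx.snd p.idx.snd_eq p.r_eq).cell (PullbackPt.snd p.pt)
          (PullbackPt.snd_eq p.pt) rfl)
        ((FamCell.right_cell _ _ _ _).trans ((flatInclCell N _ _ _).left_cell _ _ _).symm)
  left_cell _ _ _ hj hk :=
    match hj, hk with
    | rfl, rfl => (D.left_hcompCell _ _ _).trans (FamCell.left_cell _ _ _ _)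
  right_cell _ _ _ hj hk :=
    match hj, hk with
    | rfl, rfl => (D.right_hcompCell _ _ _).trans (FamCell.right_cell _ _ _ _)

theorem isIso_flatCmp {X Y Z : FamObj.{i} (DblFam.{i} D)} (M : FamPro X Y) (N : FamPro Y Z) :
    IsIso (X := Proarr.of (P := FamPro) (flatPro (FamPro.hcomp M N)))
      (Y := Proarr.of (P := FamPro) (FamPro.hcomp (flatPro M) (flatPro N))) (flatCmp M N) := by
  refine FamCell.isIso_of_bijective _ rfl rfl ⟨?_, ?_⟩ ?_
  · rintro ⟨⟨a, m, b, ha, hb⟩, j, k, hj, hk, ⟨s, t, u, hs, hu⟩⟩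
      ⟨⟨a', m', b', ha', hb'⟩, j', k', hj', hk', ⟨s', t', u', hs', hu'⟩⟩ e
    have e₁ := congrArg PullbackPt.fst e
    have e₂ := congrArg PullbackPt.snd e
    dsimp only [flatCmp] at e₁ e₂
    obtain ⟨rfl, rfl, rfl, hs''⟩ := FlatPt.mk.inj e₁
    obtain ⟨rfl, -, rfl, hu''⟩ := FlatPt.mk.inj e₂
    obtain rfl := eq_of_heq hs''
    obtain rfl := eq_of_heq hu''
    subst hs hs'
    rfl
  · rintro ⟨⟨a, j, m, hj, hm, s⟩, ⟨m', t⟩, ⟨b, m'', k, hm'', hk, u⟩, h₁, h₂⟩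
    obtain ⟨rfl, h₁'⟩ := Sigma.mk.inj_iff.1 h₁
    obtain ⟨rfl, h₂'⟩ := Sigma.mk.inj_iff.1 h₂
    exact ⟨⟨⟨a, _, b, hm, hm''⟩, j, k, hj, hk, ⟨s, t, u, eq_of_heq h₁', eq_of_heq h₂'⟩⟩, rfl⟩
  · rintro p j k rfl rfl
    exact @DblCat.isIso_hcompCell D _ _ _ _ _ _ _ _ _ _ _ _ _
      (isIso_flatInclCell M p.idx.fst p.l_eq p.idx.fst_eq _ _ _)
      (isIso_flatInclCell N p.idx.snd p.idx.snd_eq p.r_eq _ _ _)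

/-- The disjoint union of identity spans is an identity span. -/
def flatIdcmp (X : FamObj.{i} (DblFam.{i} D)) :
    FamCell (Proarr.of (flatPro (FamPro.hid X))) (Proarr.of (FamPro.hid (flatObj X))) where
  lhom := 𝟙 (flatObj X)
  rhom := 𝟙 (flatObj X)
  base p :=
    match p with
    | ⟨a, _, _, rfl, rfl, b⟩ => ⟨a, b⟩
  l_base p :=
    match p with
    | ⟨_, _, _, rfl, rfl, _⟩ => rfl
  r_base p :=
    match p with
    | ⟨_, _, _, rfl, rfl, _⟩ => rfl
  cell p _ _ hj hk :=
    match p, hj, hk with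
    | ⟨a, _, _, rfl, rfl, b⟩, rfl, rfl => 𝟙 (Proarr.of (D.hid (FamObj.fam (X.fam a) b)))
  left_cell p _ _ hj hk :=
    match p, hj, hk with
    | ⟨_, _, _, rfl, rfl, _⟩, rfl, rfl => D.left_id _
  right_cell p _ _ hj hk :=
    match p, hj, hk with
    | ⟨_, _, _, rfl, rfl, _⟩, rfl, rfl => D.right_id _

theorem isIso_flatIdcmp (X : FamObj.{i} (DblFam.{i} D)) :
    IsIso (X := Proarr.of (P := FamPro) (flatPro (FamPro.hid X)))
      (Y := Proarr.of (P := FamPro) (FamPro.hid (flatObj X))) (flatIdcmp X) := by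
  refine FamCell.isIso_of_bijective _ rfl rfl ⟨?_, ?_⟩ ?_
  · rintro ⟨a, _, _, rfl, rfl, b⟩ ⟨a', _, _, rfl, rfl, b'⟩ e
    obtain ⟨rfl, h⟩ := Sigma.mk.inj_iff.1 e
    obtain rfl := eq_of_heq h
    rfl
  · rintro ⟨a, b⟩
    exact ⟨⟨a, a, a, rfl, rfl, b⟩, rfl⟩
  · rintro ⟨a, _, _, rfl, rfl, b⟩ j k rfl rfl
    exact inferInstanceAs (IsIso (𝟙 (Proarr.of (D.hid (FamObj.fam (X.fam a) b)))))

theorem flatCell_hcomp {X Y Z : FamObj.{i} (DblFam.{i} D)} (M : FamPro X Y) (N : FamPro Y Z) :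
    (flatData.{i} D).cell (FamPro.hcomp M N) ≫ (Delta (DblFam.{i} D)).cell (flatCmp M N) ≫
      (Delta (DblFam.{i} D)).cmp (flatPro M) (flatPro N) =
    (DblFam.{i} (DblFam.{i} D)).hcompCell ((flatData.{i} D).cell M) ((flatData.{i} D).cell N)
      rfl := by
  refine FamCell.ext' ?_ ?_ (fun _ => rfl) (fun p j k hj hk => heq_of_eq ?_)
  · exact FamHom.ext' (fun _ => rfl) (fun k => heq_of_eq (FamHom.ext' (fun _ => rfl)
      fun t => heq_of_eq ((Category.id_comp _).trans (Category.id_comp _))))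
  · exact FamHom.ext' (fun _ => rfl) (fun k => heq_of_eq (FamHom.ext' (fun _ => rfl)
      fun t => heq_of_eq ((Category.id_comp _).trans (Category.id_comp _))))
  · refine FamCell.ext' ?_ ?_ (fun _ => rfl) ?_
    · exact FamHom.ext' (fun _ => rfl)
        fun t => heq_of_eq ((Category.id_comp _).trans (Category.id_comp _))
    · exact FamHom.ext' (fun _ => rfl)
        fun t => heq_of_eq ((Category.id_comp _).trans (Category.id_comp _))
    · rintro q j' k' rfl rfl
      exact heq_of_eq ((Category.id_comp _).trans (Category.comp_id _))

theorem flatCell_hid (X : FamObj.{i} (DblFam.{i} D)) :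
    (flatData.{i} D).cell (FamPro.hid X) ≫ (Delta (DblFam.{i} D)).cell (flatIdcmp X) ≫
      (Delta (DblFam.{i} D)).idcmp (flatObj X) =
    (DblFam.{i} (DblFam.{i} D)).hidCell ((flatData.{i} D).arrow X) := by
  refine FamCell.ext' ?_ ?_ (fun _ => rfl) ?_
  · exact FamHom.ext' (fun _ => rfl) (fun k => heq_of_eq (FamHom.ext' (fun _ => rfl)
      fun t => heq_of_eq ((Category.id_comp _).trans (Category.id_comp _))))
  · exact FamHom.ext' (fun _ => rfl) (fun k => heq_of_eq (FamHom.ext' (fun _ => rfl)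
      fun t => heq_of_eq ((Category.id_comp _).trans (Category.id_comp _))))
  · rintro p j k rfl rfl
    refine heq_of_eq (FamCell.ext' ?_ ?_ (fun _ => rfl) ?_)
    · exact FamHom.ext' (fun _ => rfl)
        fun t => heq_of_eq ((Category.id_comp _).trans (Category.id_comp _))
    · exact FamHom.ext' (fun _ => rfl)
        fun t => heq_of_eq ((Category.id_comp _).trans (Category.id_comp _))
    · rintro q j' k' rfl rfl
      exact heq_of_eq
        ((Category.id_comp _).trans ((Category.id_comp _).trans (D.hidCell_id _).symm))

theorem hasStrongCoproducts_DblFam (D : DblCat.{u, v, w, z}) :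
    HasStrongCoproducts.{i} (DblFam.{i} D) := by
  obtain ⟨c, hc⟩ := (flatData.{i} D).exists_leftAdjoint Delta_isPseudo
  refine ⟨c, ?_⟩
  rw [hc]
  exact (flatData.{i} D).functor_isPseudo Delta_isPseudo
    (fun M N => ⟨flatCmp M N, isIso_flatCmp M N, flatCell_hcomp M N⟩)
    (fun X => ⟨flatIdcmp X, isIso_flatIdcmp X, flatCell_hid X⟩)

/-! ### Extensions preserve coproducts -/

section

variable {E : DblCat.{u₁, v₁, w₁, z₁}} (F : ColaxFunctor D E)

/-- Disjoint unions commute with the action of a colax functor on families. -/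
def flatMap {X Y : FamObj.{i} (DblFam.{i} D)} (M : FamPro X Y) :
    FamCell (Proarr.of (flatPro ((famMap (famMap.{i} F)).pro M)))
      (Proarr.of (P := FamPro) ((famMap.{i} F).pro (flatPro M))) where
  lhom := 𝟙 ((famMap.{i} F).obj (flatObj X))
  rhom := 𝟙 ((famMap.{i} F).obj (flatObj Y))
  base p := ⟨p.idx, p.src, p.tgt, p.l_eq, p.r_eq, p.pt⟩
  l_base _ := rfl
  r_base _ := rfl
  cell p _ _ hj hk :=
    match hj, hk with
    | rfl, rfl => 𝟙 (Proarr.of (F.pro (FamPro.pro (M.pro p.idx p.l_eq p.r_eq) p.pt rfl rfl)))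
  left_cell _ _ _ hj hk :=
    match hj, hk with
    | rfl, rfl => E.left_id _
  right_cell _ _ _ hj hk :=
    match hj, hk with
    | rfl, rfl => E.right_id _

theorem isIso_flatMap {X Y : FamObj.{i} (DblFam.{i} D)} (M : FamPro X Y) :
    IsIso (X := Proarr.of (P := FamPro) (flatPro ((famMap (famMap.{i} F)).pro M)))
      (Y := Proarr.of (P := FamPro) ((famMap.{i} F).pro (flatPro M))) (flatMap F M) := by
  refine FamCell.isIso_of_bijective _ rfl rfl ⟨?_, ?_⟩ ?_
  · rintro ⟨a, j, k, hj, hk, b⟩ ⟨a', j', k', hj', hk', b'⟩ e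
    obtain ⟨rfl, rfl, rfl, h⟩ := FlatPt.mk.inj e
    obtain rfl := eq_of_heq h
    rfl
  · rintro ⟨a, j, k, hj, hk, b⟩
    exact ⟨⟨a, j, k, hj, hk, b⟩, rfl⟩
  · rintro p j k rfl rfl
    exact inferInstanceAs (IsIso (𝟙 _))

theorem famMap_flatArrow (X : FamObj.{i} (DblFam.{i} D)) :
    flatArrow ((famMap (famMap.{i} F)).obj X) = (famMap (famMap.{i} F)).map (flatArrow X) :=
  FamHom.ext' (fun _ => rfl) (fun _ => heq_of_eq (FamHom.ext' (fun _ => rfl)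
    fun _ => heq_of_eq (F.map_id _).symm))

theorem flatCell_flatMap {X Y : FamObj.{i} (DblFam.{i} D)} (M : FamPro X Y) :
    (flatData.{i} E).cell ((famMap (famMap.{i} F)).pro M) ≫
      (Delta (DblFam.{i} E)).cell (flatMap F M) =
    (famMap (famMap.{i} F)).cell (flatCell M) := by
  refine FamCell.ext' ?_ ?_ (fun _ => rfl) (fun p j k hj hk => heq_of_eq ?_)
  · exact FamHom.ext' (fun _ => rfl) (fun k => heq_of_eq (FamHom.ext' (fun _ => rfl)
      fun t => heq_of_eq ((Category.id_comp _).trans (F.map_id _).symm)))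
  · exact FamHom.ext' (fun _ => rfl) (fun k => heq_of_eq (FamHom.ext' (fun _ => rfl)
      fun t => heq_of_eq ((Category.id_comp _).trans (F.map_id _).symm)))
  · refine FamCell.ext' ?_ ?_ (fun _ => rfl) ?_
    · exact FamHom.ext' (fun _ => rfl)
        fun t => heq_of_eq ((Category.id_comp _).trans (F.map_id _).symm)
    · exact FamHom.ext' (fun _ => rfl)
        fun t => heq_of_eq ((Category.id_comp _).trans (F.map_id _).symm)
    · rintro q j' k' rfl rfl
      exact heq_of_eq ((Category.id_comp _).trans (F.cell_id _).symm)

/-- The action of a colax functor on families carries disjoint unions to disjoint unions, up to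
the isomorphisms `flatMap`. -/
theorem preservesUniversal_famMap : PreservesUniversal.{i} (famMap.{i} F) :=
  .of_unit (flatData.{i} D)
    (fun X => IsUniversal.of_eq (flatArrow_universal ((famMap (famMap.{i} F)).obj X))
      (famMap_flatArrow F X))
    (fun M => IsUniversal.of_eq
      (ColaxFunctor.UniversalCell.comp_cell (R := Delta (DblFam.{i} E))
        (flatCell_universal ((famMap (famMap.{i} F)).pro M)) (flatMap F M) (isIso_flatMap F M))
      (flatCell_flatMap F M))

end

end Flat

/-! ### Left adjoints preserve coproducts -/

theorem FamHom.ext_single {D : DblCat.{u, v, w, z}} {X : FamObj.{i} D} {a : D.Obj}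
    {f g : FamHom X (single a)} (h : ∀ k, (f.hom k : X.fam k ⟶ a) = g.hom k) : f = g :=
  FamHom.ext' (fun _ => rfl) fun k => heq_of_eq (h k)

theorem FamCell.ext_single {D : DblCat.{u, v, w, z}} {X Y : FamObj.{i} D} {M : FamPro X Y}
    {a b : D.Obj} {n : D.Pro a b} {α β : FamCell (Proarr.of M) (Proarr.of (singlePro n))}
    (hl : ∀ k, (α.lhom.hom k : X.fam k ⟶ a) = β.lhom.hom k)
    (hr : ∀ k, (α.rhom.hom k : Y.fam k ⟶ b) = β.rhom.hom k)
    (hc : ∀ (t : M.apex) {j : X.idx} {k : Y.idx} (hj : M.l t = j) (hk : M.r t = k),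
      (α.cell t hj hk : Proarr.of (M.pro t hj hk) ⟶ Proarr.of n) = β.cell t hj hk) : α = β :=
  FamCell.ext' (FamHom.ext_single hl) (FamHom.ext_single hr) (fun _ => rfl)
    fun t _ _ hj hk => heq_of_eq (hc t hj hk)

/-- The components of a cocone under a family of objects. -/
def FamHom.leg {D : DblCat.{u, v, w, z}} {X : FamObj.{i} D} {a : D.Obj}
    (f : FamHom X (single a)) (k : X.idx) : X.fam k ⟶ a :=
  f.hom k

/-- The components of a cocone under a family of proarrows. -/
def FamCell.leg {D : DblCat.{u, v, w, z}} {X Y : FamObj.{i} D} {M : FamPro X Y}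
    {a b : D.Obj} {n : D.Pro a b} (α : FamCell (Proarr.of M) (Proarr.of (singlePro n)))
    (t : M.apex) {j : X.idx} {k : Y.idx} (hj : M.l t = j) (hk : M.r t = k) :
    Proarr.of (M.pro t hj hk) ⟶ Proarr.of n :=
  α.cell t hj hk

section LeftAdjoint

variable {C : DblCat.{u₁, v₁, w₁, z₁}} {E : DblCat.{u₂, v₂, w₂, z₂}} {R : ColaxFunctor E C}
  (c : ColaxLeftAdjoint R)

namespace ColaxLeftAdjoint

theorem map_transpose {x : C.Obj} {b : E.Obj} (g : c.L.obj x ⟶ b) :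
    c.L.map (c.η x ≫ R.map g) ≫ c.ε b = g := by
  have ht' : c.L.map (c.η x) ≫ c.ε (c.L.obj x) = 𝟙 _ := c.left_triangle x
  rw [c.L.map_comp, Category.assoc, c.ε_naturality, reassoc_of% ht']

theorem cell_transpose {x y : C.Obj} {m : C.Pro x y} {a b : E.Obj} {p : E.Pro a b}
    (g : Proarr.of (c.L.pro m) ⟶ Proarr.of p) :
    c.L.cell (c.ηPro m ≫ R.cell g) ≫ c.εPro p = g := by
  have ht' : c.L.cell (c.ηPro m) ≫ c.εPro (c.L.pro m) = 𝟙 _ := c.left_trianglePro m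
  rw [c.L.cell_comp, Category.assoc, c.εPro_naturality, reassoc_of% ht']

theorem universalArrow_famMap {X : FamObj.{i} C} {a : C.Obj} {f : FamHom X (single a)}
    (hf : (Delta.{i} C).UniversalArrow (a := a) f) :
    (Delta.{i} E).UniversalArrow (a := c.L.obj a) ((famMap.{i} c.L).map f) := by
  have h₀ : ∀ (b : E.Obj) (g : ∀ k, c.L.obj (X.fam k) ⟶ b),
      ∃ h : c.L.obj a ⟶ b, ∀ k, c.L.map (f.leg k) ≫ h = g k := fun b g => by
    let g' : FamHom X (single (R.obj b)) := ⟨fun _ => ⟨⟩, fun k => c.η (X.fam k) ≫ R.map (g k)⟩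
    have e : ∀ k, f.leg k ≫ hf.desc (b := R.obj b) g' = c.η (X.fam k) ≫ R.map (g k) :=
      fun k => congrArg (fun t : FamHom X (single (R.obj b)) => t.leg k)
        (hf.fac (b := R.obj b) g')
    exact ⟨c.L.map (hf.desc (b := R.obj b) g') ≫ c.ε b, fun k => by
      rw [← c.L.map_comp_assoc, e, c.map_transpose]⟩
  have h₁ : ∀ (b : E.Obj) (g h : c.L.obj a ⟶ b),
      (∀ k, c.L.map (f.leg k) ≫ g = c.L.map (f.leg k) ≫ h) → g = h := fun b g h e => by
    have key : ∀ (g : c.L.obj a ⟶ b) k, f.leg k ≫ c.η a ≫ R.map g =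
        c.η (X.fam k) ≫ R.map (c.L.map (f.leg k) ≫ g) := fun g k => by
      rw [reassoc_of% c.η_naturality, R.map_comp]
    have : ∀ k, f.leg k ≫ c.η a ≫ R.map g = f.leg k ≫ c.η a ≫ R.map h := fun k => by
      rw [key, key, e]
    exact (c.universal_η a).ext (hf.ext (FamHom.ext_single this))
  refine ColaxFunctor.UniversalArrow.intro (fun b g => ?_) (fun b g h e => h₁ b g h fun k => ?_)
  · obtain ⟨h, hh⟩ := h₀ b (fun k => FamHom.leg g k)
    exact ⟨h, FamHom.ext_single hh⟩
  · exact congrArg (fun t : FamHom ((famMap.{i} c.L).obj X) (single b) => t.leg k) e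

/-- The transpose of a cocone under the values of `L` is a cocone under the given family. -/
def transposeCell {X Y : FamObj.{i} C} {M : FamPro X Y} {a b : E.Obj} {p : E.Pro a b}
    (gl : ∀ k, c.L.obj (X.fam k) ⟶ a) (gr : ∀ k, c.L.obj (Y.fam k) ⟶ b)
    (ψ : ∀ (t : M.apex) {j : X.idx} {k : Y.idx} (hj : M.l t = j) (hk : M.r t = k),
      Proarr.of (c.L.pro (M.pro t hj hk)) ⟶ Proarr.of p)
    (hl : ∀ (t : M.apex) {j : X.idx} {k : Y.idx} (hj : M.l t = j) (hk : M.r t = k),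
      E.left (ψ t hj hk) = gl j)
    (hr : ∀ (t : M.apex) {j : X.idx} {k : Y.idx} (hj : M.l t = j) (hk : M.r t = k),
      E.right (ψ t hj hk) = gr k) :
    FamCell (Proarr.of M) (Proarr.of (singlePro (R.pro p))) where
  lhom := ⟨fun _ => ⟨⟩, fun k => c.η (X.fam k) ≫ R.map (gl k)⟩
  rhom := ⟨fun _ => ⟨⟩, fun k => c.η (Y.fam k) ≫ R.map (gr k)⟩
  base _ := ⟨⟩
  l_base _ := rfl
  r_base _ := rfl
  cell t _ _ hj hk := c.ηPro (M.pro t hj hk) ≫ R.cell (ψ t hj hk)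
  left_cell t j k hj hk := (C.left_comp (c.ηPro (M.pro t hj hk)) (R.cell (ψ t hj hk))).trans (by
    rw [left_ηPro, R.left_cell, hl]
    rfl)
  right_cell t j k hj hk := (C.right_comp (c.ηPro (M.pro t hj hk)) (R.cell (ψ t hj hk))).trans (by
    rw [right_ηPro, R.right_cell, hr]
    rfl)

theorem universalCell_famMap {X Y : FamObj.{i} C} {M : FamPro X Y} {a b : C.Obj} {n : C.Pro a b}
    {φ : FamCell (Proarr.of M) (Proarr.of (singlePro n))}
    (hφ : (Delta.{i} C).UniversalCell (n := n) φ) :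
    (Delta.{i} E).UniversalCell (n := c.L.pro n) ((famMap.{i} c.L).cell φ) := by
  let φl : ∀ k, X.fam k ⟶ a := fun k => FamHom.leg φ.lhom k
  let φr : ∀ k, Y.fam k ⟶ b := fun k => FamHom.leg φ.rhom k
  have h₀ : ∀ {a' b' : E.Obj} (p : E.Pro a' b') (gl : ∀ k, c.L.obj (X.fam k) ⟶ a')
      (gr : ∀ k, c.L.obj (Y.fam k) ⟶ b')
      (ψ : ∀ (t : M.apex) {j : X.idx} {k : Y.idx} (hj : M.l t = j) (hk : M.r t = k),
        Proarr.of (c.L.pro (M.pro t hj hk)) ⟶ Proarr.of p),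
      (∀ (t : M.apex) {j : X.idx} {k : Y.idx} (hj : M.l t = j) (hk : M.r t = k),
        E.left (ψ t hj hk) = gl j) →
      (∀ (t : M.apex) {j : X.idx} {k : Y.idx} (hj : M.l t = j) (hk : M.r t = k),
        E.right (ψ t hj hk) = gr k) →
      ∃ γ : Proarr.of (c.L.pro n) ⟶ Proarr.of p,
        (∀ k, c.L.map (φl k) ≫ E.left γ = gl k) ∧ (∀ k, c.L.map (φr k) ≫ E.right γ = gr k) ∧
        ∀ (t : M.apex) {j : X.idx} {k : Y.idx} (hj : M.l t = j) (hk : M.r t = k),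
          c.L.cell (φ.leg t hj hk) ≫ γ = ψ t hj hk := fun {a' b'} p gl gr ψ hl hr => by
    have hh := hφ.fac (p := R.pro p) (c.transposeCell gl gr ψ hl hr)
    set γ := hφ.desc (p := R.pro p) (c.transposeCell gl gr ψ hl hr)
    have el : ∀ k, φl k ≫ C.left γ = c.η (X.fam k) ≫ R.map (gl k) := fun k => congrArg
      (fun t : FamCell (Proarr.of M) (Proarr.of (singlePro (R.pro p))) => FamHom.leg t.lhom k) hh
    have er : ∀ k, φr k ≫ C.right γ = c.η (Y.fam k) ≫ R.map (gr k) := fun k => congrArg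
      (fun t : FamCell (Proarr.of M) (Proarr.of (singlePro (R.pro p))) => FamHom.leg t.rhom k) hh
    have ec : ∀ (t : M.apex) {j : X.idx} {k : Y.idx} (hj : M.l t = j) (hk : M.r t = k),
        φ.leg t hj hk ≫ γ = c.ηPro (M.pro t hj hk) ≫ R.cell (ψ t hj hk) :=
      fun t _ _ hj hk => congrArg
        (fun s : FamCell (Proarr.of M) (Proarr.of (singlePro (R.pro p))) => s.leg t hj hk) hh
    refine ⟨c.L.cell γ ≫ c.εPro p, fun k => ?_, fun k => ?_, fun t j k hj hk => ?_⟩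
    · rw [E.left_comp, c.L.left_cell, left_εPro, ← c.L.map_comp_assoc, el, c.map_transpose]
    · rw [E.right_comp, c.L.right_cell, right_εPro, ← c.L.map_comp_assoc, er, c.map_transpose]
    · rw [← c.L.cell_comp_assoc, ec, c.cell_transpose]
  have h₁ : ∀ {a' b' : E.Obj} (p : E.Pro a' b') (α β : Proarr.of (c.L.pro n) ⟶ Proarr.of p),
      (∀ k, c.L.map (φl k) ≫ E.left α = c.L.map (φl k) ≫ E.left β) →
      (∀ k, c.L.map (φr k) ≫ E.right α = c.L.map (φr k) ≫ E.right β) →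
      (∀ (t : M.apex) {j : X.idx} {k : Y.idx} (hj : M.l t = j) (hk : M.r t = k),
        c.L.cell (φ.leg t hj hk) ≫ α = c.L.cell (φ.leg t hj hk) ≫ β) → α = β :=
      fun {a' b'} p α β el er ec => by
    have kl : ∀ (g : Proarr.of (c.L.pro n) ⟶ Proarr.of p) k,
        φl k ≫ C.left (c.ηPro n ≫ R.cell g) =
          c.η (X.fam k) ≫ R.map (c.L.map (φl k) ≫ E.left g) := fun g k => by
      rw [C.left_comp, left_ηPro, R.left_cell, reassoc_of% c.η_naturality, R.map_comp]
    have kr : ∀ (g : Proarr.of (c.L.pro n) ⟶ Proarr.of p) k,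
        φr k ≫ C.right (c.ηPro n ≫ R.cell g) =
          c.η (Y.fam k) ≫ R.map (c.L.map (φr k) ≫ E.right g) := fun g k => by
      rw [C.right_comp, right_ηPro, R.right_cell, reassoc_of% c.η_naturality, R.map_comp]
    have kc : ∀ (g : Proarr.of (c.L.pro n) ⟶ Proarr.of p) (t : M.apex) {j : X.idx} {k : Y.idx}
        (hj : M.l t = j) (hk : M.r t = k), φ.leg t hj hk ≫ c.ηPro n ≫ R.cell g =
          c.ηPro (M.pro t hj hk) ≫ R.cell (c.L.cell (φ.leg t hj hk) ≫ g) := fun g t _ _ hj hk => by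
      rw [reassoc_of% c.ηPro_naturality, R.cell_comp]
    have el' : ∀ k, φl k ≫ C.left (c.ηPro n ≫ R.cell α) = φl k ≫ C.left (c.ηPro n ≫ R.cell β) :=
      fun k => by rw [kl, kl, el]
    have er' : ∀ k, φr k ≫ C.right (c.ηPro n ≫ R.cell α) = φr k ≫ C.right (c.ηPro n ≫ R.cell β) :=
      fun k => by rw [kr, kr, er]
    have ec' : ∀ (t : M.apex) {j : X.idx} {k : Y.idx} (hj : M.l t = j) (hk : M.r t = k),
        φ.leg t hj hk ≫ c.ηPro n ≫ R.cell α = φ.leg t hj hk ≫ c.ηPro n ≫ R.cell β :=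
      fun t _ _ hj hk => by rw [kc, kc, ec]
    exact (c.universal_ηPro n).ext (hφ.ext (p := R.pro p) (FamCell.ext_single el' er' ec'))
  refine ColaxFunctor.UniversalCell.intro (fun {a' b'} p ψ => ?_) (fun {a' b'} p α β e =>
    h₁ p α β (fun k => ?_) (fun k => ?_) (fun t' j k hj hk => ?_))
  · obtain ⟨γ, hl, hr, hc⟩ := h₀ p (fun k => FamHom.leg (FamCell.lhom ψ) k)
      (fun k => FamHom.leg (FamCell.rhom ψ) k) (fun t _ _ hj hk => FamCell.leg ψ t hj hk)
      (fun t _ _ hj hk => FamCell.left_cell ψ t hj hk)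
      (fun t _ _ hj hk => FamCell.right_cell ψ t hj hk)
    exact ⟨γ, FamCell.ext_single hl hr hc⟩
  · exact congrArg (fun t : FamCell (Proarr.of (P := FamPro) ((famMap.{i} c.L).pro M))
      (Proarr.of (singlePro p)) => FamHom.leg t.lhom k) e
  · exact congrArg (fun t : FamCell (Proarr.of (P := FamPro) ((famMap.{i} c.L).pro M))
      (Proarr.of (singlePro p)) => FamHom.leg t.rhom k) e
  · exact congrArg (fun t : FamCell (Proarr.of (P := FamPro) ((famMap.{i} c.L).pro M))
      (Proarr.of (singlePro p)) => t.leg t' hj hk) e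

/-- A left adjoint preserves coproducts: cocones under its values are transposed to cocones under
the given family. -/
theorem preservesUniversal : PreservesUniversal.{i} c.L :=
  ⟨fun hf => c.universalArrow_famMap hf, fun hφ => c.universalCell_famMap hφ⟩

end ColaxLeftAdjoint

end LeftAdjoint

theorem PreservesUniversal.comp {B : DblCat.{u₁, v₁, w₁, z₁}} {C : DblCat.{u₂, v₂, w₂, z₂}}
    {E : DblCat.{u₃, v₃, w₃, z₃}} {F : ColaxFunctor B C} {G : ColaxFunctor C E}
    (hF : PreservesUniversal.{i} F) (hG : PreservesUniversal.{i} G) :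
    PreservesUniversal.{i} (F.comp G) :=
  ⟨fun hf => hG.arrow (hF.arrow hf), fun hφ => hG.cell (hF.cell hφ)⟩

/-! ### The counit of coproducts -/

section Counit

variable {D : DblCat.{u, v, w, z}}

theorem Delta_map_injective {x y : D.Obj} {f g : x ⟶ y}
    (h : (Delta.{i} D).map f = (Delta.{i} D).map g) : f = g :=
  congrArg (fun t => FamHom.leg (X := single x) (a := y) t PUnit.unit) h

theorem Delta_cell_injective {x y x' y' : D.Obj} {m : D.Pro x y} {m' : D.Pro x' y'}
    {α β : Proarr.of m ⟶ Proarr.of m'} (h : (Delta.{i} D).cell α = (Delta.{i} D).cell β) :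
    α = β :=
  congrArg (fun t => FamCell.leg t (⟨⟩ : PUnit) rfl rfl) h

theorem Delta_map_surjective {x y : D.Obj} (f : (Delta.{i} D).obj x ⟶ (Delta.{i} D).obj y) :
    ∃ g, (Delta.{i} D).map g = f :=
  ⟨FamHom.leg (X := single x) (a := y) f PUnit.unit, rfl⟩

theorem Delta_cell_surjective {x y x' y' : D.Obj} {m : D.Pro x y} {m' : D.Pro x' y'}
    (α : Proarr.of ((Delta.{i} D).pro m) ⟶ Proarr.of ((Delta.{i} D).pro m')) :
    ∃ β, (Delta.{i} D).cell β = α :=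
  ⟨FamCell.leg α (⟨⟩ : PUnit) rfl rfl, FamCell.ext_single
    (fun _ => FamCell.left_cell α (⟨⟩ : PUnit) rfl rfl)
    (fun _ => FamCell.right_cell α (⟨⟩ : PUnit) rfl rfl) (fun _ _ _ _ _ => rfl)⟩

/-- Since `Δ` is fully faithful, the counit of coproducts is invertible. -/
theorem isIso_counit (c : Coproducts.{i} D) : IsIso c.counit := by
  refine (DblTrans.isIso_iff _).2 ⟨fun x => ?_, fun {x y} m => ?_⟩
  · obtain ⟨g, hg⟩ := Delta_map_surjective (c.η ((Delta.{i} D).obj x))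
    have ht : c.η ((Delta.{i} D).obj x) ≫ (Delta.{i} D).map (c.ε x) = 𝟙 _ := c.right_triangle x
    refine ⟨g, (c.universal_η _).ext ?_, Delta_map_injective.{i} ?_⟩
    · refine (congrArg (c.η _ ≫ ·) ((Delta.{i} D).map_comp _ _)).trans ?_
      refine (Category.assoc _ _ _).symm.trans ((congrArg (· ≫ _) ht).trans ?_)
      refine (Category.id_comp _).trans (hg.trans ?_)
      exact (Category.comp_id _).symm.trans
        (congrArg (c.η _ ≫ ·) ((Delta.{i} D).map_id _).symm)
    · refine ((Delta.{i} D).map_comp _ _).trans ((congrArg (· ≫ _) hg).trans (ht.trans ?_))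
      exact ((Delta.{i} D).map_id _).symm
  · obtain ⟨g, hg⟩ := Delta_cell_surjective (c.ηPro ((Delta.{i} D).pro m))
    have ht : c.ηPro ((Delta.{i} D).pro m) ≫ (Delta.{i} D).cell (c.εPro m) = 𝟙 _ :=
      c.right_trianglePro m
    refine ⟨g, (c.universal_ηPro _).ext ?_, Delta_cell_injective.{i} ?_⟩
    · refine (congrArg (c.ηPro _ ≫ ·) ((Delta.{i} D).cell_comp _ _)).trans ?_
      refine (Category.assoc _ _ _).symm.trans ((congrArg (· ≫ _) ht).trans ?_)
      refine (Category.id_comp _).trans (hg.trans ?_)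
      exact (Category.comp_id _).symm.trans
        (congrArg (c.ηPro _ ≫ ·) ((Delta.{i} D).cell_id _).symm)
    · refine ((Delta.{i} D).cell_comp _ _).trans ((congrArg (· ≫ _) hg).trans (ht.trans ?_))
      exact ((Delta.{i} D).cell_id _).symm

/-- The extension of `F` along `Δ` takes coproducts of the values of `F`. -/
theorem Delta_comp_extension {E : DblCat.{u₁, v₁, w₁, z₁}} (d : Coproducts.{i} E)
    (F : ColaxFunctor D E) : Nonempty ((Delta.{i} D).comp ((famMap F).comp d.L) ≅ F) := by
  rw [← ColaxFunctor.comp_assoc, Delta_comp_famMap, ColaxFunctor.comp_assoc]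
  have h := (DblTrans.isIso_iff _).1 (isIso_counit d)
  have : IsIso (DblTrans.whisker F d.counit) :=
    (DblTrans.isIso_iff _).2 ⟨fun x => h.1 (F.obj x), fun m => h.2 (F.pro m)⟩
  exact ⟨asIso (DblTrans.whisker F d.counit) ≪≫ eqToIso F.comp_idFunctor⟩

end Counit

/-! ### Every family is a coproduct of singletons -/

section Dense

variable {D : DblCat.{u, v, w, z}}

/-- The inclusion of a member of a family of objects, as a singleton family. -/
def incl (X : (DblFam.{i} D).Obj) (k : FamObj.idx X) :
    (Delta.{i} D).obj (FamObj.fam X k) ⟶ X where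
  base _ := k
  hom _ := 𝟙 (FamObj.fam X k)

/-- The inclusion of a member of a family of proarrows, as a singleton family. -/
def inclCell {X Y : (DblFam.{i} D).Obj} (M : (DblFam.{i} D).Pro X Y) (a : FamPro.apex M)
    {j : FamObj.idx X} {k : FamObj.idx Y} (hj : FamPro.l M a = j) (hk : FamPro.r M a = k) :
    Proarr.of ((Delta.{i} D).pro (FamPro.pro M a hj hk)) ⟶ Proarr.of M where
  lhom := incl X j
  rhom := incl Y k
  base _ := a
  l_base _ := hj
  r_base _ := hk
  cell _ _ _ _ _ := 𝟙 (Proarr.of (FamPro.pro M a hj hk))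
  left_cell _ _ _ _ _ := D.left_id _
  right_cell _ _ _ _ _ := D.right_id _

/-- The cocone that exhibits a family of objects as the coproduct of its members. -/
def densArrow (X : FamObj.{i} D) : FamHom ((famMap (Delta.{i} D)).obj X) (single X) where
  base _ := ⟨⟩
  hom k := incl X k

/-- The cocone that exhibits a family of proarrows as the coproduct of its members. -/
def densCell {X Y : FamObj.{i} D} (M : FamPro X Y) :
    FamCell (Proarr.of (P := FamPro) ((famMap (Delta.{i} D)).pro M))
      (Proarr.of (P := FamPro) (singlePro (D := DblFam.{i} D) M)) where
  lhom := densArrow X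
  rhom := densArrow Y
  base _ := ⟨⟩
  l_base _ := rfl
  r_base _ := rfl
  cell a _ _ hj hk := inclCell M a hj hk
  left_cell _ _ _ _ _ := rfl
  right_cell _ _ _ _ _ := rfl

theorem densArrow_universal (X : FamObj.{i} D) :
    (Delta.{i} (DblFam.{i} D)).UniversalArrow (a := X) (densArrow X) := by
  refine ColaxFunctor.UniversalArrow.intro (fun Z g => ⟨?_, ?_⟩) (fun Z g h e => ?_)
  · exact ⟨fun k => FamHom.base (FamHom.hom g k) PUnit.unit,
      fun k => FamHom.hom (FamHom.hom g k) PUnit.unit⟩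
  · exact FamHom.ext' (fun k => rfl) (fun k => heq_of_eq
      (FamHom.ext' (fun t => rfl) fun t => heq_of_eq (Category.id_comp _)))
  · have e' : ∀ k, (incl X k : (DblFam.{i} D).cat.Hom _ _) ≫ g = incl X k ≫ h :=
      fun k => eq_of_heq (FamHom.hom_heq e k)
    refine FamHom.ext' (fun k => ?_) (fun k => ?_)
    · exact congrFun (congrArg FamHom.base (e' k)) PUnit.unit
    · exact (heq_of_eq (Category.id_comp _).symm).trans ((FamHom.hom_heq (e' k) PUnit.unit).trans
        (heq_of_eq (Category.id_comp _)))

/-- A cell out of `M` is the same as a family of cells out of the singletons on its members, with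
sides the restrictions of a pair of arrows of families. -/
theorem densCell_universal {X Y : FamObj.{i} D} (M : FamPro X Y) :
    (Delta.{i} (DblFam.{i} D)).UniversalCell (n := M) (densCell M) := by
  refine ColaxFunctor.UniversalCell.intro (fun {S T} P ψ => ⟨?_, ?_⟩) (fun {S T} P α β e => ?_)
  · have hl : ∀ (a : M.apex) {j : X.idx} {k : Y.idx} (hj : M.l a = j) (hk : M.r a = k),
      FamCell.lhom (FamCell.cell ψ a hj hk) = FamHom.hom (FamCell.lhom ψ) j :=
      fun a _ _ hj hk => FamCell.left_cell ψ a hj hk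
    have hr : ∀ (a : M.apex) {j : X.idx} {k : Y.idx} (hj : M.l a = j) (hk : M.r a = k),
      FamCell.rhom (FamCell.cell ψ a hj hk) = FamHom.hom (FamCell.rhom ψ) k :=
      fun a _ _ hj hk => FamCell.right_cell ψ a hj hk
    exact
      { lhom := ⟨fun k => FamHom.base (FamHom.hom (FamCell.lhom ψ) k) PUnit.unit,
          fun k => FamHom.hom (FamHom.hom (FamCell.lhom ψ) k) PUnit.unit⟩
        rhom := ⟨fun k => FamHom.base (FamHom.hom (FamCell.rhom ψ) k) PUnit.unit,
          fun k => FamHom.hom (FamHom.hom (FamCell.rhom ψ) k) PUnit.unit⟩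
        base := fun a => FamCell.base (FamCell.cell ψ a rfl rfl) PUnit.unit
        l_base := fun a => (FamCell.l_base (FamCell.cell ψ a rfl rfl) PUnit.unit).trans
          (congrArg (fun t => FamHom.base t _) (hl a rfl rfl))
        r_base := fun a => (FamCell.r_base (FamCell.cell ψ a rfl rfl) PUnit.unit).trans
          (congrArg (fun t => FamHom.base t _) (hr a rfl rfl))
        cell := fun a _ _ hj hk =>
          match hj, hk with
          | rfl, rfl => FamCell.cellOf (FamCell.cell ψ a rfl rfl)
              (hl a rfl rfl) (hr a rfl rfl) PUnit.unit rfl rfl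
        left_cell := by
          rintro p j k rfl rfl
          exact FamCell.left_cellOf _ _ _ _ _ _
        right_cell := by
          rintro p j k rfl rfl
          exact FamCell.right_cellOf _ _ _ _ _ _ }
  · refine FamCell.ext' ?_ ?_ (fun _ => rfl) ?_
    · exact FamHom.ext' (fun k => rfl) (fun k => heq_of_eq
        (FamHom.ext' (fun t => rfl) fun t => heq_of_eq (Category.id_comp _)))
    · exact FamHom.ext' (fun k => rfl) (fun k => heq_of_eq
        (FamHom.ext' (fun t => rfl) fun t => heq_of_eq (Category.id_comp _)))
    · rintro a j k rfl rfl
      refine heq_of_eq (FamCell.ext' ?_ ?_ (fun _ => rfl) ?_)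
      · refine Eq.trans ?_ (FamCell.left_cell ψ a rfl rfl).symm
        exact FamHom.ext' (fun t => rfl) fun t => heq_of_eq (Category.id_comp _)
      · refine Eq.trans ?_ (FamCell.right_cell ψ a rfl rfl).symm
        exact FamHom.ext' (fun t => rfl) fun t => heq_of_eq (Category.id_comp _)
      · rintro b j' k' rfl rfl
        exact (heq_of_eq (Category.id_comp _)).trans (FamCell.cellOf_heq _ _ _ _ _ _)
  · have hl : FamCell.lhom α = FamCell.lhom β :=
      (densArrow_universal X).ext (congrArg FamCell.lhom e)
    have hr : FamCell.rhom α = FamCell.rhom β :=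
      (densArrow_universal Y).ext (congrArg FamCell.rhom e)
    have e' : ∀ (a : M.apex) {j : X.idx} {k : Y.idx} (hj : M.l a = j) (hk : M.r a = k),
        inclCell M a hj hk ≫ α = inclCell M a hj hk ≫ β :=
      fun a _ _ hj hk => eq_of_heq (FamCell.cell_heq e a hj hk)
    refine FamCell.ext' hl hr ?_ ?_
    · intro a
      exact congrFun (congrArg FamCell.base (e' a rfl rfl)) PUnit.unit
    · intro a j k hj hk
      exact (heq_of_eq (Category.id_comp _).symm).trans
        ((FamCell.cell_heq (e' a hj hk) PUnit.unit rfl rfl).trans (heq_of_eq (Category.id_comp _)))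

theorem map_comp_incl {X Y : (DblFam.{i} D).Obj} (f : X ⟶ Y) (k : FamObj.idx X) :
    (Delta.{i} D).map (FamHom.hom f k) ≫ incl Y (FamHom.base f k) = incl X k ≫ f :=
  FamHom.ext' (fun _ => rfl)
    fun _ => heq_of_eq ((Category.comp_id _).trans (Category.id_comp _).symm)

theorem cell_comp_inclCell {X Y X' Y' : (DblFam.{i} D).Obj} {M : (DblFam.{i} D).Pro X Y}
    {M' : (DblFam.{i} D).Pro X' Y'} (α : Proarr.of M ⟶ Proarr.of M') (a : FamPro.apex M)
    {j : FamObj.idx X} {k : FamObj.idx Y} (hj : FamPro.l M a = j) (hk : FamPro.r M a = k) :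
    (Delta.{i} D).cell (FamCell.cell α a hj hk) ≫ inclCell M' (FamCell.base α a)
        ((FamCell.l_base α a).trans (congrArg (FamHom.base (FamCell.lhom α)) hj))
        ((FamCell.r_base α a).trans (congrArg (FamHom.base (FamCell.rhom α)) hk)) =
      inclCell M a hj hk ≫ α := by
  refine FamCell.ext' ?_ ?_ (fun _ => rfl) ?_
  · exact FamHom.ext' (fun _ => rfl) fun _ => heq_of_eq ((Category.comp_id _).trans
      ((FamCell.left_cell α a hj hk).trans (Category.id_comp _).symm))
  · exact FamHom.ext' (fun _ => rfl) fun _ => heq_of_eq ((Category.comp_id _).trans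
      ((FamCell.right_cell α a hj hk).trans (Category.id_comp _).symm))
  · intro _ _ _ _ _
    exact heq_of_eq ((Category.comp_id _).trans (Category.id_comp _).symm)

theorem inclCell_hcomp {X Y Z : (DblFam.{i} D).Obj} (M : (DblFam.{i} D).Pro X Y)
    (N : (DblFam.{i} D).Pro Y Z) (p : PullbackPt (FamPro.r M) (FamPro.l N)) {j : FamObj.idx X}
    {k : FamObj.idx Z} (hj : FamPro.l M p.fst = j) (hk : FamPro.r N p.snd = k) :
    inclCell ((DblFam.{i} D).hcomp M N) p hj hk =
      (Delta.{i} D).cmp (FamPro.pro M p.fst hj p.fst_eq) (FamPro.pro N p.snd p.snd_eq hk) ≫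
        (DblFam.{i} D).hcompCell (inclCell M p.fst hj p.fst_eq) (inclCell N p.snd p.snd_eq hk)
          rfl := by
  refine FamCell.ext' ?_ ?_ (fun _ => rfl) ?_
  · exact FamHom.ext' (fun _ => rfl) fun _ => heq_of_eq (Category.id_comp _).symm
  · exact FamHom.ext' (fun _ => rfl) fun _ => heq_of_eq (Category.id_comp _).symm
  · intro _ _ _ _ _
    exact heq_of_eq ((D.hcompCell_id _ _).symm.trans (Category.id_comp _).symm)

theorem inclCell_hid (X : (DblFam.{i} D).Obj) (k : FamObj.idx X) :
    inclCell ((DblFam.{i} D).hid X) k rfl rfl =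
      (Delta.{i} D).idcmp (FamObj.fam X k) ≫ (DblFam.{i} D).hidCell (incl X k) := by
  refine FamCell.ext' ?_ ?_ (fun _ => rfl) ?_
  · exact FamHom.ext' (fun _ => rfl) fun _ => heq_of_eq (Category.id_comp _).symm
  · exact FamHom.ext' (fun _ => rfl) fun _ => heq_of_eq (Category.id_comp _).symm
  · intro _ _ _ _ _
    exact heq_of_eq ((D.hidCell_id _).symm.trans (Category.id_comp _).symm)

end Dense

/-! ### The action of natural transformations on families -/

section FamTrans

variable {C : DblCat.{u₁, v₁, w₁, z₁}} {E : DblCat.{u₂, v₂, w₂, z₂}} {F G : ColaxFunctor C E}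

/-- The action of a natural transformation on a family of objects. -/
def famTransApp (θ : F ⟶ G) (X : (DblFam.{i} C).Obj) :
    (famMap.{i} F).obj X ⟶ (famMap.{i} G).obj X where
  base k := k
  hom k := θ.app (FamObj.fam X k)

/-- The action of a natural transformation on a family of proarrows. -/
def famTransAppPro (θ : F ⟶ G) {X Y : (DblFam.{i} C).Obj} (M : (DblFam.{i} C).Pro X Y) :
    Proarr.of ((famMap.{i} F).pro M) ⟶ Proarr.of ((famMap.{i} G).pro M) where
  lhom := famTransApp θ X
  rhom := famTransApp θ Y
  base a := a
  l_base _ := rfl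
  r_base _ := rfl
  cell a _ _ hj hk := θ.appPro (FamPro.pro M a hj hk)
  left_cell _ _ _ _ _ := θ.left_appPro _
  right_cell _ _ _ _ _ := θ.right_appPro _

theorem famTransApp_comp {H : ColaxFunctor C E} {α : F ⟶ G} {β : G ⟶ H} {γ : F ⟶ H}
    (h : α ≫ β = γ) (X : (DblFam.{i} C).Obj) :
    famTransApp α X ≫ famTransApp β X = famTransApp γ X := by
  subst h
  rfl

theorem famTransAppPro_comp {H : ColaxFunctor C E} {α : F ⟶ G} {β : G ⟶ H} {γ : F ⟶ H}
    (h : α ≫ β = γ) {X Y : (DblFam.{i} C).Obj} (M : (DblFam.{i} C).Pro X Y) :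
    famTransAppPro α M ≫ famTransAppPro β M = famTransAppPro γ M := by
  subst h
  rfl

theorem isIso_famTransApp (θ : F ⟶ G) [IsIso θ] (X : (DblFam.{i} C).Obj) :
    IsIso (famTransApp θ X) :=
  ⟨famTransApp (inv θ) X, famTransApp_comp (IsIso.hom_inv_id θ) X,
    famTransApp_comp (IsIso.inv_hom_id θ) X⟩

theorem isIso_famTransAppPro (θ : F ⟶ G) [IsIso θ] {X Y : (DblFam.{i} C).Obj}
    (M : (DblFam.{i} C).Pro X Y) : IsIso (famTransAppPro θ M) :=
  ⟨famTransAppPro (inv θ) M, famTransAppPro_comp (IsIso.hom_inv_id θ) M,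
    famTransAppPro_comp (IsIso.inv_hom_id θ) M⟩

theorem ColaxFunctor.UniversalArrow.iso_comp {R : ColaxFunctor C E} {x y : E.Obj} {a : C.Obj}
    {f : x ⟶ R.obj a} (hf : R.UniversalArrow f) (e : y ⟶ x) (he : IsIso e) :
    R.UniversalArrow (e ≫ f) :=
  IsUniversal.iso_comp hf e

theorem ColaxFunctor.UniversalCell.iso_comp {R : ColaxFunctor C E} {x y x' y' : E.Obj}
    {a b : C.Obj} {m : E.Pro x y} {m' : E.Pro x' y'} {n : C.Pro a b}
    {φ : Proarr.of m ⟶ Proarr.of (R.pro n)} (hφ : R.UniversalCell φ)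
    (α : Proarr.of m' ⟶ Proarr.of m) (hα : IsIso α) : R.UniversalCell (α ≫ φ) :=
  IsUniversal.iso_comp hφ α

theorem IsUniversal.of_comp_map {A : Type u₁} [Category.{v₁} A] {B : Type u₂} [Category.{v₂} B]
    {F : A ⥤ B} {x : B} {a b : A} {f : x ⟶ F.obj a} {e : a ⟶ b} [IsIso e]
    (hf : IsUniversal F (f ≫ F.map e)) : IsUniversal F f :=
  (hf.comp_map (inv e)).of_eq (by rw [Category.assoc, ← F.map_comp, IsIso.hom_inv_id, F.map_id,
    Category.comp_id])

/-- Preservation of coproducts is invariant under isomorphism of colax functors. -/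
theorem PreservesUniversal.of_iso (hG : PreservesUniversal.{i} G) (θ : F ⟶ G) [IsIso θ] :
    PreservesUniversal.{i} F where
  arrow {X a f} hf := by
    have h₁ : (famMap.{i} F).map f ≫ (Delta.{i} E).map (θ.app a) =
        famTransApp θ X ≫ (famMap.{i} G).map f :=
      FamHom.ext' (fun _ => rfl) fun k => heq_of_eq (θ.naturality (FamHom.hom f k))
    have h₂ := ((DblTrans.isIso_iff θ).1 inferInstance).1 a
    have h₃ := isIso_famTransApp θ X
    exact IsUniversal.of_comp_map (F := (Delta.{i} E).objFunctor) (e := θ.app a)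
      (IsUniversal.of_eq (IsUniversal.iso_comp (hG.arrow hf) (famTransApp θ X)) h₁.symm)
  cell {X Y M a b n φ} hφ := by
    have h₁ : (famMap.{i} F).cell φ ≫ (Delta.{i} E).cell (θ.appPro n) =
        famTransAppPro θ M ≫ (famMap.{i} G).cell φ := by
      refine FamCell.ext' ?_ ?_ (fun _ => rfl) fun t j k hj hk =>
        heq_of_eq (θ.naturalityPro (FamCell.cell φ t hj hk))
      · exact FamHom.ext' (fun _ => rfl) fun k => heq_of_eq
          ((congrArg (F.map (FamHom.hom (FamCell.lhom φ) k) ≫ ·) (θ.left_appPro n)).trans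
            (θ.naturality (FamHom.hom (FamCell.lhom φ) k)))
      · exact FamHom.ext' (fun _ => rfl) fun k => heq_of_eq
          ((congrArg (F.map (FamHom.hom (FamCell.rhom φ) k) ≫ ·) (θ.right_appPro n)).trans
            (θ.naturality (FamHom.hom (FamCell.rhom φ) k)))
    have h₂ := ((DblTrans.isIso_iff θ).1 inferInstance).2 n
    have h₃ := isIso_famTransAppPro θ M
    exact IsUniversal.of_comp_map (F := (Delta.{i} E).proFunctor) (a := Proarr.of (F.pro n))
      (b := Proarr.of (G.pro n)) (e := θ.appPro n)
      (IsUniversal.of_eq (IsUniversal.iso_comp (hG.cell hφ) (famTransAppPro θ M)) h₁.symm)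

end FamTrans

/-! ### Uniqueness of extensions along `Δ` -/

namespace TransInto

variable {B : DblCat.{u₁, v₁, w₁, z₁}} {C : DblCat.{u₂, v₂, w₂, z₂}}
  {E : DblCat.{u₃, v₃, w₃, z₃}} {K : ColaxFunctor B E} {J : ColaxFunctor B C}
  {H : ColaxFunctor C E}

/-- The transformation into `J ⋙ H`, with the composite unfolded. -/
def ofTrans (σ : K ⟶ J.comp H) : TransInto K J H where
  app := σ.app
  naturality := σ.naturality
  appPro := σ.appPro
  left_appPro := σ.left_appPro
  right_appPro := σ.right_appPro
  naturalityPro := σ.naturalityPro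
  comp_cmp m n := (σ.comp_cmp m n).trans (congrArg (σ.appPro (B.hcomp m n) ≫ ·) rfl)
  comp_idcmp x := (σ.comp_idcmp x).trans (congrArg (σ.appPro (B.hid x) ≫ ·) rfl)

variable (ρ : TransInto K J H)

theorem map_app_comp {x y : B.Obj} {a b : C.Obj} {g : x ⟶ y} {p : J.obj x ⟶ a}
    {q : J.obj y ⟶ b} {f : a ⟶ b} (h : J.map g ≫ q = p ≫ f) :
    K.map g ≫ ρ.app y ≫ H.map q = (ρ.app x ≫ H.map p) ≫ H.map f := by
  rw [reassoc_of% ρ.naturality, ← H.map_comp, h, H.map_comp, Category.assoc]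

theorem left_appPro_comp {x y : B.Obj} {m : B.Pro x y} {a b : C.Obj} {n : C.Pro a b}
    {α : Proarr.of (J.pro m) ⟶ Proarr.of n} {f : J.obj x ⟶ a} (h : C.left α = f) :
    E.left (ρ.appPro m ≫ H.cell α) = ρ.app x ≫ H.map f := by
  rw [E.left_comp, ρ.left_appPro, H.left_cell, h]

theorem right_appPro_comp {x y : B.Obj} {m : B.Pro x y} {a b : C.Obj} {n : C.Pro a b}
    {α : Proarr.of (J.pro m) ⟶ Proarr.of n} {f : J.obj y ⟶ b} (h : C.right α = f) :
    E.right (ρ.appPro m ≫ H.cell α) = ρ.app y ≫ H.map f := by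
  rw [E.right_comp, ρ.right_appPro, H.right_cell, h]

theorem cell_appPro_comp {x y x' y' : B.Obj} {m : B.Pro x y} {m' : B.Pro x' y'} {a b a' b' : C.Obj}
    {n : C.Pro a b} {n' : C.Pro a' b'} {γ : Proarr.of m ⟶ Proarr.of m'}
    {p : Proarr.of (J.pro m) ⟶ Proarr.of n} {q : Proarr.of (J.pro m') ⟶ Proarr.of n'}
    {α : Proarr.of n ⟶ Proarr.of n'} (h : J.cell γ ≫ q = p ≫ α) :
    K.cell γ ≫ ρ.appPro m' ≫ H.cell q = (ρ.appPro m ≫ H.cell p) ≫ H.cell α := by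
  rw [reassoc_of% ρ.naturalityPro, ← H.cell_comp, h, H.cell_comp, Category.assoc]

theorem cmp_appPro_comp {x y t : B.Obj} {m : B.Pro x y} {n : B.Pro y t} {a b c : C.Obj}
    {p : C.Pro a b} {q : C.Pro b c} {α : Proarr.of (J.pro m) ⟶ Proarr.of p}
    {β : Proarr.of (J.pro n) ⟶ Proarr.of q} {γ : Proarr.of (J.pro (B.hcomp m n)) ⟶
      Proarr.of (C.hcomp p q)} {h : C.right α = C.left β}
    (e : γ = J.cmp m n ≫ C.hcompCell α β h)
    (h' : E.right (ρ.appPro m ≫ H.cell α) = E.left (ρ.appPro n ≫ H.cell β)) :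
    K.cmp m n ≫ E.hcompCell (ρ.appPro m ≫ H.cell α) (ρ.appPro n ≫ H.cell β) h' =
      (ρ.appPro (B.hcomp m n) ≫ H.cell γ) ≫ H.cmp p q ≫ 𝟙 _ := by
  subst e
  rw [E.hcompCell_comp _ _ _ _ (by rw [ρ.left_appPro, ρ.right_appPro]) (by
    rw [H.left_cell, H.right_cell, h]), reassoc_of% ρ.comp_cmp, ← H.cmp_naturality _ _ h,
    H.cell_comp]
  simp only [Category.assoc, Category.comp_id]

theorem idcmp_appPro_comp {x : B.Obj} {a : C.Obj} {f : J.obj x ⟶ a}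
    {γ : Proarr.of (J.pro (B.hid x)) ⟶ Proarr.of (C.hid a)}
    (e : γ = J.idcmp x ≫ C.hidCell f) :
    K.idcmp x ≫ E.hidCell (ρ.app x ≫ H.map f) =
      (ρ.appPro (B.hid x) ≫ H.cell γ) ≫ H.idcmp a ≫ 𝟙 _ := by
  subst e
  rw [E.hidCell_comp, reassoc_of% ρ.comp_idcmp, ← H.idcmp_naturality, H.cell_comp]
  simp only [Category.assoc, Category.comp_id]

end TransInto

section Uniqueness

variable {D : DblCat.{u, v, w, z}} {E : DblCat.{u₁, v₁, w₁, z₁}} {K : ColaxFunctor D E}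
  {H : ColaxFunctor (DblFam.{i} D) E}

/-- A natural transformation `K ⟶ Δ ⋙ H` induces a cocone from the values of `K` at the members of
a family to the value of `H` at the family, naturally in the family. -/
def densTrans (ρ : TransInto K (Delta.{i} D) H) : TransInto (famMap.{i} K) H (Delta.{i} E) where
  app X :=
    { base := fun _ => ⟨⟩
      hom := fun k => ρ.app (FamObj.fam X k) ≫ H.map (incl X k) }
  naturality f := FamHom.ext' (fun _ => rfl) fun k =>
    heq_of_eq (ρ.map_app_comp (map_comp_incl f k))
  appPro {X Y} M :=
    { lhom :=
        { base := fun _ => ⟨⟩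
          hom := fun k => ρ.app (FamObj.fam X k) ≫ H.map (incl X k) }
      rhom :=
        { base := fun _ => ⟨⟩
          hom := fun k => ρ.app (FamObj.fam Y k) ≫ H.map (incl Y k) }
      base := fun _ => ⟨⟩
      l_base := fun _ => rfl
      r_base := fun _ => rfl
      cell := fun a _ _ hj hk => ρ.appPro (FamPro.pro M a hj hk) ≫ H.cell (inclCell M a hj hk)
      left_cell := fun a _ _ hj hk => ρ.left_appPro_comp (α := inclCell M a hj hk) rfl
      right_cell := fun a _ _ hj hk => ρ.right_appPro_comp (α := inclCell M a hj hk) rfl }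
  left_appPro _ := rfl
  right_appPro _ := rfl
  naturalityPro α := by
    refine FamCell.ext' ?_ ?_ (fun _ => rfl) fun a j k hj hk =>
      heq_of_eq (ρ.cell_appPro_comp (cell_comp_inclCell α a hj hk))
    · exact FamHom.ext' (fun _ => rfl) fun k => heq_of_eq
        ((ρ.map_app_comp (map_comp_incl (FamCell.lhom α) k)).trans
          (congrArg (_ ≫ ·) (H.left_cell α).symm))
    · exact FamHom.ext' (fun _ => rfl) fun k => heq_of_eq
        ((ρ.map_app_comp (map_comp_incl (FamCell.rhom α) k)).trans
          (congrArg (_ ≫ ·) (H.right_cell α).symm))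
  comp_cmp {X Y Z} M N := by
    have hl : ∀ {X : (DblFam.{i} D).Obj} (k : FamObj.idx X) {g : H.obj X ⟶ H.obj X},
        g = 𝟙 _ → 𝟙 _ ≫ ρ.app (FamObj.fam X k) ≫ H.map (incl X k) =
          (ρ.app (FamObj.fam X k) ≫ H.map (incl X k)) ≫ g ≫ 𝟙 _ := fun k g h => by
      rw [h]; simp
    refine FamCell.ext' ?_ ?_ (fun _ => rfl) fun p j k hj hk => heq_of_eq
      (ρ.cmp_appPro_comp (inclCell_hcomp M N p hj hk)
        ((ρ.right_appPro_comp (α := inclCell M p.fst hj p.fst_eq) rfl).trans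
          (ρ.left_appPro_comp (α := inclCell N p.snd p.snd_eq hk) rfl).symm))
    · exact FamHom.ext' (fun _ => rfl) fun k => heq_of_eq (hl k (H.left_cmp M N))
    · exact FamHom.ext' (fun _ => rfl) fun k => heq_of_eq (hl k (H.right_cmp M N))
  comp_idcmp X := by
    have hl : ∀ (k : FamObj.idx X) {g : H.obj X ⟶ H.obj X},
        g = 𝟙 _ → 𝟙 _ ≫ ρ.app (FamObj.fam X k) ≫ H.map (incl X k) =
          (ρ.app (FamObj.fam X k) ≫ H.map (incl X k)) ≫ g ≫ 𝟙 _ := fun k g h => by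
      rw [h]; simp
    refine FamCell.ext' ?_ ?_ (fun _ => rfl) ?_
    · exact FamHom.ext' (fun _ => rfl) fun k => heq_of_eq (hl k (H.left_idcmp X))
    · exact FamHom.ext' (fun _ => rfl) fun k => heq_of_eq (hl k (H.right_idcmp X))
    · rintro k _ _ rfl rfl
      exact heq_of_eq (ρ.idcmp_appPro_comp (inclCell_hid X k))

/-- If `H` preserves coproducts and `K ≅ Δ ⋙ H`, then the value of `H` at a family is the coproduct
of the values of `K` at its members. -/
theorem densTrans_universal (hH : PreservesUniversal.{i} H) (ρ : K ⟶ (Delta.{i} D).comp H)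
    [IsIso ρ] : (densTrans (TransInto.ofTrans ρ)).Universal where
  app X := by
    exact IsUniversal.of_eq (ColaxFunctor.UniversalArrow.iso_comp
      (hH.arrow (densArrow_universal X)) (famTransApp ρ X) (isIso_famTransApp ρ X))
      (FamHom.ext' (fun _ => rfl) fun _ => HEq.rfl)
  appPro M := by
    exact IsUniversal.of_eq (ColaxFunctor.UniversalCell.iso_comp
      (hH.cell (densCell_universal M)) (famTransAppPro ρ M) (isIso_famTransAppPro ρ M))
      (FamCell.ext' rfl rfl (fun _ => rfl) fun _ _ _ _ _ => HEq.rfl)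

/-- Coproduct-preserving extensions of `F` along `Δ` are unique up to a compatible isomorphism. -/
theorem exists_iso_of_preservesUniversal {F : ColaxFunctor D E}
    {G H : ColaxFunctor (DblFam.{i} D) E} (hG : PreservesUniversal.{i} G)
    (hH : PreservesUniversal.{i} H) (σ : (Delta.{i} D).comp G ≅ F)
    (τ : (Delta.{i} D).comp H ≅ F) :
    ∃ θ : G ≅ H, DblTrans.whisker (Delta.{i} D) θ.hom ≫ τ.hom = σ.hom := by
  obtain ⟨θ, h₀, h₁⟩ := (densTrans_universal hG σ.inv).exists_iso Delta_isPseudo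
    (densTrans_universal hH τ.inv)
  refine ⟨θ, ?_⟩
  rw [← Iso.eq_comp_inv, ← Iso.inv_comp_eq]
  refine DblTrans.ext (funext fun x => ?_) ?_
  · have h : (σ.inv.app x ≫ G.map (𝟙 ((Delta.{i} D).obj x))) ≫ θ.hom.app ((Delta.{i} D).obj x) =
        τ.inv.app x ≫ H.map (𝟙 ((Delta.{i} D).obj x)) :=
      congrArg (fun t => FamHom.leg (X := single (F.obj x)) t PUnit.unit)
        (h₀ ((Delta.{i} D).obj x))
    rw [G.map_id, H.map_id] at h
    exact (congrArg (· ≫ θ.hom.app _) (Category.comp_id _).symm).trans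
      (h.trans (Category.comp_id _))
  · funext x y m
    have h : (σ.inv.appPro m ≫ G.cell (𝟙 (Proarr.of ((Delta.{i} D).pro m)))) ≫
        θ.hom.appPro ((Delta.{i} D).pro m) =
          τ.inv.appPro m ≫ H.cell (𝟙 (Proarr.of ((Delta.{i} D).pro m))) :=
      congrArg (fun t => FamCell.leg (M := singlePro (F.pro m)) t PUnit.unit rfl rfl)
        (h₁ ((Delta.{i} D).pro m))
    rw [G.cell_id, H.cell_id] at h
    exact (congrArg (· ≫ θ.hom.appPro _) (Category.comp_id _).symm).trans
      (h.trans (Category.comp_id _))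

end Uniqueness

/-! ### Strictification of extensions -/

/-- A replacement of the values of a colax functor on objects and proarrows by isomorphic ones. -/
structure Replacement {C : DblCat.{u₁, v₁, w₁, z₁}} {E : DblCat.{u₂, v₂, w₂, z₂}}
    (G : ColaxFunctor C E) where
  obj : C.Obj → E.Obj
  iso : ∀ x, obj x ≅ G.obj x
  pro : ∀ {x y : C.Obj}, C.Pro x y → E.Pro (obj x) (obj y)
  isoPro : ∀ {x y : C.Obj} (m : C.Pro x y), Proarr.of (pro m) ≅ Proarr.of (G.pro m)
  left_hom : ∀ {x y : C.Obj} (m : C.Pro x y), E.left (isoPro m).hom = (iso x).hom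
  right_hom : ∀ {x y : C.Obj} (m : C.Pro x y), E.right (isoPro m).hom = (iso y).hom

namespace Replacement

variable {C : DblCat.{u₁, v₁, w₁, z₁}} {E : DblCat.{u₂, v₂, w₂, z₂}} {G : ColaxFunctor C E}
  (r : Replacement G)

theorem left_inv {x y : C.Obj} (m : C.Pro x y) : E.left (r.isoPro m).inv = (r.iso x).inv := by
  have h := E.left_comp (r.isoPro m).inv (r.isoPro m).hom
  rw [Iso.inv_hom_id, E.left_id, r.left_hom] at h
  exact ((Iso.eq_comp_inv _).2 h.symm).trans (Category.id_comp _)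

theorem right_inv {x y : C.Obj} (m : C.Pro x y) : E.right (r.isoPro m).inv = (r.iso y).inv := by
  have h := E.right_comp (r.isoPro m).inv (r.isoPro m).hom
  rw [Iso.inv_hom_id, E.right_id, r.right_hom] at h
  exact ((Iso.eq_comp_inv _).2 h.symm).trans (Category.id_comp _)

/-- The composition comparison of the replaced functor. -/
def cmp {x y t : C.Obj} (m : C.Pro x y) (n : C.Pro y t) :
    Proarr.of (r.pro (C.hcomp m n)) ⟶ Proarr.of (E.hcomp (r.pro m) (r.pro n)) :=
  (r.isoPro _).hom ≫ G.cmp m n ≫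
    E.hcompCell (r.isoPro m).inv (r.isoPro n).inv (by rw [r.right_inv, r.left_inv])

theorem cmp_hcompCell {x y t : C.Obj} (m : C.Pro x y) (n : C.Pro y t)
    (h : E.right (r.isoPro m).hom = E.left (r.isoPro n).hom) :
    r.cmp m n ≫ E.hcompCell (r.isoPro m).hom (r.isoPro n).hom h =
      (r.isoPro (C.hcomp m n)).hom ≫ G.cmp m n := by
  rw [cmp, Category.assoc, Category.assoc, ← E.hcompCell_comp,
    E.hcompCell_congr (Iso.inv_hom_id _) (Iso.inv_hom_id _), E.hcompCell_id, Category.comp_id]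

/-- The identity comparison of the replaced functor. -/
def idcmp (x : C.Obj) : Proarr.of (r.pro (C.hid x)) ⟶ Proarr.of (E.hid (r.obj x)) :=
  (r.isoPro _).hom ≫ G.idcmp x ≫ E.hidCell (r.iso x).inv

theorem idcmp_hidCell (x : C.Obj) :
    r.idcmp x ≫ E.hidCell (r.iso x).hom = (r.isoPro (C.hid x)).hom ≫ G.idcmp x := by
  rw [idcmp, Category.assoc, Category.assoc, ← E.hidCell_comp, Iso.inv_hom_id, E.hidCell_id,
    Category.comp_id]

/-- The replaced functor on arrows. -/
def map {x y : C.Obj} (f : x ⟶ y) : r.obj x ⟶ r.obj y :=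
  (r.iso x).hom ≫ G.map f ≫ (r.iso y).inv

theorem map_hom {x y : C.Obj} (f : x ⟶ y) :
    r.map f ≫ (r.iso y).hom = (r.iso x).hom ≫ G.map f := by
  rw [map, Category.assoc, Category.assoc, Iso.inv_hom_id, Category.comp_id]

/-- The replaced functor on cells. -/
def cell {x y x' y' : C.Obj} {m : C.Pro x y} {m' : C.Pro x' y'}
    (α : Proarr.of m ⟶ Proarr.of m') : Proarr.of (r.pro m) ⟶ Proarr.of (r.pro m') :=
  (r.isoPro m).hom ≫ G.cell α ≫ (r.isoPro m').inv

theorem cell_hom {x y x' y' : C.Obj} {m : C.Pro x y} {m' : C.Pro x' y'}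
    (α : Proarr.of m ⟶ Proarr.of m') :
    r.cell α ≫ (r.isoPro m').hom = (r.isoPro m).hom ≫ G.cell α := by
  rw [cell, Category.assoc, Category.assoc, Iso.inv_hom_id, Category.comp_id]

theorem right_hom_eq_left_hom {x y t : C.Obj} (m : C.Pro x y) (n : C.Pro y t) :
    E.right (r.isoPro m).hom = E.left (r.isoPro n).hom := by
  rw [r.right_hom, r.left_hom]

theorem left_cmp {x y t : C.Obj} (m : C.Pro x y) (n : C.Pro y t) :
    E.left (r.cmp m n) = 𝟙 (r.obj x) := by
  simp [cmp, r.left_hom, r.left_inv]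

theorem right_cmp {x y t : C.Obj} (m : C.Pro x y) (n : C.Pro y t) :
    E.right (r.cmp m n) = 𝟙 (r.obj t) := by
  simp [cmp, r.right_hom, r.right_inv]

theorem left_idcmp (x : C.Obj) : E.left (r.idcmp x) = 𝟙 (r.obj x) := by
  simp [idcmp, r.left_hom]

theorem right_idcmp (x : C.Obj) : E.right (r.idcmp x) = 𝟙 (r.obj x) := by
  simp [idcmp, r.right_hom]

theorem left_cell {x y x' y' : C.Obj} {m : C.Pro x y} {m' : C.Pro x' y'}
    (α : Proarr.of m ⟶ Proarr.of m') : E.left (r.cell α) = r.map (C.left α) := by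
  simp [cell, map, r.left_hom, r.left_inv]

theorem right_cell {x y x' y' : C.Obj} {m : C.Pro x y} {m' : C.Pro x' y'}
    (α : Proarr.of m ⟶ Proarr.of m') : E.right (r.cell α) = r.map (C.right α) := by
  simp [cell, map, r.right_hom, r.right_inv]

theorem isIso_hom_hcomp {x y t : C.Obj} (m : C.Pro x y) (n : C.Pro y t) :
    IsIso (E.hcompCell (r.isoPro m).hom (r.isoPro n).hom (r.right_hom_eq_left_hom m n)) :=
  E.isIso_hcompCell _ _ _

/-- Coassociativity can be tested after the invertible composite of `r.isoPro m`, `r.isoPro n` and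
`r.isoPro p`, which carries it to coassociativity of `G`. -/
theorem coassoc {x y t s : C.Obj} (m : C.Pro x y) (n : C.Pro y t) (p : C.Pro t s) :
    r.cmp (C.hcomp m n) p ≫
        E.hcompCell (r.cmp m n) (𝟙 (Proarr.of (r.pro p))) (by rw [right_cmp, E.left_id]) ≫
          (E.assoc (r.pro m) (r.pro n) (r.pro p)).hom =
      r.cell (C.assoc m n p).hom ≫ r.cmp m (C.hcomp n p) ≫
        E.hcompCell (𝟙 (Proarr.of (r.pro m))) (r.cmp n p) (by rw [left_cmp, E.right_id]) := by
  have i₁ := r.isIso_hom_hcomp n p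
  have h₁ : E.right (r.isoPro m).hom = E.left (E.hcompCell (r.isoPro n).hom (r.isoPro p).hom
    (r.right_hom_eq_left_hom n p)) := by rw [E.left_hcompCell, r.right_hom, r.left_hom]
  have i₂ : IsIso (E.hcompCell (r.isoPro m).hom (E.hcompCell (r.isoPro n).hom (r.isoPro p).hom
    (r.right_hom_eq_left_hom n p)) h₁) := E.isIso_hcompCell _ _ _
  rw [← cancel_mono (E.hcompCell (r.isoPro m).hom (E.hcompCell (r.isoPro n).hom (r.isoPro p).hom
    (r.right_hom_eq_left_hom n p)) h₁)]
  have a := E.assoc_naturality (r.isoPro m).hom (r.isoPro n).hom (r.isoPro p).hom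
    (r.right_hom_eq_left_hom m n) (r.right_hom_eq_left_hom n p)
  have e₁ := E.hcompCell_comp (r.cmp m n) (𝟙 (Proarr.of (r.pro p)))
    (E.hcompCell (r.isoPro m).hom (r.isoPro n).hom (r.right_hom_eq_left_hom m n))
    (r.isoPro p).hom (by simp [right_cmp]) (by simp [r.right_hom, r.left_hom])
  have e₂ := E.hcompCell_comp (r.isoPro (C.hcomp m n)).hom (r.isoPro p).hom (G.cmp m n)
    (𝟙 (Proarr.of (G.pro p))) (by simp [r.right_hom, r.left_hom]) (by simp)
  have e₃ := E.hcompCell_comp (𝟙 (Proarr.of (r.pro m))) (r.cmp n p) (r.isoPro m).hom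
    (E.hcompCell (r.isoPro n).hom (r.isoPro p).hom (r.right_hom_eq_left_hom n p))
    (by simp [left_cmp]) (by simp [r.right_hom, r.left_hom])
  have e₄ := E.hcompCell_comp (r.isoPro m).hom (r.isoPro (C.hcomp n p)).hom
    (𝟙 (Proarr.of (G.pro m))) (G.cmp n p) (by simp [r.right_hom, r.left_hom]) (by simp)
  simp only [Category.id_comp, Category.comp_id, r.cmp_hcompCell] at e₁ e₂ e₃ e₄
  simp only [Category.assoc]
  rw [← a, ← reassoc_of% e₁, reassoc_of% e₂, reassoc_of% r.cmp_hcompCell, G.coassoc, ← e₃, e₄,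
    reassoc_of% r.cmp_hcompCell, reassoc_of% r.cell_hom]

theorem left_counit {x y : C.Obj} (m : C.Pro x y) :
    r.cmp (C.hid x) m ≫
        E.hcompCell (r.idcmp x) (𝟙 (Proarr.of (r.pro m))) (by rw [right_idcmp, E.left_id]) ≫
          (E.lunit (r.pro m)).hom =
      r.cell (C.lunit m).hom := by
  rw [← cancel_mono (r.isoPro m).hom]
  have a := E.lunit_naturality (r.isoPro m).hom
  have e₁ := E.hcompCell_comp (r.idcmp x) (𝟙 (Proarr.of (r.pro m))) (E.hidCell (r.iso x).hom)
    (r.isoPro m).hom (by simp [right_idcmp]) (by simp [r.left_hom])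
  have e₂ := E.hcompCell_comp (r.isoPro (C.hid x)).hom (r.isoPro m).hom (G.idcmp x)
    (𝟙 (Proarr.of (G.pro m))) (by simp [r.right_hom, r.left_hom]) (by simp)
  simp only [Category.id_comp, Category.comp_id, r.idcmp_hidCell, r.left_hom] at e₁ e₂ a
  simp only [Category.assoc]
  rw [← a, ← reassoc_of% e₁, reassoc_of% e₂, reassoc_of% r.cmp_hcompCell, G.left_counit,
    r.cell_hom]

theorem right_counit {x y : C.Obj} (m : C.Pro x y) :
    r.cmp m (C.hid y) ≫
        E.hcompCell (𝟙 (Proarr.of (r.pro m))) (r.idcmp y) (by rw [left_idcmp, E.right_id]) ≫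
          (E.runit (r.pro m)).hom =
      r.cell (C.runit m).hom := by
  rw [← cancel_mono (r.isoPro m).hom]
  have a := E.runit_naturality (r.isoPro m).hom
  have e₁ := E.hcompCell_comp (𝟙 (Proarr.of (r.pro m))) (r.idcmp y) (r.isoPro m).hom
    (E.hidCell (r.iso y).hom) (by simp [left_idcmp]) (by simp [r.right_hom])
  have e₂ := E.hcompCell_comp (r.isoPro m).hom (r.isoPro (C.hid y)).hom
    (𝟙 (Proarr.of (G.pro m))) (G.idcmp y) (by simp [r.right_hom, r.left_hom]) (by simp)
  simp only [Category.id_comp, Category.comp_id, r.idcmp_hidCell, r.right_hom] at e₁ e₂ a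
  simp only [Category.assoc]
  rw [← a, ← reassoc_of% e₁, reassoc_of% e₂, reassoc_of% r.cmp_hcompCell, G.right_counit,
    r.cell_hom]

/-- The colax functor with replaced values. -/
def functor : ColaxFunctor C E where
  obj := r.obj
  map := r.map
  map_id x := by simp [map]
  map_comp f g := by simp [map, G.map_comp]
  pro := r.pro
  cell := r.cell
  cell_id m := by simp [cell]
  cell_comp α β := by simp [cell, G.cell_comp]
  left_cell := r.left_cell
  right_cell := r.right_cell
  cmp := r.cmp
  left_cmp := r.left_cmp
  right_cmp := r.right_cmp
  cmp_naturality {x y t x' y' t' m n m' n'} α β h := by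
    have i₁ := r.isIso_hom_hcomp m' n'
    rw [← cancel_mono (E.hcompCell (r.isoPro m').hom (r.isoPro n').hom
      (r.right_hom_eq_left_hom m' n'))]
    have hc : E.right (r.cell α) = E.left (r.cell β) := by rw [r.right_cell, r.left_cell, h]
    have hc' : E.right (G.cell α) = E.left (G.cell β) := by simp [h]
    have e₁ := E.hcompCell_comp (r.cell α) (r.cell β) (r.isoPro m').hom (r.isoPro n').hom hc
      (r.right_hom_eq_left_hom m' n')
    have e₂ := E.hcompCell_comp (r.isoPro m).hom (r.isoPro n).hom (G.cell α) (G.cell β)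
      (r.right_hom_eq_left_hom m n) hc'
    simp only [r.cell_hom] at e₁
    simp only [Category.assoc]
    rw [r.cmp_hcompCell, reassoc_of% r.cell_hom, G.cmp_naturality, ← e₁, e₂,
      reassoc_of% r.cmp_hcompCell]
  idcmp := r.idcmp
  left_idcmp := r.left_idcmp
  right_idcmp := r.right_idcmp
  idcmp_naturality {x y} f := by
    have : IsIso (E.hidCell (r.iso y).hom) := ⟨E.hidCell (r.iso y).inv,
      by rw [← E.hidCell_comp, Iso.hom_inv_id, E.hidCell_id],
      by rw [← E.hidCell_comp, Iso.inv_hom_id, E.hidCell_id]⟩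
    rw [← cancel_mono (E.hidCell (r.iso y).hom)]
    simp only [Category.assoc]
    rw [r.idcmp_hidCell, reassoc_of% r.cell_hom, G.idcmp_naturality, ← E.hidCell_comp, r.map_hom,
      E.hidCell_comp, reassoc_of% r.idcmp_hidCell]
  coassoc := r.coassoc
  left_counit := r.left_counit
  right_counit := r.right_counit

/-- The isomorphism from the replaced functor to the original one. -/
def trans : r.functor ⟶ G where
  app x := (r.iso x).hom
  naturality f := r.map_hom f
  appPro m := (r.isoPro m).hom
  left_appPro := r.left_hom
  right_appPro := r.right_hom
  naturalityPro α := r.cell_hom α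
  comp_cmp m n := r.cmp_hcompCell m n _
  comp_idcmp x := r.idcmp_hidCell x

theorem isIso_trans : IsIso r.trans :=
  (DblTrans.isIso_iff _).2 ⟨fun x => inferInstanceAs (IsIso (r.iso x).hom),
    fun m => inferInstanceAs (IsIso (r.isoPro m).hom)⟩

end Replacement

/-- Two colax functors are equal if there is a natural transformation between them whose components
are identities, up to equality of their end points. -/
theorem ColaxFunctor.eq_of_eqToHom {C : DblCat.{u₁, v₁, w₁, z₁}} {E : DblCat.{u₂, v₂, w₂, z₂}}
    {A B : ColaxFunctor C E} (θ : A ⟶ B)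
    (h₀ : ∀ x, ∃ h : A.obj x = B.obj x, θ.app x = eqToHom h)
    (h₁ : ∀ {x y : C.Obj} (m : C.Pro x y), ∃ h : Proarr.of (A.pro m) = Proarr.of (B.pro m),
      θ.appPro m = eqToHom h) : A = B := by
  obtain ⟨a, nat, b, _, _, natPro, ccmp, cid⟩ := θ
  obtain ⟨Ao, Am, _, _, Ap, Ac, _, _, _, _, Acmp, _, _, _, Aid, _, _, _, _, _, _⟩ := A
  obtain ⟨Bo, Bm, _, _, Bp, Bc, _, _, _, _, Bcmp, _, _, _, Bid, _, _, _, _, _, _⟩ := B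
  dsimp only at a b h₀ h₁ nat natPro ccmp cid
  obtain rfl : Ao = Bo := funext fun x => (h₀ x).choose
  obtain rfl : @Ap = @Bp := by
    funext x y m
    obtain ⟨h, -⟩ := h₁ m
    injection h
  have ha : a = fun x => 𝟙 (Ao x) := funext fun x => (h₀ x).choose_spec
  have hb : @b = fun x y m => 𝟙 (Proarr.of (Ap m)) := by
    funext x y m
    exact (h₁ m).choose_spec
  subst ha hb
  congr 1
  · funext x y f
    exact (Category.comp_id _).symm.trans ((nat f).trans (Category.id_comp _))
  · funext x y x' y' m m' α
    exact (Category.comp_id _).symm.trans ((natPro α).trans (Category.id_comp _))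
  · funext x y t m n
    refine Eq.trans ?_ ((ccmp m n).trans (Category.id_comp _))
    rw [E.hcompCell_id, Category.comp_id]
  · funext x
    refine Eq.trans ?_ ((cid x).trans (Category.id_comp _))
    rw [E.hidCell_id, Category.comp_id]

section Strictification

variable {D : DblCat.{u₁, v₁, w₁, z₁}} {C : DblCat.{u₂, v₂, w₂, z₂}}
  {E : DblCat.{u₃, v₃, w₃, z₃}} {J : ColaxFunctor D C} {G : ColaxFunctor C E}
  {F : ColaxFunctor D E}

/-- The values of `G` at the objects `J x` are replaced by `F x`. -/
theorem exists_obj_replacement (hJ : Function.Injective J.obj)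
    (s : ∀ x, G.obj (J.obj x) ≅ F.obj x) (X : C.Obj) :
    ∃ (o : E.Obj) (e : o ≅ G.obj X), ∀ (x : D.Obj) (h : J.obj x = X), ∃ h' : o = F.obj x,
      e.hom ≫ G.map (eqToHom h.symm) ≫ (s x).hom = eqToHom h' := by
  by_cases hX : ∃ x, J.obj x = X
  · obtain ⟨x, rfl⟩ := hX
    refine ⟨F.obj x, (s x).symm, fun x' h => ?_⟩
    obtain rfl := hJ h
    exact ⟨rfl, by simp⟩
  · exact ⟨G.obj X, Iso.refl _, fun x h => absurd ⟨x, h⟩ hX⟩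

/-- The values of `G` at the proarrows `J m` are replaced by `F m`, and the other ones are
transported along the isomorphisms of their source and target. -/
theorem exists_pro_replacement (hE : HorizontallyInvariant E)
    (hJ : ∀ {x y x' y' : D.Obj} {m : D.Pro x y} {m' : D.Pro x' y'},
      Proarr.of (J.pro m) = Proarr.of (J.pro m') → Proarr.of m = Proarr.of m')
    (s : ∀ x, G.obj (J.obj x) ≅ F.obj x)
    (t : ∀ {x y : D.Obj} (m : D.Pro x y), Proarr.of (G.pro (J.pro m)) ≅ Proarr.of (F.pro m))
    (ht : ∀ {x y : D.Obj} (m : D.Pro x y), E.left (t m).inv = (s x).inv ∧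
      E.right (t m).inv = (s y).inv)
    {o : C.Obj → E.Obj} (e : ∀ X, o X ≅ G.obj X)
    (he : ∀ (X : C.Obj) (x : D.Obj) (h : J.obj x = X), ∃ h' : o X = F.obj x,
      (e X).hom ≫ G.map (eqToHom h.symm) ≫ (s x).hom = eqToHom h')
    {X Y : C.Obj} (M : C.Pro X Y) :
    ∃ (p : E.Pro (o X) (o Y)) (φ : Proarr.of p ≅ Proarr.of (G.pro M)),
      E.left φ.hom = (e X).hom ∧ E.right φ.hom = (e Y).hom ∧
      ∀ {x y : D.Obj} (m : D.Pro x y) (h : Proarr.of (J.pro m) = Proarr.of M),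
        ∃ h' : Proarr.of p = Proarr.of (F.pro m),
          φ.hom ≫ G.cell (eqToHom h.symm) ≫ (t m).hom = eqToHom h' := by
  by_cases hM : ∃ (x y : D.Obj) (m : D.Pro x y), Proarr.of (J.pro m) = Proarr.of M
  · obtain ⟨x, y, m, h⟩ := hM
    obtain ⟨rfl, rfl, h⟩ := Proarr.of.inj h
    obtain rfl := eq_of_heq h
    have key : ∀ {a b : E.Obj} (f : a ≅ G.obj (J.obj x)) (g : b ≅ G.obj (J.obj y))
        (ha : a = F.obj x) (hb : b = F.obj y), f.hom ≫ (s x).hom = eqToHom ha →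
        g.hom ≫ (s y).hom = eqToHom hb →
        ∃ (p : E.Pro a b) (φ : Proarr.of p ≅ Proarr.of (G.pro (J.pro m))),
          E.left φ.hom = f.hom ∧ E.right φ.hom = g.hom ∧
          ∃ h' : Proarr.of p = Proarr.of (F.pro m), φ.hom ≫ (t m).hom = eqToHom h' := by
      intro a b f g ha hb hf hg
      subst ha hb
      refine ⟨F.pro m, (t m).symm, ?_, ?_, rfl, (t m).inv_hom_id⟩
      · refine (ht m).1.trans ((Iso.eq_comp_inv (s x)).2 hf |>.trans ?_).symm
        exact Category.id_comp _
      · refine (ht m).2.trans ((Iso.eq_comp_inv (s y)).2 hg |>.trans ?_).symm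
        exact Category.id_comp _
    obtain ⟨ha, ha'⟩ := he _ x rfl
    obtain ⟨hb, hb'⟩ := he _ y rfl
    rw [eqToHom_refl, G.map_id, Category.id_comp] at ha' hb'
    obtain ⟨p, φ, hl, hr, h', hφ⟩ := key (e _) (e _) ha hb ha' hb'
    refine ⟨p, φ, hl, hr, fun {x' y'} m' h => ?_⟩
    obtain ⟨rfl, rfl, hm'⟩ := Proarr.of.inj (hJ h)
    obtain rfl := eq_of_heq hm'
    refine ⟨h', ?_⟩
    rw [eqToHom_refl, G.cell_id, Category.id_comp, hφ]
  · obtain ⟨p, φ, hl, hr⟩ := hE (G.pro M) (e X) (e Y)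
    exact ⟨p, φ, hl, hr, fun m h => absurd ⟨_, _, m, h⟩ hM⟩

/-- In a horizontally invariant double category, an extension of `F` along `J` up to isomorphism can
be replaced by an isomorphic one that extends `F` strictly, if `J` is injective on objects and
proarrows. -/
theorem exists_strict_extension (hE : HorizontallyInvariant E)
    (hJ₀ : Function.Injective J.obj)
    (hJ₁ : ∀ {x y x' y' : D.Obj} {m : D.Pro x y} {m' : D.Pro x' y'},
      Proarr.of (J.pro m) = Proarr.of (J.pro m') → Proarr.of m = Proarr.of m')
    (σ : J.comp G ≅ F) : ∃ (G' : ColaxFunctor C E) (ρ : G' ⟶ G), IsIso ρ ∧ J.comp G' = F := by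
  let s : ∀ x, G.obj (J.obj x) ≅ F.obj x := fun x => ⟨σ.hom.app x, σ.inv.app x,
    congrArg (fun θ => DblTrans.app θ x) σ.hom_inv_id,
    congrArg (fun θ => DblTrans.app θ x) σ.inv_hom_id⟩
  let t : ∀ {x y : D.Obj} (m : D.Pro x y), Proarr.of (G.pro (J.pro m)) ≅ Proarr.of (F.pro m) :=
    fun m => ⟨σ.hom.appPro m, σ.inv.appPro m,
      congrArg (fun θ => DblTrans.appPro θ m) σ.hom_inv_id,
      congrArg (fun θ => DblTrans.appPro θ m) σ.inv_hom_id⟩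
  choose o e he using exists_obj_replacement hJ₀ s
  have h := fun {X Y : C.Obj} (M : C.Pro X Y) => exists_pro_replacement hE hJ₁ s t
    (fun m => ⟨σ.inv.left_appPro m, σ.inv.right_appPro m⟩) e he M
  choose p φ hl hr hφ using @h
  let r : Replacement G := ⟨o, e, p, φ, hl, hr⟩
  refine ⟨r.functor, r.trans, r.isIso_trans, ?_⟩
  refine ColaxFunctor.eq_of_eqToHom (DblTrans.whisker J r.trans ≫ σ.hom) (fun x => ?_)
    (fun m => ?_)
  · obtain ⟨h', hh⟩ := he (J.obj x) x rfl
    rw [eqToHom_refl, G.map_id, Category.id_comp] at hh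
    exact ⟨h', hh⟩
  · obtain ⟨h', hh⟩ := hφ (J.pro m) m rfl
    rw [eqToHom_refl, G.cell_id, Category.id_comp] at hh
    exact ⟨h', hh⟩

end Strictification

/-! ### The free coproduct completion -/

/-- A criterion for free coproduct completions, in terms of preservation of coproduct cocones.  The
strict extensions come from strictification. -/
theorem IsFreeCoproductCompletion.of_preservesUniversal {D : DblCat.{u₁, v₁, w₁, z₁}}
    {C : DblCat.{u₂, v₂, w₂, z₂}} {J : ColaxFunctor D C} (hC : HasColaxCoproducts.{i} C)
    (hJ₀ : Function.Injective J.obj)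
    (hJ₁ : ∀ {x y x' y' : D.Obj} {m : D.Pro x y} {m' : D.Pro x' y'},
      Proarr.of (J.pro m) = Proarr.of (J.pro m') → Proarr.of m = Proarr.of m')
    (exists_extension : ∀ (E : DblCat.{u₃, v₃, w₃, z₃}) (_ : Coproducts.{i} E)
      (F : ColaxFunctor D E), ∃ G : ColaxFunctor C E,
        PreservesUniversal.{i} G ∧ Nonempty (J.comp G ≅ F))
    (exists_iso : ∀ (E : DblCat.{u₃, v₃, w₃, z₃}) (F : ColaxFunctor D E) (G H : ColaxFunctor C E),
      PreservesUniversal.{i} G → PreservesUniversal.{i} H →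
        ∀ (σ : J.comp G ≅ F) (τ : J.comp H ≅ F),
          ∃ θ : G ≅ H, DblTrans.whisker J θ.hom ≫ τ.hom = σ.hom) :
    IsFreeCoproductCompletion.{i, u₁, v₁, w₁, z₁, u₂, v₂, w₂, z₂, u₃, v₃, w₃, z₃} J := by
  refine ⟨hC, fun E c d F => ⟨?_, fun hE => ?_, fun G H hG hH σ τ => ?_⟩⟩
  · obtain ⟨G, hG, h⟩ := exists_extension E d F
    exact ⟨G, hG.preservesCoproducts c d, h⟩
  · obtain ⟨G, hG, ⟨σ⟩⟩ := exists_extension E d F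
    obtain ⟨G', ρ, hρ, h⟩ := exists_strict_extension hE hJ₀ hJ₁ σ
    exact ⟨G', (hG.of_iso ρ).preservesCoproducts c d, h⟩
  · exact exists_iso E F G H hG.preservesUniversal hH.preservesUniversal σ τ

theorem Delta_obj_injective (D : DblCat.{u, v, w, z}) :
    Function.Injective (Delta.{i} D).obj := fun x y h => by
  obtain ⟨-, h⟩ := FamObj.mk.inj h
  exact congrFun (eq_of_heq h) PUnit.unit

theorem Delta_pro_injective (D : DblCat.{u, v, w, z}) {x y x' y' : D.Obj} {m : D.Pro x y}
    {m' : D.Pro x' y'} (h : Proarr.of ((Delta.{i} D).pro m) = Proarr.of ((Delta.{i} D).pro m')) :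
    Proarr.of m = Proarr.of m' := by
  obtain ⟨hx, hy, h⟩ := Proarr.of.inj h
  obtain rfl := Delta_obj_injective D hx
  obtain rfl := Delta_obj_injective D hy
  obtain ⟨-, -, -, h⟩ := FamPro.mk.inj (eq_of_heq h)
  have h' : m = m' :=
    congrFun (congrFun (congrFun (congrFun (congrFun (eq_of_heq h) PUnit.unit) PUnit.unit)
      PUnit.unit) rfl) rfl
  rw [h']

theorem isFreeCoproductCompletion_Delta (D : DblCat.{u, v, w, z}) :
    IsFreeCoproductCompletion.{i, u, v, w, z, max u (i + 1), max v i, max w (i + 1),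
      max z v i, u₁, v₁, w₁, z₁} (Delta.{i} D) :=
  .of_preservesUniversal (hasStrongCoproducts_DblFam D).nonempty (Delta_obj_injective D)
    (Delta_pro_injective D)
    (fun _ d F => ⟨(famMap F).comp d.L, (preservesUniversal_famMap F).comp d.preservesUniversal,
      Delta_comp_extension d F⟩)
    (fun _ _ _ _ hG hH σ τ => exists_iso_of_preservesUniversal hG hH σ τ)

/-! ### Spans as families over the terminal double category -/

/-- A family of objects of the terminal double category is a set, and a family of proarrows is a
span of sets. -/
def famToSpan : ColaxFunctor (DblFam.{i} One) Span.{i} where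
  obj X := FamObj.idx X
  map f := TypeCat.ofHom (FamHom.base f)
  map_id _ := rfl
  map_comp _ _ := rfl
  pro M := ⟨FamPro.apex M, FamPro.l M, FamPro.r M⟩
  cell α := ⟨TypeCat.ofHom (FamHom.base (FamCell.lhom α)),
    TypeCat.ofHom (FamHom.base (FamCell.rhom α)), FamCell.base α, FamCell.l_base α,
    FamCell.r_base α⟩
  cell_id _ := rfl
  cell_comp _ _ := rfl
  left_cell _ := rfl
  right_cell _ := rfl
  cmp _ _ := 𝟙 _
  left_cmp _ _ := rfl
  right_cmp _ _ := rfl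
  cmp_naturality _ _ _ := rfl
  idcmp _ := 𝟙 _
  left_idcmp _ := rfl
  right_idcmp _ := rfl
  idcmp_naturality _ := rfl
  coassoc _ _ _ := rfl
  left_counit _ := rfl
  right_counit _ := rfl

/-- The inverse of `famToSpan`. -/
def spanToFam : ColaxFunctor Span.{i} (DblFam.{i} One) where
  obj I := ⟨I, fun _ => ⟨⟩⟩
  map f := ⟨(ConcreteCategory.hom (C := Type i) f).toFun, fun _ => ⟨⟩⟩
  map_id _ := rfl
  map_comp _ _ := rfl
  pro M := ⟨SpanPro.apex M, SpanPro.l M, SpanPro.r M, fun _ _ _ _ _ => ⟨⟩⟩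
  cell α := ⟨⟨fun x => SpanCell.lhom α x, fun _ => ⟨⟩⟩,
    ⟨fun x => SpanCell.rhom α x, fun _ => ⟨⟩⟩, SpanCell.base α,
    SpanCell.l_base α, SpanCell.r_base α, fun _ _ _ _ _ => ⟨⟩, fun _ _ _ _ _ => rfl,
    fun _ _ _ _ _ => rfl⟩
  cell_id _ := rfl
  cell_comp _ _ := rfl
  left_cell _ := rfl
  right_cell _ := rfl
  cmp _ _ := 𝟙 _
  left_cmp _ _ := rfl
  right_cmp _ _ := rfl
  cmp_naturality _ _ _ := rfl
  idcmp _ := 𝟙 _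
  left_idcmp _ := rfl
  right_idcmp _ := rfl
  idcmp_naturality _ := rfl
  coassoc _ _ _ := rfl
  left_counit _ := rfl
  right_counit _ := rfl

theorem famToSpan_isStrict : famToSpan.{i}.IsStrict :=
  ⟨fun _ _ => ⟨rfl, rfl⟩, fun _ => ⟨rfl, rfl⟩⟩

theorem spanToFam_isStrict : spanToFam.{i}.IsStrict :=
  ⟨fun _ _ => ⟨rfl, rfl⟩, fun _ => ⟨rfl, rfl⟩⟩

theorem famToSpan_comp_spanToFam :
    famToSpan.{i}.comp spanToFam = ColaxFunctor.idFunctor (DblFam.{i} One) := rfl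

theorem spanToFam_comp_famToSpan :
    spanToFam.{i}.comp famToSpan = ColaxFunctor.idFunctor Span.{i} := rfl

theorem Delta_comp_famToSpan : (Delta.{i} One).comp famToSpan = point.{i} := rfl

/-! ### Coproducts of sets and spans -/

/-- An isomorphism of double categories preserves universal cocones: cocones are transported along
its inverse. -/
theorem preservesUniversal_famToSpan : PreservesUniversal.{i} famToSpan.{i} where
  arrow {X a f} hf := by
    refine ColaxFunctor.UniversalArrow.intro (fun b g => ?_) (fun b g h e => ?_)
    · exact ⟨famToSpan.map (hf.desc (b := spanToFam.obj b) ((famMap.{i} spanToFam).map g)),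
        congrArg (fun t => (famMap.{i} famToSpan).map t)
          (hf.fac (b := spanToFam.obj b) ((famMap.{i} spanToFam).map g))⟩
    · have e' := congrArg (fun t => (famMap.{i} spanToFam).map t) e
      exact congrArg (fun t => famToSpan.map t)
        (hf.ext (g := spanToFam.map g) (h := spanToFam.map h) e')
  cell {X Y M a b n φ} hφ := by
    refine ColaxFunctor.UniversalCell.intro (fun p ψ => ?_) (fun p α β e => ?_)
    · exact ⟨famToSpan.cell (hφ.desc (p := spanToFam.pro p) ((famMap.{i} spanToFam).cell ψ)),
        congrArg (fun t => (famMap.{i} famToSpan).cell t)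
          (hφ.fac (p := spanToFam.pro p) ((famMap.{i} spanToFam).cell ψ))⟩
    · have e' := congrArg (fun t => (famMap.{i} spanToFam).cell t) e
      exact congrArg (fun t => famToSpan.cell t)
        (hφ.ext (α := spanToFam.cell α) (β := spanToFam.cell β) e')

theorem preservesUniversal_spanToFam : PreservesUniversal.{i} spanToFam.{i} where
  arrow {X a f} hf := by
    refine ColaxFunctor.UniversalArrow.intro (fun b g => ?_) (fun b g h e => ?_)
    · exact ⟨spanToFam.map (hf.desc (b := famToSpan.obj b) ((famMap.{i} famToSpan).map g)),
        congrArg (fun t => (famMap.{i} spanToFam).map t)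
          (hf.fac (b := famToSpan.obj b) ((famMap.{i} famToSpan).map g))⟩
    · have e' := congrArg (fun t => (famMap.{i} famToSpan).map t) e
      exact congrArg (fun t => spanToFam.map t)
        (hf.ext (g := famToSpan.map g) (h := famToSpan.map h) e')
  cell {X Y M a b n φ} hφ := by
    refine ColaxFunctor.UniversalCell.intro (fun p ψ => ?_) (fun p α β e => ?_)
    · exact ⟨spanToFam.cell (hφ.desc (p := famToSpan.pro p) ((famMap.{i} famToSpan).cell ψ)),
        congrArg (fun t => (famMap.{i} spanToFam).cell t)
          (hφ.fac (p := famToSpan.pro p) ((famMap.{i} famToSpan).cell ψ))⟩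
    · have e' := congrArg (fun t => (famMap.{i} famToSpan).cell t) e
      exact congrArg (fun t => spanToFam.cell t)
        (hφ.ext (α := famToSpan.cell α) (β := famToSpan.cell β) e')

/-- Coproducts of sets and of spans, obtained from those of families. -/
def spanData : UniversalData (Delta.{i} Span.{i}) where
  obj X := famToSpan.obj (flatObj ((famMap.{i} spanToFam).obj X))
  arrow X := (famMap.{i} famToSpan).map (flatArrow ((famMap.{i} spanToFam).obj X))
  arrow_universal _ := preservesUniversal_famToSpan.arrow (flatArrow_universal _)
  pro M := famToSpan.pro (flatPro ((famMap.{i} spanToFam).pro M))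
  cell M := (famMap.{i} famToSpan).cell (flatCell ((famMap.{i} spanToFam).pro M))
  left_cell _ := rfl
  right_cell _ := rfl
  cell_universal _ := preservesUniversal_famToSpan.cell (flatCell_universal _)

/-- The disjoint union of identity spans is an identity span. -/
def spanIdcmp (X : (DblFam.{i} Span.{i}).Obj) :
    Proarr.of (spanData.{i}.pro ((DblFam.{i} Span.{i}).hid X)) ≅
      Proarr.of (Span.{i}.hid (spanData.{i}.obj X)) where
  hom :=
    { lhom := 𝟙 _
      rhom := 𝟙 _
      base := fun p =>
        match p with
        | ⟨a, _, _, rfl, rfl, b⟩ => ⟨a, b⟩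
      l_base := fun p =>
        match p with
        | ⟨_, _, _, rfl, rfl, _⟩ => rfl
      r_base := fun p =>
        match p with
        | ⟨_, _, _, rfl, rfl, _⟩ => rfl }
  inv :=
    { lhom := 𝟙 _
      rhom := 𝟙 _
      base := fun p => ⟨p.1, p.1, p.1, rfl, rfl, p.2⟩
      l_base := fun _ => rfl
      r_base := fun _ => rfl }
  hom_inv_id := SpanCell.ext rfl rfl (funext fun p =>
    match p with
    | ⟨_, _, _, rfl, rfl, _⟩ => rfl)
  inv_hom_id := rfl

/-- The comparison cells of coproducts of spans are the images under `famToSpan` of those of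
coproducts of families. -/
theorem hasStrongCoproducts_Span : HasStrongCoproducts.{i} Span.{i} := by
  obtain ⟨c, hc⟩ := spanData.{i}.exists_leftAdjoint Delta_isPseudo
  refine ⟨c, ?_⟩
  rw [hc]
  refine spanData.{i}.functor_isPseudo Delta_isPseudo
    (fun M N => ⟨famToSpan.cell (flatCmp ((famMap.{i} spanToFam).pro M)
      ((famMap.{i} spanToFam).pro N)), ?_, ?_⟩)
    (fun X => ⟨(spanIdcmp X).hom, inferInstance, ?_⟩)
  · exact @ColaxFunctor.isIso_cell _ _ famToSpan _ _ _ _ _ _ _ (isIso_flatCmp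
      ((famMap.{i} spanToFam).pro M) ((famMap.{i} spanToFam).pro N))
  · exact congrArg (fun t => (famMap.{i} famToSpan).cell t)
      (flatCell_hcomp ((famMap.{i} spanToFam).pro M) ((famMap.{i} spanToFam).pro N))
  · refine FamCell.ext' rfl rfl (fun _ => rfl) ?_
    rintro a j k rfl rfl
    rfl

/-! ### Spans as the free coproduct completion of the terminal double category -/

theorem point_comp_spanToFam : point.{i}.comp spanToFam = Delta.{i} One := by
  rw [← Delta_comp_famToSpan, ColaxFunctor.comp_assoc, famToSpan_comp_spanToFam,
    ColaxFunctor.comp_idFunctor]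

theorem DblTrans.isIso_whisker {B : DblCat.{u₁, v₁, w₁, z₁}} {C : DblCat.{u₂, v₂, w₂, z₂}}
    {D : DblCat.{u₃, v₃, w₃, z₃}} (J : ColaxFunctor B C) {G H : ColaxFunctor C D} (θ : G ⟶ H)
    (h : IsIso θ) : IsIso (DblTrans.whisker J θ) :=
  have h := (DblTrans.isIso_iff θ).1 h
  (DblTrans.isIso_iff _).2 ⟨fun x => h.1 (J.obj x), fun m => h.2 (J.pro m)⟩

/-- Extensions along `point` are extensions along `Δ`, precomposed with `spanToFam`. -/
theorem isFreeCoproductCompletion_point :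
    IsFreeCoproductCompletion.{i, 0, 0, 0, 0, i + 1, i, i + 1, i, u₁, v₁, w₁, z₁} point.{i} := by
  refine .of_preservesUniversal hasStrongCoproducts_Span.nonempty (fun _ _ _ => rfl)
    (fun _ => rfl) (fun E d F => ?_) (fun E F G H hG hH σ τ => ?_)
  · refine ⟨spanToFam.comp ((famMap F).comp d.L), preservesUniversal_spanToFam.comp
      ((preservesUniversal_famMap F).comp d.preservesUniversal), ?_⟩
    rw [← ColaxFunctor.comp_assoc, point_comp_spanToFam]
    exact Delta_comp_extension d F
  · have e : ∀ K : ColaxFunctor Span.{i} E,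
        (Delta.{i} One).comp (famToSpan.comp K) = point.comp K := fun K => by
      rw [← ColaxFunctor.comp_assoc, Delta_comp_famToSpan]
    have e' : ∀ K : ColaxFunctor Span.{i} E, spanToFam.comp (famToSpan.comp K) = K := fun K => by
      rw [← ColaxFunctor.comp_assoc, spanToFam_comp_famToSpan, ColaxFunctor.idFunctor_comp]
    obtain ⟨θ, hθ⟩ := exists_iso_of_preservesUniversal (preservesUniversal_famToSpan.comp hG)
      (preservesUniversal_famToSpan.comp hH) (eqToIso (e G) ≪≫ σ) (eqToIso (e H) ≪≫ τ)
    have := DblTrans.isIso_whisker spanToFam θ.hom inferInstance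
    -- The components of these equalities of colax functors are identities.
    have h₀ : ∀ {A B : ColaxFunctor Span.{i} E} (h : A = B) (x : Type i) (h' : A.obj x = B.obj x),
        DblTrans.app (eqToHom h) x = eqToHom h' := fun h x _ => DblTrans.eqToHom_app h x
    have h₁ : ∀ {A B : ColaxFunctor Span.{i} E} (h : A = B) {x y : Type i} (m : SpanPro x y)
        (h' : Proarr.of (A.pro m) = Proarr.of (B.pro m)),
        DblTrans.appPro (eqToHom h) m = eqToHom h' := fun h _ _ m _ => DblTrans.eqToHom_appPro h m
    have k₀ : ∀ {A B : ColaxFunctor One E} (h : A = B) (x : One.Obj) (h' : A.obj x = B.obj x),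
        DblTrans.app (eqToHom h) x = eqToHom h' := fun h x _ => DblTrans.eqToHom_app h x
    have k₁ : ∀ {A B : ColaxFunctor One E} (h : A = B) {x y : One.Obj} (m : One.Pro x y)
        (h' : Proarr.of (A.pro m) = Proarr.of (B.pro m)),
        DblTrans.appPro (eqToHom h) m = eqToHom h' := fun h _ _ m _ => DblTrans.eqToHom_appPro h m
    refine ⟨eqToIso (e' G).symm ≪≫ asIso (DblTrans.whisker spanToFam θ.hom) ≪≫ eqToIso (e' H),
      DblTrans.ext (funext fun x => ?_) ?_⟩
    · have h : θ.hom.app (single x) ≫ DblTrans.app (eqToHom (e H)) x ≫ τ.hom.app x =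
          DblTrans.app (eqToHom (e G)) x ≫ σ.hom.app x := congrArg (fun t => DblTrans.app t x) hθ
      rw [k₀ (e H) x rfl, k₀ (e G) x rfl] at h
      have g : (DblTrans.app (eqToHom (e' G).symm) PUnit ≫ θ.hom.app (single x) ≫
          DblTrans.app (eqToHom (e' H)) PUnit) ≫ τ.hom.app x = σ.hom.app x := by
        rw [h₀ (e' G).symm PUnit rfl, h₀ (e' H) PUnit rfl]
        refine Eq.trans ?_ (h.trans (Category.id_comp _))
        refine (Category.assoc _ _ _).trans ((Category.id_comp _).trans (Category.assoc _ _ _))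
      exact g
    · funext x y m
      have h : θ.hom.appPro (singlePro m) ≫ DblTrans.appPro (eqToHom (e H)) m ≫ τ.hom.appPro m =
          DblTrans.appPro (eqToHom (e G)) m ≫ σ.hom.appPro m :=
        congrArg (fun t => DblTrans.appPro t m) hθ
      rw [k₁ (e H) m rfl, k₁ (e G) m rfl] at h
      have g : (DblTrans.appPro (eqToHom (e' G).symm) (point.{i}.pro m) ≫
          θ.hom.appPro (singlePro m) ≫
            DblTrans.appPro (eqToHom (e' H)) (point.{i}.pro m)) ≫ τ.hom.appPro m =
          σ.hom.appPro m := by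
        rw [h₁ (e' G).symm (point.{i}.pro m) rfl, h₁ (e' H) (point.{i}.pro m) rfl]
        refine Eq.trans ?_ (h.trans (Category.id_comp _))
        refine (Category.assoc _ _ _).trans ((Category.id_comp _).trans (Category.assoc _ _ _))
      exact g

end Dbl

theorem mainTheorem1 (D : Dbl.DblCat.{u, v, w, z}) :
    (Dbl.HasStrongCoproducts.{i} (Dbl.DblFam.{i} D) ∧
      Dbl.IsFreeCoproductCompletion.{i, u, v, w, z, max u (i + 1), max v i, max w (i + 1),
        max z v i, u₁, v₁, w₁, z₁} (Dbl.Delta.{i} D)) ∧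
    (∃ (P : Dbl.ColaxFunctor (Dbl.DblFam.{i} Dbl.One) Dbl.Span.{i})
        (Q : Dbl.ColaxFunctor Dbl.Span.{i} (Dbl.DblFam.{i} Dbl.One)),
      P.IsStrict ∧ Q.IsStrict ∧
        P.comp Q = Dbl.ColaxFunctor.idFunctor (Dbl.DblFam.{i} Dbl.One) ∧
        Q.comp P = Dbl.ColaxFunctor.idFunctor Dbl.Span.{i} ∧
        (Dbl.Delta.{i} Dbl.One).comp P = Dbl.point.{i}) ∧
    (Dbl.HasStrongCoproducts.{i} Dbl.Span.{i} ∧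
      Dbl.IsFreeCoproductCompletion.{i, 0, 0, 0, 0, i + 1, i, i + 1, i, u₁, v₁, w₁, z₁}
        Dbl.point.{i}) := by
  exact ⟨⟨Dbl.hasStrongCoproducts_DblFam D, Dbl.isFreeCoproductCompletion_Delta D⟩,
    ⟨Dbl.famToSpan, Dbl.spanToFam, Dbl.famToSpan_isStrict, Dbl.spanToFam_isStrict,
      Dbl.famToSpan_comp_spanToFam, Dbl.spanToFam_comp_famToSpan, Dbl.Delta_comp_famToSpan⟩,
    Dbl.hasStrongCoproducts_Span, Dbl.isFreeCoproductCompletion_point⟩
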